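/- **Setting.** Let $d\in\{2,3\}$, $T>0$, $\delta t>0$, $N=\lfloor T/\delta t\rfloor$, $\gamma\ge1$, $\mu>0$, $\mu+\lambda>0$ and $\wp(\rho)=\rho^\gamma$. Let $\Omega\subset\mathbb R^d$ be an open box, with a fixed, possibly non-uniform, rectangular MAC mesh: cells $K\in\mathcal M$, and internal faces $\sigma=K|L\in\mathcal E^{(i)}_{\rm int}$ orthogonal to the $i$-th basis vector $e^{(i)}$. Scalar unknowns $\rho_K,p_K$ are attached to the cells, and the $i$-th velocity component $u_{\sigma,i}$ to the faces of $\mathcal E^{(i)}_{\rm int}$; velocities vanish on external faces. Let $n_{K,\sigma}$ be the normal to $\sigma$ outward $K$, $u_{K,\sigma}=u_{\sigma,i}\,n_{K,\sigma}\cdot e^{(i)}$, and let $D_\sigma=D_{K,\sigma}\cup D_{L,\sigma}$ be the dual cell of $\sigma=K|L$, $D_{K,\sigma}$ being the half of $K$ adjacent to $\sigma$. Define: * $F_{K,\sigma}(\rho,u)=|\sigma|\,\rho_\sigma\,u_{K,\sigma}$ with $\rho_\sigma=\rho_K$ if $u_{K,\sigma}\ge0$ and $\rho_\sigma=\rho_L$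 otherwise ($F_{K,\sigma}=0$ on external faces), $\mathrm{div}(\rho u)_K=|K|^{-1}\sum_{\sigma\subset\partial K}F_{K,\sigma}(\rho,u)$, $(\mathrm{div}\,u)_K=\mathrm{div}(1\times u)_K$; * $(\nabla p)_{\sigma,i}=\frac{|\sigma|}{|D_\sigma|}(p_L-p_K)\,n_{K,\sigma}\cdot e^{(i)}$ and $|D_\sigma|\rho_{D_\sigma}=|D_{K,\sigma}|\rho_K+|D_{L,\sigma}|\rho_L$; * $\mathrm{div}(\rho v_iu)_\sigma=|D_\sigma|^{-1}\sum_{\epsilon\subset\partial D_\sigma}F_{\sigma,\epsilon}(\rho,u)\,v_{\epsilon,i}$ with centered values $v_{\epsilon,i}=\frac12(v_{\sigma,i}+v_{\sigma',i})$ at $\epsilon=D_\sigma|D_{\sigma'}$, where the flux $F_{\sigma,\epsilon}$ outward $D_\sigma$ is half the sum of the mass fluxes, oriented as the outward normal of $D_\sigma$ at $\epsilon$, through the two faces of $K$ orthogonal to $e^{(i)}$ if $\epsilon\subset K$ is orthogonal to $e^{(i)}$ (and likewise for $L$), and through the two primal faces, one of $K$ and one of $L$, whose halves make up $\epsilon$,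 if $\epsilon$ is parallel to $e^{(i)}$ (so it is zero if $\epsilon\subset\partial\Omega$); * $\mathrm{div}\,\tau(v)_{\sigma,i}=\mu(\Delta v)_{\sigma,i}+(\mu+\lambda)(\nabla\,\mathrm{div}\,v)_{\sigma,i}$, where $(\Delta v)_{\sigma,i}=|D_\sigma|^{-1}\sum_{\epsilon\subset\partial D_\sigma}\frac{|\epsilon|}{d_\epsilon}(v_{\sigma',i}-v_{\sigma,i})$ for $\epsilon=D_\sigma|D_{\sigma'}$, $d_\epsilon$ being the distance between the centres of $\sigma$ and $\sigma'$; if $\epsilon\subset\partial\Omega$ one takes $v_{\sigma',i}=0$ and $d_\epsilon$ is the distance from the centre of $\sigma$ to $\epsilon$. **Compressible scheme.** For a Mach number $\mathrm{Ma}>0$ and data $(\rho_0,u_0)$, put $\rho^0_K=\frac1{|K|}\int_K\rho_0$, $u^0_{\sigma,i}=\frac1{|\sigma|}\int_\sigma u_0\cdot e^{(i)}$ (in the sense of traces), and let $\rho^{-1}$ be given by $\frac1{\delta t}(\rho^0_K-\rho^{-1}_K)+\mathrm{div}(\rho^0u^0)_K=0$. A solution $(\rho,u)$ consists of $(\rho^n,u^n)_{0\le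 n\le N}$ such that, for $0\le n<N$ and some $\tilde u^{n+1}$, with $p^n=\wp(\rho^n)$ and $(\overline{\nabla p})^n_{\sigma,i}=(\rho^n_{D_\sigma}/\rho^{n-1}_{D_\sigma})^{1/2}(\nabla p^n)_{\sigma,i}$, for all $i$, $\sigma\in\mathcal E^{(i)}_{\rm int}$ and $K\in\mathcal M$, $$\tfrac1{\delta t}(\rho^n_{D_\sigma}\tilde u^{n+1}_{\sigma,i}-\rho^{n-1}_{D_\sigma}u^n_{\sigma,i})+\mathrm{div}(\rho^n\tilde u^{n+1}_iu^n)_\sigma-\mathrm{div}\,\tau(\tilde u^{n+1})_{\sigma,i}+\tfrac1{\mathrm{Ma}^2}(\overline{\nabla p})^n_{\sigma,i}=0,$$ $$\tfrac1{\delta t}\rho^n_{D_\sigma}(u^{n+1}_{\sigma,i}-\tilde u^{n+1}_{\sigma,i})+\tfrac1{\mathrm{Ma}^2}(\nabla p^{n+1})_{\sigma,i}-\tfrac1{\mathrm{Ma}^2}(\overline{\nabla p})^n_{\sigma,i}=0,$$ $$\tfrac1{\delta t}(\rho^{n+1}_K-\rho^n_K)+\mathrm{div}(\rho^{n+1}u^{n+1})_K=0.$$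 Put $\delta p^n_K=\mathrm{Ma}^{-2}\bigl(p^n_K-|\Omega|^{-1}\int_\Omega p^n\bigr)$. The discrete density is also regarded as the function equal to $\rho^n_K$ on $[n\delta t,(n+1)\delta t)\times K$. **Incompressible scheme** with initial data $(V^0,P^0)$: find $(u^n,\delta p^n)_{0\le n\le N}$ with $u^0=V^0$, $\delta p^0=P^0$, $\int_\Omega\delta p^n=0$ for all $n\le N$, and, for $0\le n<N$ and some $\tilde u^{n+1}$, $$\tfrac1{\delta t}(\tilde u^{n+1}_{\sigma,i}-u^n_{\sigma,i})+\mathrm{div}(\tilde u^{n+1}_iu^n)_\sigma-\mathrm{div}\,\tau(\tilde u^{n+1})_{\sigma,i}+(\nabla\delta p^n)_{\sigma,i}=0,$$ $$\tfrac1{\delta t}(u^{n+1}_{\sigma,i}-\tilde u^{n+1}_{\sigma,i})+(\nabla\delta p^{n+1})_{\sigma,i}-(\nabla\delta p^n)_{\sigma,i}=0,\qquad(\mathrm{div}\,u^{n+1})_K=0.$$ **Theorem.** Let $\mathrm{Ma}_m>0$, $\mathrm{Ma}_m\to0$, and let the initial data $\rho_{0,m}\in L^\infty(\Omega)$, $\rho_{0,m}>0$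 a.e., $u_{0,m}\in H^1_0(\Omega)^d$ be well prepared: for some $C$ and all $m$, $$\|u_{0,m}\|_{H^1(\Omega)^d}+\tfrac1{\mathrm{Ma}_m}\|\mathrm{div}\,u_{0,m}\|_{L^2(\Omega)}+\tfrac1{\mathrm{Ma}_m^2}\|\rho_{0,m}-1\|_{L^\infty(\Omega)}\le C,$$ and $u_{0,m}\to\bar u_0$ in $L^2(\Omega)^d$. Let $(\rho_m,u_m)$ be corresponding solutions of the compressible scheme. Then: 1. $\rho_m\to1$ in $L^\infty(0,T;L^q(\Omega))$ for every $q\in[1,\min(\gamma,2)]$. 2. $\bar u_0\in H^1_0(\Omega)^d$, and the field $V^0$ of its face means satisfies $(\mathrm{div}\,V^0)_K=0$ for all $K$. If the initial scaled pressure deviations $\delta p^0_m$ (which are determined by $\rho_{0,m}$) converge to some $P^0$, then the incompressible scheme with initial data $(V^0,P^0)$ has exactly one solution $(u,\delta p)$, and $(u_m^n,\delta p_m^n)_{0\le n\le N}\to(u^n,\delta p^n)_{0\le n\le N}$ in any norm on the space of discrete functions. 3. In general, every subsequence has a further subsequence along which $\delta p^0_m$ converges, and the conclusion of 2 holds along every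 subsequence for which $\delta p^0_m$ converges, $P^0$ being the limit along that subsequence. -/

import Mathlib

open MeasureTheory Filter Topology
open scoped ENNReal ContDiff

noncomputable section

/-! ### Sobolev data on an open set of `ℝ^d` -/

/-- The partial derivative `∂_j φ`. -/
def partialDeriv {d : ℕ} (j : Fin d) (φ : (Fin d → ℝ) → ℝ) (y : Fin d → ℝ) : ℝ :=
  fderiv ℝ φ y (Pi.single j 1)

/-- `φ_k ∈ C_c^∞(Ω)`, `φ_k → f` in `L²(Ω)` and `∂_j φ_k → g_j` in `L²(Ω)` for every `j`,
that is, `φ_k → f` in `H¹(Ω)`, the weak gradient of `f` being `g`. -/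
structure IsH10Approx {d : ℕ} (Ω : Set (Fin d → ℝ)) (f : (Fin d → ℝ) → ℝ)
    (g : Fin d → (Fin d → ℝ) → ℝ) (φ : ℕ → (Fin d → ℝ) → ℝ) : Prop where
  smooth : ∀ k, ContDiff ℝ ∞ (φ k)
  compactSupport : ∀ k, HasCompactSupport (φ k)
  support_subset : ∀ k, tsupport (φ k) ⊆ Ω
  tendsto_val : Tendsto (fun k => eLpNorm (fun y => φ k y - f y) 2 (volume.restrict Ω))
    atTop (𝓝 0)
  tendsto_grad : ∀ j, Tendsto
    (fun k => eLpNorm (fun y => partialDeriv j (φ k) y - g j y) 2 (volume.restrict Ω))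
    atTop (𝓝 0)

/-- `f ∈ H¹₀(Ω)` (the closure of `C_c^∞(Ω)` in `H¹(Ω)`), with weak gradient `g ∈ L²(Ω)^d`. -/
structure HasH10Grad {d : ℕ} (Ω : Set (Fin d → ℝ)) (f : (Fin d → ℝ) → ℝ)
    (g : Fin d → (Fin d → ℝ) → ℝ) : Prop where
  memLp_val : MemLp f 2 (volume.restrict Ω)
  memLp_grad : ∀ j, MemLp (g j) 2 (volume.restrict Ω)
  approx : ∃ φ, IsH10Approx Ω f g φ

/-- The `L²(Ω)` norm. -/
def l2Norm {d : ℕ} (Ω : Set (Fin d → ℝ)) (f : (Fin d → ℝ) → ℝ) : ℝ :=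
  (eLpNorm f 2 (volume.restrict Ω)).toReal

/-- The `H¹(Ω)^d` norm of the vector field `(f_1, …, f_d)` with weak gradients `g i = ∇ f_i`. -/
def h1Norm {d : ℕ} (Ω : Set (Fin d → ℝ)) (f : Fin d → (Fin d → ℝ) → ℝ)
    (g : Fin d → Fin d → (Fin d → ℝ) → ℝ) : ℝ :=
  Real.sqrt (∑ i, (l2Norm Ω (f i) ^ 2 + ∑ j, l2Norm Ω (g i j) ^ 2))

/-- Well-prepared initial data for the Mach number `Ma`, with constant `C`;
`Gu₀ i` is the weak gradient of the `i`-th component of `u₀`. -/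
structure WellPrepared {d : ℕ} (Ω : Set (Fin d → ℝ)) (Ma C : ℝ) (ρ₀ : (Fin d → ℝ) → ℝ)
    (u₀ : Fin d → (Fin d → ℝ) → ℝ) (Gu₀ : Fin d → Fin d → (Fin d → ℝ) → ℝ) : Prop where
  density_memLp : MemLp ρ₀ ∞ (volume.restrict Ω)
  density_pos : ∀ᵐ y ∂(volume.restrict Ω), 0 < ρ₀ y
  velocity_h10 : ∀ i, HasH10Grad Ω (u₀ i) (Gu₀ i)
  bound : h1Norm Ω u₀ Gu₀ + (1 / Ma) * l2Norm Ω (fun y => ∑ i, Gu₀ i i y)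
    + (1 / Ma ^ 2) * (eLpNorm (fun y => ρ₀ y - 1) ∞ (volume.restrict Ω)).toReal ≤ C

/-! ### MAC meshes and discrete fields -/

/-- A (possibly non-uniform) MAC mesh of a box of `ℝ^d`: in the direction `j` there are `n j`
layers of cells, separated by the abscissae `x j 0 < x j 1 < ⋯ < x j (n j)`
(the other values of `x j` play no role). -/
structure MACMesh (d : ℕ) where
  n : Fin d → ℕ
  n_pos : ∀ j, 0 < n j
  x : Fin d → ℤ → ℝ
  x_lt : ∀ j (k : ℤ), 0 ≤ k → k < n j → x j k < x j (k + 1)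

namespace MACMesh

variable {d : ℕ} (M : MACMesh d)

/-- The domain `Ω`. -/
def domain : Set (Fin d → ℝ) := Set.pi Set.univ fun j => Set.Ioo (M.x j 0) (M.x j (M.n j))

/-- Multi-indices of the primal cells: cell `k` is `∏_j (x j (k j), x j (k j + 1))`. -/
def cells : Finset (Fin d → ℤ) := Fintype.piFinset fun j => Finset.Ico (0 : ℤ) (M.n j)

/-- The shift by one in the direction `j`. -/
def e (j : Fin d) : Fin d → ℤ := Pi.single j 1

/-- Internal faces orthogonal to the `i`-th basis vector. The index `k` stands for the face
`K|L` common to the cell `K` of index `k` and to the next cell `L`, of index `k + e i`. -/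
def faces (i : Fin d) : Finset (Fin d → ℤ) := M.cells.filter fun k => k i + 1 < M.n i

/-- Discrete scalar fields (densities, pressures): one value per cell. -/
abbrev CellField : Type := M.cells → ℝ

/-- Discrete velocity fields: one value per internal face; the values at external faces are
zero (see `fv`). -/
abbrev FaceField : Type := (i : Fin d) → M.faces i → ℝ

variable {M} in
/-- The value of a cell field at the cell of index `k` (zero if there is no such cell). -/
def cv (p : M.CellField) (k : Fin d → ℤ) : ℝ := if h : k ∈ M.cells then p ⟨k, h⟩ else 0

variable {M} in
/-- The value of the `i`-th velocity component at the face of index `k`: this is the degree of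
freedom at an internal face, and zero otherwise; in particular it is zero at the external faces
(the upper ones, `k i = n i - 1`, and the lower ones, `k i = -1`). -/
def fv (u : M.FaceField) (i : Fin d) (k : Fin d → ℤ) : ℝ :=
  if h : k ∈ M.faces i then u i ⟨k, h⟩ else 0

/-- The width in the direction `j` of the cells of index `k`, and zero outside the domain. -/
def width (j : Fin d) (k : Fin d → ℤ) : ℝ :=
  if 0 ≤ k j ∧ k j < M.n j then M.x j (k j + 1) - M.x j (k j) else 0

/-- The measure `|K|`. -/
def vol (k : Fin d → ℤ) : ℝ := ∏ j, M.width j k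

/-- The measure `|σ|` of the faces of the cell `k` orthogonal to the direction `i`. -/
def area (i : Fin d) (k : Fin d → ℤ) : ℝ := ∏ j ∈ Finset.univ.erase i, M.width j k

/-- The measure `|D_σ| = |D_{K,σ}| + |D_{L,σ}|` of the dual cell of the internal face
`σ = K|L`, where `D_{K,σ}` is the half of `K` adjacent to `σ`. -/
def dualVol (i : Fin d) (k : Fin d → ℤ) : ℝ := M.vol k / 2 + M.vol (k + e i) / 2

/-! ### Discrete operators -/

variable {M}

/-- The upwind mass flux through the upper face of the cell `k` in the direction `i`, counted
positively in the direction `+ e_i`. It vanishes at external faces. It is the flux outward `K`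
for the lower cell `K`, and the opposite of the flux outward `L` for the upper cell `L`. -/
def massFlux (ρ : M.CellField) (u : M.FaceField) (i : Fin d) (k : Fin d → ℤ) : ℝ :=
  M.area i k * (if 0 ≤ fv u i k then cv ρ k else cv ρ (k + e i)) * fv u i k

/-- The discrete divergence `div(ρ u)_K`. -/
def divMass (ρ : M.CellField) (u : M.FaceField) (k : Fin d → ℤ) : ℝ :=
  (1 / M.vol k) * ∑ i, (massFlux ρ u i k - massFlux ρ u i (k - e i))

/-- The discrete divergence `(div u)_K = div(1 × u)_K`. -/
def divVel (u : M.FaceField) : M.CellField := fun k => divMass (fun _ => 1) u k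

/-- The discrete gradient `(∇ p)_{σ,i}` of a cell field. -/
def grad (p : M.CellField) (i : Fin d) (k : Fin d → ℤ) : ℝ :=
  M.area i k / M.dualVol i k * (cv p (k + e i) - cv p k)

/-- The density `ρ_{D_σ}` on the dual cell. -/
def dualDensity (ρ : M.CellField) (i : Fin d) (k : Fin d → ℤ) : ℝ :=
  (M.vol k / 2 * cv ρ k + M.vol (k + e i) / 2 * cv ρ (k + e i)) / M.dualVol i k

/-- The mass flux, counted positively in the direction `+ e_j`, through the upper face in the
direction `j` of the dual cell `D_σ`, `σ = K|L` being the face of index `k` orthogonal to `e_i`.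
For `j ≠ i` the dual face is the union of the halves of the upper faces of `K` and `L` in the
direction `j`; for `j = i` it is the median section of `L`, and the fluxes are those at the
lower and at the upper face of `L`. In both cases one takes the half sum. The lower dual face
of `D_σ` in the direction `j` has the index `k - e j`. -/
def dualFlux (ρ : M.CellField) (u : M.FaceField) (i j : Fin d) (k : Fin d → ℤ) : ℝ :=
  (massFlux ρ u j k + massFlux ρ u j (k + e i)) / 2

/-- The centered approximation of the `i`-th component of `v` at the upper face in the
direction `j` of the dual cell of index `k`. -/
def dualFaceVal (v : M.FaceField) (i j : Fin d) (k : Fin d → ℤ) : ℝ :=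
  (fv v i k + fv v i (k + e j)) / 2

/-- The velocity convection operator `div(ρ v_i u)_σ`. -/
def conv (ρ : M.CellField) (v u : M.FaceField) (i : Fin d) (k : Fin d → ℤ) : ℝ :=
  (1 / M.dualVol i k) * ∑ j, (dualFlux ρ u i j k * dualFaceVal v i j k
    - dualFlux ρ u i j (k - e j) * dualFaceVal v i j (k - e j))

variable (M) in
/-- The measure of the upper face in the direction `j` of the dual cell of index `k`. -/
def dualArea (i j : Fin d) (k : Fin d → ℤ) : ℝ := (M.area j k + M.area j (k + e i)) / 2

variable (M) in
/-- The distance between the centres of the two velocity faces (orthogonal to `e_i`, of indices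
`k` and `k + e j`) on both sides of a dual face. For `j ≠ i`, if the dual face lies on the
boundary of the domain, it is the distance from the only face centre to the boundary, since one
of the two widths is then zero. -/
def dualDist (i j : Fin d) (k : Fin d → ℤ) : ℝ :=
  if j = i then M.width i (k + e i) else (M.width j k + M.width j (k + e j)) / 2

/-- The two-point diffusion flux through the upper dual face in the direction `j`. -/
def diffFlux (v : M.FaceField) (i j : Fin d) (k : Fin d → ℤ) : ℝ :=
  M.dualArea i j k / M.dualDist i j k * (fv v i (k + e j) - fv v i k)

/-- The MAC discrete Laplacian `(Δ v)_{σ,i}` with homogeneous Dirichlet conditions. -/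
def laplacian (v : M.FaceField) (i : Fin d) (k : Fin d → ℤ) : ℝ :=
  (1 / M.dualVol i k) * ∑ j, (diffFlux v i j k - diffFlux v i j (k - e j))

/-- The discrete diffusion term `div τ(v)_{σ,i}`, with
`div τ(v) = μ Δ v + (μ + lam) ∇ div v`. -/
def divTau (μ lam : ℝ) (v : M.FaceField) (i : Fin d) (k : Fin d → ℤ) : ℝ :=
  μ * laplacian v i k + (μ + lam) * grad (divVel v) i k

/-- The pressure field `℘(ρ) = ρ^γ`. -/
def pressure (γ : ℝ) (ρ : M.CellField) : M.CellField := fun k => ρ k ^ γ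

/-- The integral of a cell field over `Ω`. -/
def integral (p : M.CellField) : ℝ := ∑ k : M.cells, M.vol k * p k

/-- The scaled pressure deviation `δp = (p - |Ω|⁻¹ ∫_Ω p) / Ma²`, `p = ℘(ρ)`. -/
def deltaP (γ Ma : ℝ) (ρ : M.CellField) : M.CellField := fun k =>
  (pressure γ ρ k - (∑ k : M.cells, M.vol k)⁻¹ * integral (pressure γ ρ)) / Ma ^ 2

/-! ### Initialization -/

variable (M) in
/-- The open cell of index `k`, as a subset of `ℝ^d`. -/
def cellBox (k : Fin d → ℤ) : Set (Fin d → ℝ) :=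
  Set.pi Set.univ fun j => Set.Ioo (M.x j (k j)) (M.x j (k j + 1))

variable (M) in
/-- The mean value of `φ` over the internal face of index `k` orthogonal to `e_i`, for the
`(d-1)`-dimensional Lebesgue measure of the hyperplane `y_i = x i (k i + 1)`. -/
def smoothFaceMean (φ : (Fin d → ℝ) → ℝ) (i : Fin d) (k : Fin d → ℤ) : ℝ :=
  ⨍ z in (Set.pi Set.univ fun j : {j : Fin d // j ≠ i} =>
      Set.Ioo (M.x j (k j)) (M.x j (k j + 1)) : Set ({j : Fin d // j ≠ i} → ℝ)),
    φ (fun j => if h : j = i then M.x i (k i + 1) else z ⟨j, h⟩)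

variable (M) in
/-- `f ∈ H¹₀(Ω)` and `c` is the mean value of (the trace of) `f` over the internal face of index
`k` orthogonal to `e_i`. The trace is the continuous extension to `H¹₀(Ω)` of the restriction
of functions of `C_c^∞(Ω)`. -/
def IsFaceMean (f : (Fin d → ℝ) → ℝ) (i : Fin d) (k : Fin d → ℤ) (c : ℝ) : Prop :=
  ∃ g, HasH10Grad M.domain f g ∧ ∃ φ, IsH10Approx M.domain f g φ ∧
    Tendsto (fun l => M.smoothFaceMean (φ l) i k) atTop (𝓝 c)

/-- `U` is the field of the face mean values of the components of the vector field `f`. -/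
def IsFaceInterpolate (f : Fin d → (Fin d → ℝ) → ℝ) (U : M.FaceField) : Prop :=
  ∀ i (k : M.faces i), M.IsFaceMean (f i) i k (U i k)

/-! ### The schemes -/

/-- `(ρ^n)_{-1 ≤ n ≤ N}`, `(u^n)_{0 ≤ n ≤ N}`, with predicted velocities `(w^n)_{1 ≤ n ≤ N}`,
is a solution of the compressible pressure correction scheme for the initial data `(ρ₀, u₀)`.
-/
structure IsCompressibleSol (γ μ lam δt Ma : ℝ) (N : ℕ) (ρ₀ : (Fin d → ℝ) → ℝ)
    (u₀ : Fin d → (Fin d → ℝ) → ℝ) (ρ : ℤ → M.CellField) (u w : ℕ → M.FaceField) : Prop where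
  init_density : ∀ k : M.cells, ρ 0 k = ⨍ y in M.cellBox k, ρ₀ y
  init_velocity : IsFaceInterpolate u₀ (u 0)
  /-- backward mass balance, which defines `ρ^{-1}` -/
  init_backward : ∀ k : M.cells,
    (1 / δt) * (ρ 0 k - ρ (-1) k) + divMass (ρ 0) (u 0) k = 0
  /-- prediction step, with the scaled pressure gradient
  `(ρ^n_{D_σ} / ρ^{n-1}_{D_σ})^{1/2} (∇ p^n)_{σ,i}` -/
  prediction : ∀ n : ℕ, n < N → ∀ i (k : M.faces i),
    (1 / δt) * (dualDensity (ρ n) i k * w (n + 1) i k - dualDensity (ρ (n - 1)) i k * u n i k)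
      + conv (ρ n) (w (n + 1)) (u n) i k
      - divTau μ lam (w (n + 1)) i k
      + (1 / Ma ^ 2) * (Real.sqrt (dualDensity (ρ n) i k / dualDensity (ρ (n - 1)) i k)
          * grad (pressure γ (ρ n)) i k) = 0
  correction : ∀ n : ℕ, n < N → ∀ i (k : M.faces i),
    (1 / δt) * dualDensity (ρ n) i k * (u (n + 1) i k - w (n + 1) i k)
      + (1 / Ma ^ 2) * grad (pressure γ (ρ (n + 1))) i k
      - (1 / Ma ^ 2) * (Real.sqrt (dualDensity (ρ n) i k / dualDensity (ρ (n - 1)) i k)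
          * grad (pressure γ (ρ n)) i k) = 0
  mass : ∀ n : ℕ, n < N → ∀ k : M.cells,
    (1 / δt) * (ρ (n + 1) k - ρ n k) + divMass (ρ (n + 1)) (u (n + 1)) k = 0

/-- `(v^n, π^n)_{0 ≤ n ≤ N}`, with predicted velocities `(w^n)_{1 ≤ n ≤ N}`, is a solution of
the incompressible pressure correction scheme starting from `(v⁰, π⁰) = (V₀, P₀)`; pressures
have a zero mean value. -/
structure IsIncompressibleSol (μ lam δt : ℝ) (N : ℕ) (V₀ : M.FaceField) (P₀ : M.CellField)
    (v w : ℕ → M.FaceField) (π : ℕ → M.CellField) : Prop where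
  init_velocity : v 0 = V₀
  init_pressure : π 0 = P₀
  mean_zero : ∀ n : ℕ, n ≤ N → integral (π n) = 0
  prediction : ∀ n : ℕ, n < N → ∀ i (k : M.faces i),
    (1 / δt) * (w (n + 1) i k - v n i k)
      + conv (fun _ => 1) (w (n + 1)) (v n) i k
      - divTau μ lam (w (n + 1)) i k
      + grad (π n) i k = 0
  correction : ∀ n : ℕ, n < N → ∀ i (k : M.faces i),
    (1 / δt) * (v (n + 1) i k - w (n + 1) i k)
      + grad (π (n + 1)) i k - grad (π n) i k = 0
  div_free : ∀ n : ℕ, n < N → ∀ k : M.cells, divVel (v (n + 1)) k = 0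

/-! ### The discrete density as a function of time and space -/

/-- The function of space, constant over each cell, associated with a cell field. -/
def cellFun (p : M.CellField) (y : Fin d → ℝ) : ℝ :=
  ∑ k : M.cells, (M.cellBox k).indicator (fun _ => p k) y

/-- The discrete density as a function of `(t, y)`: it is equal to `ρ^n_K` for
`t ∈ [n δt, (n + 1) δt)` and `y ∈ K`. -/
def densityFun (δt : ℝ) (ρ : ℤ → M.CellField) (t : ℝ) (y : Fin d → ℝ) : ℝ :=
  cellFun (ρ ⌊t / δt⌋) y

end MACMesh

end

/-- Summation by parts on a commutative group, for a function supported in a finite set. -/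
theorem sum_sub_shift_mul {G : Type*} [AddCommGroup G] [DecidableEq G] (S : Finset G) (e : G)
    (A z : G → ℝ) (hz : ∀ k, k ∉ S → z k = 0) :
    ∑ k ∈ S, (A k - A (k - e)) * z k
      = ∑ k ∈ S ∪ S.image (fun k => k - e), A k * (z k - z (k + e)) := by
  have h1 : ∑ k ∈ S ∪ S.image (fun k => k - e), A k * z k = ∑ k ∈ S, A k * z k := by
    symm
    apply Finset.sum_subset Finset.subset_union_left
    intro k _ hk
    rw [hz k hk, mul_zero]
  have h2 : ∑ k ∈ S ∪ S.image (fun k => k - e), A k * z (k + e) = ∑ k ∈ S, A (k - e) * z k := by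
    have : ∑ k ∈ S, A (k - e) * z k = ∑ k ∈ S.image (fun k => k - e), A k * z (k + e) := by
      rw [Finset.sum_image (fun a _ b _ h => sub_left_injective h)]
      simp
    rw [this]
    symm
    apply Finset.sum_subset Finset.subset_union_right
    intro k _ hk
    rw [hz (k + e), mul_zero]
    intro hS
    exact hk (Finset.mem_image.2 ⟨k + e, hS, by simp⟩)
  simp only [mul_sub, sub_mul, Finset.sum_sub_distrib]
  rw [h1, h2]

namespace MACMesh

variable {d : ℕ} {M : MACMesh d}

/-! ### Elementary facts on MAC meshes -/

theorem mem_cells {k : Fin d → ℤ} : k ∈ M.cells ↔ ∀ j, 0 ≤ k j ∧ k j < M.n j := by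
  simp [cells, Fintype.mem_piFinset]

theorem add_e_same (k : Fin d → ℤ) (i : Fin d) : (k + e i) i = k i + 1 := by simp [e]

theorem add_e_of_ne (k : Fin d → ℤ) {i j : Fin d} (h : j ≠ i) : (k + e i) j = k j := by
  simp [e, h]

theorem mem_faces {i : Fin d} {k : Fin d → ℤ} :
    k ∈ M.faces i ↔ k ∈ M.cells ∧ k + e i ∈ M.cells := by
  rw [faces, Finset.mem_filter]
  refine and_congr_right fun hk => ?_
  constructor
  · intro h
    rw [mem_cells] at hk ⊢
    intro j
    by_cases hj : j = i
    · subst hj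
      rw [add_e_same]
      exact ⟨by linarith [(hk j).1], h⟩
    · rw [add_e_of_ne k hj]
      exact hk j
  · intro h
    have := (mem_cells.1 h i).2
    rwa [add_e_same] at this

theorem cells_of_mem_faces {i : Fin d} {k : Fin d → ℤ} (h : k ∈ M.faces i) : k ∈ M.cells :=
  (mem_faces.1 h).1

theorem add_e_mem_cells {i : Fin d} {k : Fin d → ℤ} (h : k ∈ M.faces i) : k + e i ∈ M.cells :=
  (mem_faces.1 h).2

theorem cv_of_mem (p : M.CellField) {k : Fin d → ℤ} (h : k ∈ M.cells) : cv p k = p ⟨k, h⟩ :=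
  dif_pos h

theorem fv_of_mem (u : M.FaceField) {i : Fin d} {k : Fin d → ℤ} (h : k ∈ M.faces i) :
    fv u i k = u i ⟨k, h⟩ := dif_pos h

theorem fv_of_notMem (u : M.FaceField) {i : Fin d} {k : Fin d → ℤ} (h : k ∉ M.faces i) :
    fv u i k = 0 := dif_neg h

theorem width_pos {j : Fin d} {k : Fin d → ℤ} (h : 0 ≤ k j ∧ k j < M.n j) : 0 < M.width j k := by
  rw [width, if_pos h]
  linarith [M.x_lt j (k j) h.1 h.2]

theorem width_nonneg (j : Fin d) (k : Fin d → ℤ) : 0 ≤ M.width j k := by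
  by_cases h : 0 ≤ k j ∧ k j < M.n j
  · exact (width_pos h).le
  · rw [width, if_neg h]

theorem vol_pos {k : Fin d → ℤ} (h : k ∈ M.cells) : 0 < M.vol k :=
  Finset.prod_pos fun j _ => width_pos (mem_cells.1 h j)

theorem area_pos (i : Fin d) {k : Fin d → ℤ} (h : k ∈ M.cells) : 0 < M.area i k :=
  Finset.prod_pos fun j _ => width_pos (mem_cells.1 h j)

theorem area_nonneg (i : Fin d) (k : Fin d → ℤ) : 0 ≤ M.area i k :=
  Finset.prod_nonneg fun j _ => width_nonneg j k

theorem dualVol_pos {i : Fin d} {k : Fin d → ℤ} (h : k ∈ M.faces i) : 0 < M.dualVol i k := by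
  have h1 := vol_pos (cells_of_mem_faces h)
  have h2 := vol_pos (add_e_mem_cells h)
  rw [dualVol]
  linarith

theorem dualArea_nonneg (i j : Fin d) (k : Fin d → ℤ) : 0 ≤ M.dualArea i j k := by
  have h1 := M.area_nonneg j k
  have h2 := M.area_nonneg j (k + e i)
  rw [dualArea]
  linarith

theorem dualDist_nonneg (i j : Fin d) (k : Fin d → ℤ) : 0 ≤ M.dualDist i j k := by
  rw [dualDist]
  split_ifs
  · exact M.width_nonneg _ _
  · have h1 := M.width_nonneg j k
    have h2 := M.width_nonneg j (k + e j)
    linarith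

theorem dualDensity_pos {ρ : M.CellField} (hρ : ∀ k, 0 < ρ k) {i : Fin d} {k : Fin d → ℤ}
    (h : k ∈ M.faces i) : 0 < dualDensity ρ i k := by
  have h1 := vol_pos (cells_of_mem_faces h)
  have h2 := vol_pos (add_e_mem_cells h)
  have h3 := hρ ⟨k, cells_of_mem_faces h⟩
  have h4 := hρ ⟨_, add_e_mem_cells h⟩
  rw [dualDensity, cv_of_mem _ (cells_of_mem_faces h), cv_of_mem _ (add_e_mem_cells h)]
  have := dualVol_pos h
  positivity

theorem massFlux_of_notMem (ρ : M.CellField) (u : M.FaceField) {i : Fin d} {k : Fin d → ℤ}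
    (h : k ∉ M.faces i) : massFlux ρ u i k = 0 := by
  rw [massFlux, fv_of_notMem u h, mul_zero]

theorem massFlux_one (u : M.FaceField) (i : Fin d) (k : Fin d → ℤ) :
    massFlux (fun _ => 1) u i k = M.area i k * fv u i k := by
  by_cases h : k ∈ M.faces i
  · rw [massFlux, cv_of_mem _ (cells_of_mem_faces h), cv_of_mem _ (add_e_mem_cells h)]
    simp
  · rw [massFlux_of_notMem _ _ h, fv_of_notMem _ h, mul_zero]

theorem vol_mul_divMass (ρ : M.CellField) (u : M.FaceField) {k : Fin d → ℤ} (h : k ∈ M.cells) :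
    M.vol k * divMass ρ u k = ∑ i, (massFlux ρ u i k - massFlux ρ u i (k - e i)) := by
  rw [divMass, ← mul_assoc, mul_one_div_cancel (vol_pos h).ne', one_mul]

theorem dualVol_mul_grad (p : M.CellField) {i : Fin d} {k : Fin d → ℤ} (h : k ∈ M.faces i) :
    M.dualVol i k * grad p i k = M.area i k * (cv p (k + e i) - cv p k) := by
  rw [grad]
  have := (dualVol_pos h).ne'
  field_simp

theorem dualVol_mul_dualDensity (ρ : M.CellField) {i : Fin d} {k : Fin d → ℤ}
    (h : k ∈ M.faces i) : M.dualVol i k * dualDensity ρ i k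
      = M.vol k / 2 * cv ρ k + M.vol (k + e i) / 2 * cv ρ (k + e i) := by
  rw [dualDensity]
  have := (dualVol_pos h).ne'
  field_simp

/-! ### Discrete duality -/

/-- Duality between the discrete divergence and differences through the internal faces. -/
theorem sum_cells_mul_divMass (ρ : M.CellField) (u : M.FaceField) (f : M.CellField) :
    ∑ k ∈ M.cells, M.vol k * divMass ρ u k * cv f k
      = ∑ i, ∑ k ∈ M.faces i, massFlux ρ u i k * (cv f k - cv f (k + e i)) := by
  have h1 : ∀ k ∈ M.cells, M.vol k * divMass ρ u k * cv f k
      = ∑ i, (massFlux ρ u i k - massFlux ρ u i (k - e i)) * cv f k := by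
    intro k hk
    rw [vol_mul_divMass ρ u hk, Finset.sum_mul]
  rw [Finset.sum_congr rfl h1, Finset.sum_comm]
  refine Finset.sum_congr rfl fun i _ => ?_
  rw [sum_sub_shift_mul M.cells (e i) (massFlux ρ u i) (cv f) (fun k hk => dif_neg hk)]
  symm
  apply Finset.sum_subset
  · intro k hk
    exact Finset.mem_union_left _ (cells_of_mem_faces hk)
  · intro k _ hk
    rw [massFlux_of_notMem _ _ hk, zero_mul]

/-- Duality between the discrete gradient and the discrete divergence. -/
theorem sum_grad_mul (p : M.CellField) (v : M.FaceField) :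
    ∑ i, ∑ k ∈ M.faces i, M.dualVol i k * (grad p i k * fv v i k)
      = - ∑ k ∈ M.cells, M.vol k * cv (divVel v) k * cv p k := by
  have h := sum_cells_mul_divMass (fun _ => 1) v p
  have h2 : ∑ k ∈ M.cells, M.vol k * cv (divVel v) k * cv p k
      = ∑ k ∈ M.cells, M.vol k * divMass (fun _ => 1) v k * cv p k :=
    Finset.sum_congr rfl fun k hk => by rw [cv_of_mem _ hk, divVel]
  rw [h2, h, ← Finset.sum_neg_distrib]
  refine Finset.sum_congr rfl fun i _ => ?_
  rw [← Finset.sum_neg_distrib]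
  refine Finset.sum_congr rfl fun k hk => ?_
  rw [← mul_assoc, dualVol_mul_grad p hk, massFlux_one]
  ring

/-- The diffusion operator is dissipative. -/
theorem sum_laplacian_mul_nonpos (v : M.FaceField) (i : Fin d) :
    ∑ k ∈ M.faces i, M.dualVol i k * (laplacian v i k * fv v i k) ≤ 0 := by
  have h1 : ∀ k ∈ M.faces i, M.dualVol i k * (laplacian v i k * fv v i k)
      = ∑ j, (diffFlux v i j k - diffFlux v i j (k - e j)) * fv v i k := by
    intro k hk
    have := (dualVol_pos hk).ne'
    rw [laplacian, ← Finset.sum_mul]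
    field_simp
  rw [Finset.sum_congr rfl h1, Finset.sum_comm]
  refine Finset.sum_nonpos fun j _ => ?_
  rw [sum_sub_shift_mul (M.faces i) (e j) (diffFlux v i j) (fv v i) (fun k hk => dif_neg hk)]
  refine Finset.sum_nonpos fun k _ => ?_
  have h2 : 0 ≤ M.dualArea i j k / M.dualDist i j k :=
    div_nonneg (dualArea_nonneg i j k) (dualDist_nonneg i j k)
  rw [diffFlux]
  nlinarith [mul_nonneg h2 (sq_nonneg (fv v i (k + e j) - fv v i k))]

theorem sum_divTau_mul_nonpos {μ lam : ℝ} (hμ : 0 ≤ μ) (hlam : 0 ≤ μ + lam) (v : M.FaceField) :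
    ∑ i, ∑ k ∈ M.faces i, M.dualVol i k * (divTau μ lam v i k * fv v i k) ≤ 0 := by
  have h1 : ∑ i, ∑ k ∈ M.faces i, M.dualVol i k * (divTau μ lam v i k * fv v i k)
      = μ * ∑ i, ∑ k ∈ M.faces i, M.dualVol i k * (laplacian v i k * fv v i k)
        + (μ + lam) * ∑ i, ∑ k ∈ M.faces i, M.dualVol i k * (grad (divVel v) i k * fv v i k) := by
    simp only [Finset.mul_sum, ← Finset.sum_add_distrib, divTau]
    refine Finset.sum_congr rfl fun i _ => Finset.sum_congr rfl fun k _ => ?_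
    ring
  rw [h1, sum_grad_mul]
  have h2 : ∑ i, ∑ k ∈ M.faces i, M.dualVol i k * (laplacian v i k * fv v i k) ≤ 0 :=
    Finset.sum_nonpos fun i _ => sum_laplacian_mul_nonpos v i
  have h3 : 0 ≤ ∑ k ∈ M.cells, M.vol k * cv (divVel v) k * cv (divVel v) k :=
    Finset.sum_nonneg fun k hk => by
      have := vol_pos hk
      rw [mul_assoc]
      exact mul_nonneg this.le (mul_self_nonneg _)
  nlinarith [mul_nonneg hlam h3, mul_nonneg hμ (neg_nonneg.2 h2)]

theorem sum_dualFlux_sub (ρ : M.CellField) (u : M.FaceField) {i : Fin d} {k : Fin d → ℤ}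
    (h : k ∈ M.faces i) :
    ∑ j, (dualFlux ρ u i j k - dualFlux ρ u i j (k - e j))
      = (M.vol k * divMass ρ u k + M.vol (k + e i) * divMass ρ u (k + e i)) / 2 := by
  rw [vol_mul_divMass _ _ (cells_of_mem_faces h), vol_mul_divMass _ _ (add_e_mem_cells h),
    ← Finset.sum_add_distrib, Finset.sum_div]
  refine Finset.sum_congr rfl fun j _ => ?_
  rw [dualFlux, dualFlux, show k - e j + e i = k + e i - e j by abel]
  ring

/-- The centered convection operator: kinetic energy identity. -/
theorem sum_conv_mul (ρ : M.CellField) (v u : M.FaceField) (i : Fin d) :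
    ∑ k ∈ M.faces i, M.dualVol i k * (conv ρ v u i k * fv v i k)
      = ∑ k ∈ M.faces i, (M.vol k * divMass ρ u k + M.vol (k + e i) * divMass ρ u (k + e i)) / 2
          * (fv v i k ^ 2 / 2) := by
  have h1 : ∀ k ∈ M.faces i, M.dualVol i k * (conv ρ v u i k * fv v i k)
      = ∑ j, (dualFlux ρ u i j k * dualFaceVal v i j k
          - dualFlux ρ u i j (k - e j) * dualFaceVal v i j (k - e j)) * fv v i k := by
    intro k hk
    have := (dualVol_pos hk).ne'
    rw [conv, ← Finset.sum_mul]
    field_simp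
  have h2 : ∀ k ∈ M.faces i,
      (M.vol k * divMass ρ u k + M.vol (k + e i) * divMass ρ u (k + e i)) / 2
          * (fv v i k ^ 2 / 2)
      = ∑ j, (dualFlux ρ u i j k - dualFlux ρ u i j (k - e j)) * (fv v i k ^ 2 / 2) := by
    intro k hk
    rw [← sum_dualFlux_sub ρ u hk, Finset.sum_mul]
  rw [Finset.sum_congr rfl h1, Finset.sum_congr rfl h2, Finset.sum_comm,
    Finset.sum_comm (s := M.faces i)]
  refine Finset.sum_congr rfl fun j _ => ?_
  rw [sum_sub_shift_mul (M.faces i) (e j) (fun k => dualFlux ρ u i j k * dualFaceVal v i j k)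
      (fv v i) (fun k hk => dif_neg hk),
    sum_sub_shift_mul (M.faces i) (e j) (dualFlux ρ u i j) (fun k => fv v i k ^ 2 / 2)
      (fun k hk => by simp [fv_of_notMem v hk])]
  refine Finset.sum_congr rfl fun k _ => ?_
  rw [dualFaceVal]
  ring

/-! ### The upwind mass balance -/

/-- The upwind scheme for the mass balance preserves the positivity of the density. -/
theorem density_pos_of_mass_balance {δt : ℝ} (hδt : 0 < δt) {ρ ρ' : M.CellField} {u : M.FaceField}
    (hρ : ∀ k, 0 < ρ k)
    (hmass : ∀ k : M.cells, (1 / δt) * (ρ' k - ρ k) + divMass ρ' u k = 0) : ∀ k, 0 < ρ' k := by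
  by_contra! hcon
  obtain ⟨k₀, hk₀⟩ := hcon
  set f : M.CellField := fun k => if ρ' k ≤ 0 then 1 else 0 with hf
  have h1 := sum_cells_mul_divMass ρ' u f
  have h2 : ∑ i, ∑ k ∈ M.faces i, massFlux ρ' u i k * (cv f k - cv f (k + e i)) ≤ 0 := by
    refine Finset.sum_nonpos fun i _ => Finset.sum_nonpos fun k hk => ?_
    have hA := area_nonneg (M := M) i k
    rw [massFlux, cv_of_mem _ (cells_of_mem_faces hk), cv_of_mem _ (add_e_mem_cells hk),
      cv_of_mem _ (cells_of_mem_faces hk), cv_of_mem _ (add_e_mem_cells hk), mul_assoc, mul_assoc]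
    apply mul_nonpos_of_nonneg_of_nonpos hA
    simp only [hf]
    split_ifs <;> nlinarith
  have h3 : 0 < ∑ k ∈ M.cells, M.vol k * divMass ρ' u k * cv f k := by
    have hk : ∀ k : M.cells, divMass ρ' u k = (1 / δt) * (ρ k - ρ' k) := fun k => by
      linarith [hmass k]
    apply Finset.sum_pos'
    · intro k hk'
      rw [hk ⟨k, hk'⟩, cv_of_mem _ hk']
      have h5 := hρ ⟨k, hk'⟩
      have h6 := vol_pos hk'
      simp only [hf]
      split_ifs with h7
      · have : 0 ≤ ρ ⟨k, hk'⟩ - ρ' ⟨k, hk'⟩ := by linarith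
        positivity
      · simp
    · refine ⟨k₀, k₀.2, ?_⟩
      rw [hk k₀, cv_of_mem _ k₀.2]
      have h5 := hρ k₀
      have h6 := vol_pos k₀.2
      have h7 : 0 < ρ k₀ - ρ' k₀ := by linarith
      simp only [hf, if_pos hk₀]
      positivity
  linarith

/-- `Ψ` is a convex function on `(0, ∞)` with derivative `h`, and `ρ h(ρ) - Ψ(ρ) = ρ^γ - 1`. -/
structure IsElasticPotential (γ : ℝ) (Ψ h : ℝ → ℝ) : Prop where
  convex : ∀ x y, 0 < x → 0 < y → Ψ x + h x * (y - x) ≤ Ψ y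
  legendre : ∀ x, 0 < x → x * h x - Ψ x = x ^ γ - 1
  value_one : Ψ 1 = 0
  deriv_one : h 1 = 0
  deriv_pos : ∀ x, 1 < x → 0 < h x
  deriv_neg : ∀ x, 0 < x → x < 1 → h x < 0
  continuousAt_deriv : ContinuousAt h 1

/-- The work of the pressure forces bounds the variation of the elastic potential. -/
theorem elastic_le_pressure_work {γ δt : ℝ} (hδt : 0 < δt) {Ψ h : ℝ → ℝ}
    (hΨ : IsElasticPotential γ Ψ h) {ρ ρ' : M.CellField} {u : M.FaceField}
    (hρ : ∀ k, 0 < ρ k) (hρ' : ∀ k, 0 < ρ' k)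
    (hmass : ∀ k : M.cells, (1 / δt) * (ρ' k - ρ k) + divMass ρ' u k = 0) :
    ∑ k : M.cells, M.vol k * Ψ (ρ' k) - ∑ k : M.cells, M.vol k * Ψ (ρ k)
      ≤ δt * ∑ i, ∑ k ∈ M.faces i, M.dualVol i k * (grad (pressure γ ρ') i k * fv u i k) := by
  have h1 := sum_cells_mul_divMass ρ' u (fun k => h (ρ' k))
  have h2 : - ∑ i, ∑ k ∈ M.faces i, massFlux ρ' u i k
        * (cv (fun k => h (ρ' k)) k - cv (fun k => h (ρ' k)) (k + e i))
      ≤ ∑ i, ∑ k ∈ M.faces i, M.dualVol i k * (grad (pressure γ ρ') i k * fv u i k) := by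
    rw [← Finset.sum_neg_distrib]
    refine Finset.sum_le_sum fun i _ => ?_
    rw [← Finset.sum_neg_distrib]
    refine Finset.sum_le_sum fun k hk => ?_
    have hK := cells_of_mem_faces hk
    have hL := add_e_mem_cells hk
    rw [← mul_assoc, dualVol_mul_grad _ hk, massFlux, cv_of_mem _ hK, cv_of_mem _ hL,
      cv_of_mem _ hK, cv_of_mem _ hL, cv_of_mem _ hK, cv_of_mem _ hL]
    have hA := area_nonneg (M := M) i k
    have pK := hρ' ⟨k, hK⟩
    have pL := hρ' ⟨_, hL⟩
    simp only [pressure]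
    generalize ρ' ⟨k, hK⟩ = a at pK ⊢
    generalize ρ' ⟨_, hL⟩ = b at pL ⊢
    generalize fv u i k = v
    have e1 := hΨ.legendre a pK
    have e2 := hΨ.legendre b pL
    have e3 := hΨ.convex a b pK pL
    have e4 := hΨ.convex b a pL pK
    have e5 : b ^ γ - a ^ γ = b * h b - Ψ b - (a * h a - Ψ a) := by rw [e1, e2]; ring
    rw [e5]
    have : -((if 0 ≤ v then a else b) * v * (h a - h b))
        ≤ (b * h b - Ψ b - (a * h a - Ψ a)) * v := by
      split_ifs with hv
      · nlinarith
      · push Not at hv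
        nlinarith
    calc _ = M.area i k * (-((if 0 ≤ v then a else b) * v * (h a - h b))) := by ring
      _ ≤ M.area i k * ((b * h b - Ψ b - (a * h a - Ψ a)) * v) := by gcongr
      _ = _ := by ring
  have h3 : ∑ k : M.cells, M.vol k * Ψ (ρ' k) - ∑ k : M.cells, M.vol k * Ψ (ρ k)
      ≤ - δt * ∑ k ∈ M.cells, M.vol k * divMass ρ' u k * cv (fun k => h (ρ' k)) k := by
    rw [← Finset.sum_sub_distrib, ← Finset.sum_coe_sort M.cells, Finset.mul_sum]
    refine Finset.sum_le_sum fun k _ => ?_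
    have hd : divMass ρ' u k = (1 / δt) * (ρ k - ρ' k) := by linarith [hmass k]
    rw [hd, cv_of_mem _ k.2]
    have e3 := hΨ.convex (ρ' k) (ρ k) (hρ' k) (hρ k)
    have hv := vol_pos k.2
    have : -δt * (M.vol ↑k * (1 / δt * (ρ k - ρ' k)) * h (ρ' k))
        = M.vol k * (h (ρ' k) * (ρ' k - ρ k)) := by
      field_simp
      ring
    rw [this, ← mul_sub]
    gcongr
    nlinarith
  rw [h1] at h3
  nlinarith

/-! ### The energy -/

/-- The discrete total energy, at the step `n`, with `ρm = ρ^{n-1}`, `ρ = ρ^n`, `u = u^n`. -/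
noncomputable def energy (γ δt Ma : ℝ) (Ψ : ℝ → ℝ) (ρm ρ : M.CellField) (u : M.FaceField) : ℝ :=
  ∑ i, ∑ k ∈ M.faces i, M.dualVol i k * (dualDensity ρm i k * fv u i k ^ 2 / 2
      + δt ^ 2 * ((1 / Ma ^ 2) * grad (pressure γ ρ) i k) ^ 2 / (2 * dualDensity ρm i k))
    + (1 / Ma ^ 2) * ∑ k : M.cells, M.vol k * Ψ (ρ k)

/-- The discrete total energy does not increase. -/
theorem energy_le {γ μ lam δt Ma : ℝ} (hδt : 0 < δt) (hμ : 0 ≤ μ) (hlam : 0 ≤ μ + lam)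
    {Ψ h : ℝ → ℝ} (hΨ : IsElasticPotential γ Ψ h) {ρm ρ ρ' : M.CellField}
    {u w u' : M.FaceField} (hρm : ∀ k, 0 < ρm k) (hρ : ∀ k, 0 < ρ k)
    (hmass₀ : ∀ k : M.cells, (1 / δt) * (ρ k - ρm k) + divMass ρ u k = 0)
    (hpred : ∀ i (k : M.faces i),
      (1 / δt) * (dualDensity ρ i k * w i k - dualDensity ρm i k * u i k)
        + conv ρ w u i k - divTau μ lam w i k
        + (1 / Ma ^ 2) * (Real.sqrt (dualDensity ρ i k / dualDensity ρm i k)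
            * grad (pressure γ ρ) i k) = 0)
    (hcorr : ∀ i (k : M.faces i), (1 / δt) * dualDensity ρ i k * (u' i k - w i k)
        + (1 / Ma ^ 2) * grad (pressure γ ρ') i k
        - (1 / Ma ^ 2) * (Real.sqrt (dualDensity ρ i k / dualDensity ρm i k)
            * grad (pressure γ ρ) i k) = 0)
    (hmass : ∀ k : M.cells, (1 / δt) * (ρ' k - ρ k) + divMass ρ' u' k = 0) :
    energy γ δt Ma Ψ ρ ρ' u' ≤ energy γ δt Ma Ψ ρm ρ u := by
  have hρ' := density_pos_of_mass_balance hδt hρ hmass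
  have hel := elastic_le_pressure_work hδt hΨ hρ hρ' hmass
  have hvisc := sum_divTau_mul_nonpos hμ hlam w
  have hc : ∀ i, ∑ k ∈ M.faces i, M.dualVol i k * (conv ρ w u i k * fv w i k)
      = ∑ k ∈ M.faces i, M.dualVol i k * (-(1 / δt) * (dualDensity ρ i k - dualDensity ρm i k)
          * (fv w i k ^ 2 / 2)) := by
    intro i
    rw [sum_conv_mul]
    refine Finset.sum_congr rfl fun k hk => ?_
    have e1 := hmass₀ ⟨k, cells_of_mem_faces hk⟩
    have e2 := hmass₀ ⟨_, add_e_mem_cells hk⟩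
    rw [← cv_of_mem ρ, ← cv_of_mem ρm] at e1 e2
    have e3 : divMass ρ u k = -(1 / δt) * (cv ρ k - cv ρm k) := by linarith
    have e4 : divMass ρ u (k + e i) = -(1 / δt) * (cv ρ (k + e i) - cv ρm (k + e i)) := by
      linarith
    rw [e3, e4]
    have e5 := dualVol_mul_dualDensity ρ hk
    have e6 := dualVol_mul_dualDensity ρm hk
    calc _ = -(1 / δt) * ((M.vol k / 2 * cv ρ k + M.vol (k + e i) / 2 * cv ρ (k + e i))
          - (M.vol k / 2 * cv ρm k + M.vol (k + e i) / 2 * cv ρm (k + e i)))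
          * (fv w i k ^ 2 / 2) := by ring
      _ = _ := by rw [← e5, ← e6]; ring
  have hpt : ∀ i, ∀ k ∈ M.faces i,
      M.dualVol i k * (dualDensity ρ i k * fv u' i k ^ 2 / 2
        + δt ^ 2 * ((1 / Ma ^ 2) * grad (pressure γ ρ') i k) ^ 2 / (2 * dualDensity ρ i k))
      ≤ M.dualVol i k * (dualDensity ρm i k * fv u i k ^ 2 / 2
        + δt ^ 2 * ((1 / Ma ^ 2) * grad (pressure γ ρ) i k) ^ 2 / (2 * dualDensity ρm i k))
        - (δt / Ma ^ 2) * (M.dualVol i k * (grad (pressure γ ρ') i k * fv u' i k))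
        + δt * (M.dualVol i k * (divTau μ lam w i k * fv w i k))
        - δt * (M.dualVol i k * (conv ρ w u i k * fv w i k)
          - M.dualVol i k * (-(1 / δt) * (dualDensity ρ i k - dualDensity ρm i k)
            * (fv w i k ^ 2 / 2))) := by
    intro i k hk
    have e1 := hpred i ⟨k, hk⟩
    have e2 := hcorr i ⟨k, hk⟩
    rw [← fv_of_mem w, ← fv_of_mem u] at e1
    rw [← fv_of_mem w, ← fv_of_mem u'] at e2
    have p0 := dualDensity_pos hρm hk
    have p1 := dualDensity_pos hρ hk
    have pD := dualVol_pos hk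
    simp only at e1 e2
    generalize conv ρ w u i k = cc at *
    generalize divTau μ lam w i k = tt at *
    have hs : Real.sqrt (dualDensity ρ i k / dualDensity ρm i k) ^ 2
        = dualDensity ρ i k / dualDensity ρm i k := Real.sq_sqrt (by positivity)
    generalize Real.sqrt (dualDensity ρ i k / dualDensity ρm i k) = s at *
    generalize dualDensity ρ i k = r at *
    generalize dualDensity ρm i k = rm at *
    generalize grad (pressure γ ρ) i k = g at *
    generalize grad (pressure γ ρ') i k = g' at *
    generalize fv u' i k = b at *
    generalize fv u i k = a at *
    generalize fv w i k = c at *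
    generalize M.dualVol i k = D at *
    have hinv : δt / Ma ^ 2 = δt * (1 / Ma ^ 2) := by ring
    rw [hinv]
    generalize 1 / Ma ^ 2 = m at *
    have f1 : r * c - rm * a + δt * cc - δt * tt + δt * (m * (s * g)) = 0 := by
      have := congrArg (fun t => δt * t) e1
      simp only [mul_zero] at this
      rw [← this]
      field_simp
    have f2 : r * b + δt * (m * g') = r * c + δt * (m * (s * g)) := by
      have := congrArg (fun t => δt * t) e2
      simp only [mul_zero] at this
      field_simp at this
      linarith
    have f3 : r * b ^ 2 / 2 + δt ^ 2 * (m * g') ^ 2 / (2 * r) + δt * m * (g' * b)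
        = r * c ^ 2 / 2 + δt * (m * (s * g)) * c + δt ^ 2 * (m * g) ^ 2 / (2 * rm) := by
      have h1 : (r * b + δt * (m * g')) ^ 2 / (2 * r)
          = r * b ^ 2 / 2 + δt ^ 2 * (m * g') ^ 2 / (2 * r) + δt * m * (g' * b) := by
        field_simp
        ring
      have h2 : (r * c + δt * (m * (s * g))) ^ 2 / (2 * r)
          = r * c ^ 2 / 2 + δt * (m * (s * g)) * c + s ^ 2 * (δt ^ 2 * (m * g) ^ 2 / (2 * r)) := by
        field_simp
        ring
      rw [← h1, f2, h2, hs]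
      field_simp
    have f4 : δt * (m * (s * g)) * c = -(r * c - rm * a + δt * cc - δt * tt) * c := by
      linear_combination c * f1
    have f5 : δt * (-(1 / δt) * (r - rm) * (c ^ 2 / 2)) = - (r - rm) * (c ^ 2 / 2) := by
      field_simp
    have f6 : r * b ^ 2 / 2 + δt ^ 2 * (m * g') ^ 2 / (2 * r)
        ≤ rm * a ^ 2 / 2 + δt ^ 2 * (m * g) ^ 2 / (2 * rm) - δt * m * (g' * b)
          + δt * (tt * c) - (δt * (cc * c) - δt * (-(1 / δt) * (r - rm) * (c ^ 2 / 2))) := by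
      rw [f5]
      nlinarith [mul_nonneg p0.le (sq_nonneg (a - c))]
    calc _ ≤ D * (rm * a ^ 2 / 2 + δt ^ 2 * (m * g) ^ 2 / (2 * rm) - δt * m * (g' * b)
          + δt * (tt * c) - (δt * (cc * c) - δt * (-(1 / δt) * (r - rm) * (c ^ 2 / 2)))) := by
          gcongr
      _ = _ := by ring
  have hsum := Finset.sum_le_sum fun i (_ : i ∈ Finset.univ) => Finset.sum_le_sum (hpt i)
  simp only [Finset.sum_add_distrib, Finset.sum_sub_distrib, ← Finset.mul_sum, hc, sub_self,
    mul_zero, sub_zero] at hsum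
  have hel' : (1 / Ma ^ 2) * (∑ k : M.cells, M.vol k * Ψ (ρ' k) - ∑ k : M.cells, M.vol k * Ψ (ρ k))
      ≤ (1 / Ma ^ 2) * (δt * ∑ i, ∑ k ∈ M.faces i,
        M.dualVol i k * (grad (pressure γ ρ') i k * fv u' i k)) := by gcongr
  have hvisc' := mul_nonpos_of_nonneg_of_nonpos hδt.le hvisc
  have hr : (1 / Ma ^ 2) * (δt * ∑ i, ∑ k ∈ M.faces i,
        M.dualVol i k * (grad (pressure γ ρ') i k * fv u' i k)) = (δt / Ma ^ 2) * ∑ i, ∑ k ∈ M.faces i,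
        M.dualVol i k * (grad (pressure γ ρ') i k * fv u' i k) := by ring
  simp only [energy]
  rw [hr] at hel'
  linarith

end MACMesh

namespace MACMesh

variable {d : ℕ} {M : MACMesh d}

/-! ### The elastic potential -/

theorem IsElasticPotential.nonneg {γ : ℝ} {Ψ h : ℝ → ℝ} (H : IsElasticPotential γ Ψ h) {x : ℝ}
    (hx : 0 < x) : 0 ≤ Ψ x := by
  have := H.convex 1 x one_pos hx
  rw [H.value_one, H.deriv_one] at this
  linarith

theorem IsElasticPotential.le_deriv_mul {γ : ℝ} {Ψ h : ℝ → ℝ} (H : IsElasticPotential γ Ψ h)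
    {x : ℝ} (hx : 0 < x) : Ψ x ≤ |h x| * |x - 1| := by
  have := H.convex x 1 hx one_pos
  rw [H.value_one] at this
  rw [← abs_mul]
  have h2 := le_abs_self (h x * (x - 1))
  linarith

theorem IsElasticPotential.coercive {γ : ℝ} {Ψ h : ℝ → ℝ} (H : IsElasticPotential γ Ψ h)
    {ε : ℝ} (hε : 0 < ε) : ∃ η > 0, ∀ x, 0 < x → Ψ x < η → |x - 1| < ε := by
  obtain ⟨δ, hδ, hδε, hδ1⟩ : ∃ δ, 0 < δ ∧ 2 * δ ≤ ε ∧ δ < 1 :=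
    ⟨min (ε / 2) (1 / 2), by positivity, by linarith [min_le_left (ε / 2) (1 / 2)],
      by linarith [min_le_right (ε / 2) (1 / 2)]⟩
  have hp := H.deriv_pos (1 + δ) (by linarith)
  have hm := H.deriv_neg (1 - δ) (by linarith) (by linarith)
  refine ⟨min (h (1 + δ) * δ) (-h (1 - δ) * δ), lt_min (by positivity) (by nlinarith), ?_⟩
  intro x hx hlt
  rw [lt_min_iff] at hlt
  by_contra! hcon
  rcases le_abs.1 hcon with h1 | h1
  · have h2 := H.convex (1 + δ) x (by linarith) hx
    have h3 := H.nonneg (x := 1 + δ) (by linarith)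
    nlinarith [hlt.1]
  · have h2 := H.convex (1 - δ) x (by linarith) hx
    have h3 := H.nonneg (x := 1 - δ) (by linarith)
    nlinarith [hlt.2]

theorem isElasticPotential_log :
    IsElasticPotential 1 (fun x => x * Real.log x - x + 1) Real.log where
  convex x y hx hy := by
    have h1 := Real.log_le_sub_one_of_pos (div_pos hx hy)
    rw [Real.log_div hx.ne' hy.ne'] at h1
    have h2 : y * (Real.log x - Real.log y) ≤ y * (x / y - 1) := by gcongr
    have h3 : y * (x / y - 1) = x - y := by field_simp
    linarith
  legendre x hx := by rw [Real.rpow_one]; ring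
  value_one := by simp
  deriv_one := by simp
  deriv_pos x hx := Real.log_pos hx
  deriv_neg x hx hx' := Real.log_neg hx hx'
  continuousAt_deriv := Real.continuousAt_log one_ne_zero

theorem isElasticPotential_rpow {γ : ℝ} (hγ : 1 < γ) :
    IsElasticPotential γ (fun x => (x ^ γ - 1 - γ * (x - 1)) / (γ - 1))
      (fun x => γ * (x ^ (γ - 1) - 1) / (γ - 1)) where
  convex x y hx hy := by
    have hγ' : 0 < γ - 1 := by linarith
    have h1 := one_add_mul_self_le_rpow_one_add (s := y / x - 1) (p := γ)
      (by have := div_pos hy hx; linarith) hγ.le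
    rw [add_sub_cancel, Real.div_rpow hy.le hx.le, le_div_iff₀ (Real.rpow_pos_of_pos hx _)] at h1
    have h2 : x ^ γ = x ^ (γ - 1) * x := by rw [Real.rpow_sub_one hx.ne']; field_simp
    have h3 : (1 + γ * (y / x - 1)) * x ^ γ = x ^ γ + γ * (x ^ (γ - 1) * (y - x)) := by
      rw [h2]; field_simp
    rw [h3] at h1
    rw [div_mul_eq_mul_div, ← add_div]
    gcongr
    linarith
  legendre x hx := by
    have hγ' : γ - 1 ≠ 0 := by linarith
    have h2 : x ^ γ = x ^ (γ - 1) * x := by rw [Real.rpow_sub_one hx.ne']; field_simp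
    rw [h2]
    field_simp
    ring
  value_one := by simp
  deriv_one := by simp
  deriv_pos x hx := by
    have h1 := Real.one_lt_rpow hx (sub_pos.2 hγ)
    have h2 : 0 < x ^ (γ - 1) - 1 := by linarith
    have h3 : 0 < γ - 1 := by linarith
    positivity
  deriv_neg x hx hx' := by
    have h1 := Real.rpow_lt_one hx.le hx' (sub_pos.2 hγ)
    have h3 : 0 < γ - 1 := by linarith
    apply div_neg_of_neg_of_pos _ h3
    nlinarith
  continuousAt_deriv := by
    have := Real.continuousAt_rpow_const 1 (γ - 1) (Or.inl one_ne_zero)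
    fun_prop

theorem exists_isElasticPotential {γ : ℝ} (hγ : 1 ≤ γ) : ∃ Ψ h, IsElasticPotential γ Ψ h := by
  rcases hγ.eq_or_lt with rfl | hγ
  · exact ⟨_, _, isElasticPotential_log⟩
  · exact ⟨_, _, isElasticPotential_rpow hγ⟩

/-! ### A discrete Poincaré inequality -/

theorem zero_mem_cells : (0 : Fin d → ℤ) ∈ M.cells :=
  mem_cells.2 fun j => ⟨le_rfl, by simpa using M.n_pos j⟩

theorem sub_e_same (k : Fin d → ℤ) (i : Fin d) : (k - e i) i = k i - 1 := by simp [e]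

theorem sub_e_of_ne (k : Fin d → ℤ) {i j : Fin d} (h : j ≠ i) : (k - e i) j = k j := by
  simp [e, h]

theorem abs_cv_sub_le {p : M.CellField} {c : ℝ}
    (hp : ∀ i, ∀ k ∈ M.faces i, |cv p (k + e i) - cv p k| ≤ c) (s : ℕ) :
    ∀ k ∈ M.cells, ∑ j, k j = s → |cv p k - cv p 0| ≤ s * c := by
  induction s with
  | zero =>
    intro k hk hs
    have h0 : k = 0 := by
      funext j
      have := (Finset.sum_eq_zero_iff_of_nonneg (fun j _ => (mem_cells.1 hk j).1)).1
        (by simpa using hs) j (Finset.mem_univ j)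
      simpa using this
    simp [h0]
  | succ s ih =>
    intro k hk hs
    obtain ⟨j, hj⟩ : ∃ j, 1 ≤ k j := by
      by_contra! hcon
      have : ∑ j, k j ≤ 0 := Finset.sum_nonpos fun j _ => by linarith [hcon j]
      rw [hs] at this
      push_cast at this
      linarith
    have hk' : k - e j ∈ M.cells := by
      rw [mem_cells] at hk ⊢
      intro l
      by_cases hl : l = j
      · subst hl
        rw [sub_e_same]
        exact ⟨by linarith, by linarith [(hk l).2]⟩
      · rw [sub_e_of_ne _ hl]
        exact hk l
    have h1 := hp j (k - e j) (mem_faces.2 ⟨hk', by simpa using hk⟩)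
    rw [sub_add_cancel] at h1
    have h2 := ih (k - e j) hk' (by
      have : ∑ l, (k - e j) l = ∑ l, k l - 1 := by simp [e, Finset.sum_sub_distrib]
      rw [this, hs]
      simp)
    have h3 := abs_sub_le (cv p k) (cv p (k - e j)) (cv p 0)
    push_cast
    linarith

/-- The number of layers of cells, all directions together. -/
def layers (M : MACMesh d) : ℝ := ∑ j, (M.n j : ℝ)

theorem abs_sub_le_of_faces {p : M.CellField} {c : ℝ} (hc : 0 ≤ c)
    (hp : ∀ i, ∀ k ∈ M.faces i, |cv p (k + e i) - cv p k| ≤ c) (k l : M.cells) :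
    |p k - p l| ≤ 2 * M.layers * c := by
  have key : ∀ k : M.cells, |p k - cv p 0| ≤ M.layers * c := by
    intro k
    have h0 : 0 ≤ ∑ j, k.1 j := Finset.sum_nonneg fun j _ => (mem_cells.1 k.2 j).1
    have h1 := abs_cv_sub_le hp (∑ j, k.1 j).toNat k k.2 (by omega)
    rw [cv_of_mem _ k.2] at h1
    refine h1.trans ?_
    gcongr
    have h2 : (((∑ j, k.1 j).toNat : ℤ) : ℝ) = ∑ j, (k.1 j : ℝ) := by
      rw [Int.toNat_of_nonneg h0]; push_cast; rfl
    rw [← Int.cast_natCast, h2]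
    refine Finset.sum_le_sum fun j _ => ?_
    exact_mod_cast (mem_cells.1 k.2 j).2.le
  have h1 := key k
  have h2 := key l
  have h3 := abs_sub_le (p k) (cv p 0) (p l)
  rw [abs_sub_comm (cv p 0)] at h3
  linarith

theorem sum_vol_pos : 0 < ∑ k : M.cells, M.vol k :=
  Finset.sum_pos (fun k _ => vol_pos k.2) ⟨⟨0, zero_mem_cells⟩, Finset.mem_univ _⟩

theorem abs_le_of_faces {p : M.CellField} {c : ℝ} (hc : 0 ≤ c)
    (hp : ∀ i, ∀ k ∈ M.faces i, |cv p (k + e i) - cv p k| ≤ c) (h0 : integral p = 0)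
    (k : M.cells) : |p k| ≤ 2 * M.layers * c := by
  have hV := sum_vol_pos (M := M)
  have h1 : (∑ l : M.cells, M.vol l) * p k = ∑ l : M.cells, M.vol l * (p k - p l) := by
    rw [integral] at h0
    simp only [mul_sub, Finset.sum_sub_distrib, h0, Finset.sum_mul, sub_zero]
  have h2 : |(∑ l : M.cells, M.vol l) * p k|
      ≤ (∑ l : M.cells, M.vol l) * (2 * M.layers * c) := by
    rw [h1, Finset.sum_mul]
    refine (Finset.abs_sum_le_sum_abs _ _).trans (Finset.sum_le_sum fun l _ => ?_)
    rw [abs_mul, abs_of_pos (vol_pos l.2)]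
    have := (vol_pos l.2).le
    gcongr
    exact abs_sub_le_of_faces hc hp k l
  rw [abs_mul, abs_of_pos hV] at h2
  exact le_of_mul_le_mul_left h2 hV

theorem abs_cv_sub_eq (p : M.CellField) {i : Fin d} {k : Fin d → ℤ} (hk : k ∈ M.faces i) :
    |cv p (k + e i) - cv p k| = M.dualVol i k / M.area i k * |grad p i k| := by
  have hA := area_pos i (cells_of_mem_faces hk)
  have hD := dualVol_pos hk
  rw [grad, abs_mul, abs_of_pos (by positivity : 0 < M.area i k / M.dualVol i k)]
  field_simp

theorem eq_zero_of_grad_eq_zero {p : M.CellField} (h0 : integral p = 0)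
    (hp : ∀ i, ∀ k ∈ M.faces i, grad p i k = 0) : p = 0 := by
  funext k
  have := abs_le_of_faces (c := 0) le_rfl
    (fun i k hk => by rw [abs_cv_sub_eq p hk, hp i k hk]; simp) h0 k
  simpa using this

/-! ### Linearity of the discrete operators -/

theorem fv_sub (u v : M.FaceField) (i : Fin d) (k : Fin d → ℤ) :
    fv (u - v) i k = fv u i k - fv v i k := by
  by_cases h : k ∈ M.faces i
  · simp [fv_of_mem _ h]
  · simp [fv_of_notMem _ h]

theorem cv_sub (p q : M.CellField) (k : Fin d → ℤ) : cv (p - q) k = cv p k - cv q k := by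
  by_cases h : k ∈ M.cells
  · simp [cv_of_mem _ h]
  · simp [cv, h]

theorem integral_sub' (p q : M.CellField) : integral (p - q) = integral p - integral q := by
  simp [integral, mul_sub]

theorem grad_sub (p q : M.CellField) (i : Fin d) (k : Fin d → ℤ) :
    grad (p - q) i k = grad p i k - grad q i k := by
  simp only [grad, cv_sub]
  ring

theorem divVel_eq (u : M.FaceField) (k : M.cells) : divVel u k
    = (1 / M.vol k) * ∑ i, (M.area i k * fv u i k - M.area i (k - e i) * fv u i (k - e i)) := by
  simp only [divVel, divMass, massFlux_one]

theorem divVel_sub (u v : M.FaceField) : divVel (u - v) = divVel u - divVel v := by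
  funext k
  rw [Pi.sub_apply, divVel_eq, divVel_eq, divVel_eq, ← mul_sub, ← Finset.sum_sub_distrib]
  congr 1
  refine Finset.sum_congr rfl fun i _ => ?_
  rw [fv_sub, fv_sub]
  ring

theorem laplacian_sub (u v : M.FaceField) (i : Fin d) (k : Fin d → ℤ) :
    laplacian (u - v) i k = laplacian u i k - laplacian v i k := by
  rw [laplacian, laplacian, laplacian, ← mul_sub, ← Finset.sum_sub_distrib]
  congr 1
  refine Finset.sum_congr rfl fun j _ => ?_
  simp only [diffFlux, fv_sub]
  ring

theorem divTau_sub (μ lam : ℝ) (u v : M.FaceField) (i : Fin d) (k : Fin d → ℤ) :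
    divTau μ lam (u - v) i k = divTau μ lam u i k - divTau μ lam v i k := by
  rw [divTau, divTau, divTau, laplacian_sub, divVel_sub, grad_sub]
  ring

theorem conv_sub (ρ : M.CellField) (v v' u : M.FaceField) (i : Fin d) (k : Fin d → ℤ) :
    conv ρ (v - v') u i k = conv ρ v u i k - conv ρ v' u i k := by
  rw [conv, conv, conv, ← mul_sub, ← Finset.sum_sub_distrib]
  congr 1
  refine Finset.sum_congr rfl fun j _ => ?_
  simp only [dualFaceVal, fv_sub]
  ring

/-! ### Uniqueness for the incompressible scheme -/

theorem eq_zero_of_sum_sq {z : M.FaceField}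
    (h : ∑ i, ∑ k ∈ M.faces i, M.dualVol i k * fv z i k ^ 2 ≤ 0) : z = 0 := by
  have hnn : ∀ i, ∀ k ∈ M.faces i, 0 ≤ M.dualVol i k * fv z i k ^ 2 := fun i k hk => by
    have := dualVol_pos hk
    positivity
  have h1 := (Finset.sum_eq_zero_iff_of_nonneg
    (fun i _ => Finset.sum_nonneg (hnn i))).1 (h.antisymm (Finset.sum_nonneg fun i _ =>
      Finset.sum_nonneg (hnn i)))
  funext i k
  have h2 := (Finset.sum_eq_zero_iff_of_nonneg (hnn i)).1 (h1 i (Finset.mem_univ i)) k k.2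
  have h3 := (dualVol_pos k.2).ne'
  rw [fv_of_mem _ k.2] at h2
  simpa [h3] using h2

/-- The prediction step has at most one solution. -/
theorem prediction_unique {μ lam δt : ℝ} (hδt : 0 < δt) (hμ : 0 ≤ μ) (hlam : 0 ≤ μ + lam)
    {u z : M.FaceField} (hu : ∀ k : M.cells, divVel u k = 0)
    (hz : ∀ i (k : M.faces i), (1 / δt) * z i k + conv (fun _ => 1) z u i k
      - divTau μ lam z i k = 0) : z = 0 := by
  apply eq_zero_of_sum_sq
  have h1 : ∀ i, ∀ k ∈ M.faces i, M.dualVol i k * fv z i k ^ 2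
      = δt * (M.dualVol i k * (divTau μ lam z i k * fv z i k))
        - δt * (M.dualVol i k * (conv (fun _ => 1) z u i k * fv z i k)) := by
    intro i k hk
    have e1 := hz i ⟨k, hk⟩
    rw [← fv_of_mem z hk] at e1
    have e2 : fv z i k = δt * (divTau μ lam z i k - conv (fun _ => 1) z u i k) := by
      field_simp at e1
      linarith
    rw [sq]
    nth_rw 1 [e2]
    ring
  have h2 := sum_divTau_mul_nonpos hμ hlam z
  have h3 : ∀ i, ∑ k ∈ M.faces i, M.dualVol i k * (conv (fun _ => 1) z u i k * fv z i k) = 0 := by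
    intro i
    rw [sum_conv_mul]
    refine Finset.sum_eq_zero fun k hk => ?_
    have e1 := hu ⟨k, cells_of_mem_faces hk⟩
    have e2 := hu ⟨_, add_e_mem_cells hk⟩
    rw [divVel] at e1 e2
    simp only at e1 e2
    rw [e1, e2]
    simp
  rw [Finset.sum_congr rfl fun i _ => Finset.sum_congr rfl (h1 i)]
  simp only [Finset.sum_sub_distrib, ← Finset.mul_sum, h3, mul_zero, sub_zero]
  exact mul_nonpos_of_nonneg_of_nonpos hδt.le h2

/-- The correction step has at most one solution. -/
theorem correction_unique {δt : ℝ} (hδt : 0 < δt) {z : M.FaceField} {q : M.CellField}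
    (hz : ∀ k : M.cells, divVel z k = 0) (hq : integral q = 0)
    (h : ∀ i (k : M.faces i), (1 / δt) * z i k + grad q i k = 0) : z = 0 ∧ q = 0 := by
  have h1 : ∀ i, ∀ k ∈ M.faces i, M.dualVol i k * fv z i k ^ 2
      = - δt * (M.dualVol i k * (grad q i k * fv z i k)) := by
    intro i k hk
    have e1 := h i ⟨k, hk⟩
    rw [← fv_of_mem z hk] at e1
    have e2 : fv z i k = - δt * grad q i k := by
      field_simp at e1
      linarith
    rw [sq]
    nth_rw 1 [e2]
    ring
  have hz0 : z = 0 := by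
    apply eq_zero_of_sum_sq
    rw [Finset.sum_congr rfl fun i _ => Finset.sum_congr rfl (h1 i)]
    simp only [← Finset.mul_sum]
    rw [sum_grad_mul, Finset.sum_eq_zero]
    · simp
    · intro k hk
      rw [cv_of_mem _ hk, hz]
      simp
  refine ⟨hz0, eq_zero_of_grad_eq_zero hq fun i k hk => ?_⟩
  have e1 := h i ⟨k, hk⟩
  rw [hz0] at e1
  simpa using e1

/-- The incompressible scheme has at most one solution. -/
theorem IsIncompressibleSol.unique {μ lam δt : ℝ} {N : ℕ} {V₀ : M.FaceField} {P₀ : M.CellField}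
    {v w v' w' : ℕ → M.FaceField} {π π' : ℕ → M.CellField} (hδt : 0 < δt) (hμ : 0 ≤ μ)
    (hlam : 0 ≤ μ + lam) (hV₀ : ∀ k : M.cells, divVel V₀ k = 0)
    (H : IsIncompressibleSol μ lam δt N V₀ P₀ v w π)
    (H' : IsIncompressibleSol μ lam δt N V₀ P₀ v' w' π') :
    (∀ n ≤ N, v' n = v n ∧ π' n = π n) ∧ ∀ n < N, w' (n + 1) = w (n + 1) := by
  have hdiv : ∀ n ≤ N, ∀ k : M.cells, divVel (v n) k = 0 := by
    intro n hn k
    cases n with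
    | zero => rw [H.init_velocity]; exact hV₀ k
    | succ n => exact H.div_free n hn k
  have hdiv' : ∀ n ≤ N, ∀ k : M.cells, divVel (v' n) k = 0 := by
    intro n hn k
    cases n with
    | zero => rw [H'.init_velocity]; exact hV₀ k
    | succ n => exact H'.div_free n hn k
  have hw : ∀ n < N, v' n = v n → π' n = π n → w' (n + 1) = w (n + 1) := by
    intro n hn hv hπ
    rw [← sub_eq_zero]
    refine prediction_unique hδt hμ hlam (hdiv n hn.le) fun i k => ?_
    have e1 := H.prediction n hn i k
    have e2 := H'.prediction n hn i k
    rw [hv, hπ] at e2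
    rw [conv_sub, divTau_sub, Pi.sub_apply, Pi.sub_apply]
    linear_combination e2 - e1
  have hvπ : ∀ n ≤ N, v' n = v n ∧ π' n = π n := by
    intro n
    induction n with
    | zero =>
      intro _
      exact ⟨H'.init_velocity.trans H.init_velocity.symm,
        H'.init_pressure.trans H.init_pressure.symm⟩
    | succ n ih =>
      intro hn
      obtain ⟨hv, hπ⟩ := ih (by omega)
      have hwn := hw n hn hv hπ
      have := correction_unique hδt (z := v' (n + 1) - v (n + 1)) (q := π' (n + 1) - π (n + 1))
        (fun k => by
          rw [divVel_sub, Pi.sub_apply, hdiv _ hn, hdiv' _ hn, sub_zero])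
        (by rw [integral_sub', H.mean_zero _ hn, H'.mean_zero _ hn, sub_zero])
        (fun i k => by
          have e1 := H.correction n hn i k
          have e2 := H'.correction n hn i k
          rw [hπ, hwn] at e2
          rw [grad_sub, Pi.sub_apply, Pi.sub_apply]
          linear_combination e2 - e1)
      exact ⟨sub_eq_zero.1 this.1, sub_eq_zero.1 this.2⟩
  exact ⟨hvπ, fun n hn => hw n hn (hvπ n hn.le).1 (hvπ n hn.le).2⟩

end MACMesh

/-! ### Integration over boxes -/

section Box

variable {d : ℕ}

/-- An open box of `ℝ^d`. -/
def openBox {ι : Type*} (lo hi : ι → ℝ) : Set (ι → ℝ) := Set.pi Set.univ fun j => Set.Ioo (lo j) (hi j)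

/-- The point whose `i`-th coordinate is `c`, the other ones being given by `z`. -/
def insertCoord (i : Fin d) (c : ℝ) (z : {j : Fin d // j ≠ i} → ℝ) : Fin d → ℝ :=
  fun j => if h : j = i then c else z ⟨j, h⟩

theorem insertCoord_same (i : Fin d) (c : ℝ) (z : {j : Fin d // j ≠ i} → ℝ) :
    insertCoord i c z i = c := by simp [insertCoord]

theorem insertCoord_eq (i : Fin d) (c : ℝ) (z : {j : Fin d // j ≠ i} → ℝ) :
    insertCoord i c z = insertCoord i 0 z + c • Pi.single i 1 := by
  funext j
  by_cases h : j = i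
  · subst h; simp [insertCoord]
  · simp [insertCoord, h]

theorem continuous_insertCoord (i : Fin d) :
    Continuous fun x : ({j : Fin d // j ≠ i} → ℝ) × ℝ => insertCoord i x.2 x.1 := by
  refine continuous_pi fun j => ?_
  by_cases h : j = i
  · simp only [insertCoord, h, dite_true]; fun_prop
  · simp only [insertCoord, h, dite_false]; fun_prop

theorem measurableSet_openBox {ι : Type*} [Finite ι] (lo hi : ι → ℝ) :
    MeasurableSet (openBox lo hi) := by
  exact MeasurableSet.univ_pi fun _ => measurableSet_Ioo

theorem openBox_subset_Icc {ι : Type*} (lo hi : ι → ℝ) : openBox lo hi ⊆ Set.Icc lo hi :=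
  fun _ hz => ⟨fun j => (hz j trivial).1.le, fun j => (hz j trivial).2.le⟩

theorem Continuous.integrableOn_openBox {ι : Type*} [Fintype ι] {F : (ι → ℝ) → ℝ}
    (hF : Continuous F) (lo hi : ι → ℝ) : IntegrableOn F (openBox lo hi) :=
  (hF.integrableOn_Icc).mono_set (openBox_subset_Icc lo hi)

theorem volume_openBox_toReal {ι : Type*} [Fintype ι] {lo hi : ι → ℝ} (h : ∀ j, lo j ≤ hi j) :
    (volume (openBox lo hi)).toReal = ∏ j, (hi j - lo j) :=
  Real.volume_pi_Ioo_toReal h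

theorem volume_openBox_ne_top {ι : Type*} [Fintype ι] (lo hi : ι → ℝ) :
    volume (openBox lo hi) ≠ (⊤ : ℝ≥0∞) := by
  rw [openBox, Real.volume_pi_Ioo]
  exact ENNReal.prod_ne_top fun _ _ => ENNReal.ofReal_ne_top

theorem measurePreserving_insertCoord (i : Fin d) :
    ∃ e : (({j : Fin d // j ≠ i} → ℝ) × ℝ) ≃ᵐ (Fin d → ℝ),
      MeasurePreserving e (volume.prod volume) volume ∧ ∀ x, e x = insertCoord i x.2 x.1 := by
  let e₁ := MeasurableEquiv.piEquivPiSubtypeProd (fun _ : Fin d => ℝ) (fun j => j = i)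
  have h₁ : MeasurePreserving e₁.symm volume volume := by
    convert (volume_preserving_piEquivPiSubtypeProd (fun _ : Fin d => ℝ) (fun j => j = i)).symm e₁
    all_goals rfl
  let e₂ := MeasurableEquiv.funUnique {j : Fin d // j = i} ℝ
  have h₂ : MeasurePreserving e₂.symm volume volume :=
    (volume_preserving_funUnique {j : Fin d // j = i} ℝ).symm e₂
  let e₃ : (({j : Fin d // j ≠ i} → ℝ) × ℝ) ≃ᵐ (ℝ × ({j : Fin d // j ≠ i} → ℝ)) :=
    MeasurableEquiv.prodComm
  have h₃ : MeasurePreserving e₃ (volume.prod volume) (volume.prod volume) :=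
    Measure.measurePreserving_swap
  let e₄ := MeasurableEquiv.prodCongr e₂.symm (MeasurableEquiv.refl ({j : Fin d // j ≠ i} → ℝ))
  have h₄ : MeasurePreserving e₄ (volume.prod volume) (volume.prod volume) :=
    h₂.prod (MeasurePreserving.id _)
  refine ⟨(e₃.trans e₄).trans e₁.symm, (h₁.comp (h₄.comp h₃)), fun x => ?_⟩
  funext j
  by_cases h : j = i
  · subst h; simp [insertCoord, e₁, e₂, e₃, e₄, MeasurableEquiv.piEquivPiSubtypeProd,
      Equiv.piEquivPiSubtypeProd, MeasurableEquiv.prodCongr, MeasurableEquiv.prodComm]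
  · simp [insertCoord, h, e₁, e₂, e₃, e₄, MeasurableEquiv.piEquivPiSubtypeProd,
      Equiv.piEquivPiSubtypeProd, MeasurableEquiv.prodCongr, MeasurableEquiv.prodComm]

theorem setIntegral_openBox {F : (Fin d → ℝ) → ℝ} (hF : Continuous F) (i : Fin d)
    (lo hi : Fin d → ℝ) :
    ∫ y in openBox lo hi, F y
      = ∫ z in openBox (fun j : {j : Fin d // j ≠ i} => lo j) (fun j => hi j),
          ∫ t in Set.Ioo (lo i) (hi i), F (insertCoord i t z) := by
  obtain ⟨e, he, hex⟩ := measurePreserving_insertCoord i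
  have h1 := he.setIntegral_preimage_emb e.measurableEmbedding F (openBox lo hi)
  have h2 : e ⁻¹' (openBox lo hi)
      = openBox (fun j : {j : Fin d // j ≠ i} => lo j) (fun j => hi j)
        ×ˢ Set.Ioo (lo i) (hi i) := by
    ext x
    simp only [Set.mem_preimage, hex, openBox, Set.mem_pi, Set.mem_univ, true_imp_iff,
      Set.mem_prod]
    constructor
    · intro h
      refine ⟨fun j => ?_, by simpa [insertCoord_same] using h i⟩
      have := h j
      simpa [insertCoord, j.2] using this
    · rintro ⟨h, h'⟩ j
      by_cases hj : j = i
      · subst hj; simpa [insertCoord] using h'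
      · have := h ⟨j, hj⟩
        simpa [insertCoord, hj] using this
  rw [h2] at h1
  rw [← h1]
  simp only [hex]
  refine setIntegral_prod (fun x : ({j : Fin d // j ≠ i} → ℝ) × ℝ => F (insertCoord i x.2 x.1)) ?_
  have hc : Continuous fun x : ({j : Fin d // j ≠ i} → ℝ) × ℝ => F (insertCoord i x.2 x.1) :=
    hF.comp (continuous_insertCoord i)
  have hint : IntegrableOn (fun x : ({j : Fin d // j ≠ i} → ℝ) × ℝ => F (insertCoord i x.2 x.1))
      (Set.Icc (fun j : {j : Fin d // j ≠ i} => lo j) (fun j => hi j) ×ˢ Set.Icc (lo i) (hi i))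
      (volume.prod volume) :=
    hc.continuousOn.integrableOn_compact (isCompact_Icc.prod isCompact_Icc)
  exact hint.mono_set (Set.prod_mono (openBox_subset_Icc _ _) Set.Ioo_subset_Icc_self)

/-- The integral of `φ` over the section `y_i = c` of a box. -/
noncomputable def sectionIntegral (φ : (Fin d → ℝ) → ℝ) (i : Fin d) (lo hi : Fin d → ℝ) (c : ℝ) : ℝ :=
  ∫ z in openBox (fun j : {j : Fin d // j ≠ i} => lo j) (fun j => hi j), φ (insertCoord i c z)

theorem continuous_partialDeriv {φ : (Fin d → ℝ) → ℝ} (hφ : ContDiff ℝ ∞ φ) (i : Fin d) :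
    Continuous (partialDeriv i φ) := by
  have h := hφ.continuous_fderiv (by simp)
  exact h.clm_apply continuous_const

/-- Integration by parts over a box against an affine function of one coordinate. -/
theorem setIntegral_affine {φ : (Fin d → ℝ) → ℝ} (hφ : ContDiff ℝ ∞ φ) (i : Fin d)
    {lo hi : Fin d → ℝ} (h : lo i ≤ hi i) (α β : ℝ) :
    ∫ y in openBox lo hi, (β * φ y + (α + β * y i) * partialDeriv i φ y)
      = (α + β * hi i) * sectionIntegral φ i lo hi (hi i)
        - (α + β * lo i) * sectionIntegral φ i lo hi (lo i) := by
  have hcp := continuous_partialDeriv hφ i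
  have hc := hφ.continuous
  rw [setIntegral_openBox (by fun_prop) i]
  have hcz : ∀ c, Continuous fun z => φ (insertCoord i c z) := fun c =>
    hc.comp ((continuous_insertCoord i).comp (by fun_prop : Continuous fun z => (z, c)))
  have hinner : ∀ z : {j : Fin d // j ≠ i} → ℝ,
      ∫ t in Set.Ioo (lo i) (hi i), (β * φ (insertCoord i t z)
        + (α + β * insertCoord i t z i) * partialDeriv i φ (insertCoord i t z))
      = (α + β * hi i) * φ (insertCoord i (hi i) z)
        - (α + β * lo i) * φ (insertCoord i (lo i) z) := by
    intro z
    rw [← integral_Ioc_eq_integral_Ioo, ← intervalIntegral.integral_of_le h]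
    simp only [insertCoord_same]
    have hct : Continuous fun t => insertCoord i t z :=
      (continuous_insertCoord i).comp (by fun_prop : Continuous fun t : ℝ => (z, t))
    have hcts : Continuous fun t : ℝ => β * φ (insertCoord i t z)
        + (α + β * t) * partialDeriv i φ (insertCoord i t z) := by fun_prop
    refine intervalIntegral.integral_eq_sub_of_hasDerivAt
      (f := fun t => (α + β * t) * φ (insertCoord i t z)) (fun t _ => ?_)
      (hcts.intervalIntegrable _ _)
    have h1 : HasDerivAt (fun t => insertCoord i t z) (Pi.single i 1) t := by
      have : HasDerivAt (fun t : ℝ => insertCoord i 0 z + t • (Pi.single i 1 : Fin d → ℝ))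
          ((1 : ℝ) • (Pi.single i 1 : Fin d → ℝ)) t :=
        ((hasDerivAt_id t).smul_const _).const_add _
      rw [one_smul] at this
      refine this.congr_of_eventuallyEq (Eventually.of_forall fun t => insertCoord_eq i t z)
    have h2 : HasDerivAt (fun t => φ (insertCoord i t z))
        (partialDeriv i φ (insertCoord i t z)) t :=
      ((hφ.differentiable (by simp)).differentiableAt.hasFDerivAt).comp_hasDerivAt t h1
    have h3 : HasDerivAt (fun t : ℝ => α + β * t) β t := by
      simpa using ((hasDerivAt_id t).const_mul β).const_add α
    exact h3.mul h2
  simp only [hinner]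
  rw [integral_sub, integral_const_mul, integral_const_mul]
  · rfl
  · exact ((hcz _).integrableOn_openBox _ _).const_mul _
  · exact ((hcz _).integrableOn_openBox _ _).const_mul _

/-- A Cauchy–Schwarz estimate for integrals over a subset. -/
theorem abs_setIntegral_mul_le {Ω B : Set (Fin d → ℝ)} (hB : MeasurableSet B) (hBΩ : B ⊆ Ω)
    (hBfin : volume B ≠ (⊤ : ℝ≥0∞)) {f : (Fin d → ℝ) → ℝ} (hf : MemLp f 2 (volume.restrict Ω))
    {ψ : (Fin d → ℝ) → ℝ} {W : ℝ} (hW : 0 ≤ W) (hψ : ∀ y ∈ B, |ψ y| ≤ W) :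
    |∫ y in B, ψ y * f y| ≤ W * (Real.sqrt (volume B).toReal * l2Norm Ω f) := by
  have hfB : MemLp f 2 (volume.restrict B) := hf.mono_measure (Measure.restrict_mono hBΩ le_rfl)
  have : IsFiniteMeasure (volume.restrict B) := ⟨by simpa using hBfin.lt_top⟩
  have hf1 : Integrable f (volume.restrict B) := hfB.integrable (by norm_num)
  have h1 : |∫ y in B, ψ y * f y| ≤ ∫ y in B, W * |f y| := by
    rw [← Real.norm_eq_abs]
    refine norm_integral_le_of_norm_le (hf1.abs.const_mul W) ?_
    refine (ae_restrict_iff' hB).2 (Eventually.of_forall fun y hy => ?_)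
    rw [Real.norm_eq_abs, abs_mul]
    exact mul_le_mul_of_nonneg_right (hψ y hy) (abs_nonneg _)
  refine h1.trans ?_
  rw [integral_const_mul]
  refine mul_le_mul_of_nonneg_left ?_ hW
  have h2 : ∫ y in B, |f y| = (eLpNorm f 1 (volume.restrict B)).toReal := by
    rw [eLpNorm_one_eq_lintegral_enorm, ← integral_norm_eq_lintegral_enorm hf1.1]
    rfl
  have h3 := eLpNorm_le_eLpNorm_mul_rpow_measure_univ (p := 1) (q := 2) (μ := volume.restrict B)
    (by norm_num) hf1.1
  have h4 : eLpNorm f 2 (volume.restrict B) ≤ eLpNorm f 2 (volume.restrict Ω) :=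
    eLpNorm_mono_measure _ (Measure.restrict_mono hBΩ le_rfl)
  have h5 : eLpNorm f 1 (volume.restrict B)
      ≤ eLpNorm f 2 (volume.restrict Ω) * volume B ^ (1 / 2 : ℝ) := by
    refine h3.trans ?_
    rw [Measure.restrict_apply_univ]
    norm_num
    gcongr
  rw [h2, l2Norm, mul_comm, Real.sqrt_eq_rpow, ENNReal.toReal_rpow, ← ENNReal.toReal_mul]
  exact ENNReal.toReal_mono
    (ENNReal.mul_ne_top hf.2.ne (ENNReal.rpow_ne_top_of_nonneg (by norm_num) hBfin)) h5

theorem tendsto_l2Norm {Ω : Set (Fin d → ℝ)} {f : ℕ → (Fin d → ℝ) → ℝ}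
    (h : Tendsto (fun l => eLpNorm (f l) 2 (volume.restrict Ω)) atTop (𝓝 0)) :
    Tendsto (fun l => l2Norm Ω (f l)) atTop (𝓝 0) := by
  have := (ENNReal.tendsto_toReal ENNReal.zero_ne_top).comp h
  simpa [l2Norm, Function.comp_def] using this

theorem integrable_mul_of_memLp {Ω B : Set (Fin d → ℝ)} (hB : MeasurableSet B) (hBΩ : B ⊆ Ω)
    (hBfin : volume B ≠ (⊤ : ℝ≥0∞)) {g : (Fin d → ℝ) → ℝ} (hg : MemLp g 2 (volume.restrict Ω))
    {ψ : (Fin d → ℝ) → ℝ} (hψm : Measurable ψ) {W : ℝ} (hψ : ∀ y ∈ B, |ψ y| ≤ W) :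
    Integrable (fun y => ψ y * g y) (volume.restrict B) := by
  have : IsFiniteMeasure (volume.restrict B) := ⟨by simpa using hBfin.lt_top⟩
  have hg1 : Integrable g (volume.restrict B) :=
    (hg.mono_measure (Measure.restrict_mono hBΩ le_rfl)).integrable (by norm_num)
  refine hg1.bdd_mul (c := W) hψm.aestronglyMeasurable ?_
  exact (ae_restrict_iff' hB).2 (Eventually.of_forall hψ)

theorem tendsto_setIntegral_mul {Ω B : Set (Fin d → ℝ)} (hB : MeasurableSet B) (hBΩ : B ⊆ Ω)
    (hBfin : volume B ≠ (⊤ : ℝ≥0∞)) {f : (Fin d → ℝ) → ℝ} (hf : MemLp f 2 (volume.restrict Ω))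
    {F : ℕ → (Fin d → ℝ) → ℝ} (hF : ∀ l, MemLp (F l) 2 (volume.restrict Ω))
    (h : Tendsto (fun l => eLpNorm (fun y => F l y - f y) 2 (volume.restrict Ω)) atTop (𝓝 0))
    {ψ : (Fin d → ℝ) → ℝ} (hψm : Measurable ψ) {W : ℝ} (hW : 0 ≤ W)
    (hψ : ∀ y ∈ B, |ψ y| ≤ W) :
    Tendsto (fun l => ∫ y in B, ψ y * F l y) atTop (𝓝 (∫ y in B, ψ y * f y)) := by
  have hint : ∀ g : (Fin d → ℝ) → ℝ, MemLp g 2 (volume.restrict Ω) →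
      Integrable (fun y => ψ y * g y) (volume.restrict B) := fun g hg =>
    integrable_mul_of_memLp hB hBΩ hBfin hg hψm hψ
  rw [tendsto_iff_norm_sub_tendsto_zero]
  have h0 : Tendsto (fun l => W * (Real.sqrt (volume B).toReal
      * l2Norm Ω (fun y => F l y - f y))) atTop (𝓝 0) := by
    simpa using ((tendsto_l2Norm h).const_mul (Real.sqrt (volume B).toReal)).const_mul W
  refine squeeze_zero (fun _ => norm_nonneg _) (fun l => ?_) h0
  rw [← integral_sub (hint _ (hF l)) (hint _ hf), Real.norm_eq_abs]
  simp only [← mul_sub]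
  exact abs_setIntegral_mul_le hB hBΩ hBfin ((hF l).sub hf) hW hψ

end Box

section Sobolev

variable {d : ℕ}

theorem l2Norm_nonneg (Ω : Set (Fin d → ℝ)) (f : (Fin d → ℝ) → ℝ) : 0 ≤ l2Norm Ω f :=
  ENNReal.toReal_nonneg

theorem l2Norm_sub_le {Ω : Set (Fin d → ℝ)} {f g : (Fin d → ℝ) → ℝ}
    (hf : MemLp f 2 (volume.restrict Ω)) (hg : MemLp g 2 (volume.restrict Ω)) :
    l2Norm Ω (fun y => f y - g y) ≤ l2Norm Ω f + l2Norm Ω g := by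
  rw [l2Norm, l2Norm, l2Norm, ← ENNReal.toReal_add hf.2.ne hg.2.ne]
  exact ENNReal.toReal_mono (ENNReal.add_ne_top.2 ⟨hf.2.ne, hg.2.ne⟩)
    (eLpNorm_sub_le hf.1 hg.1 (by norm_num))

theorem IsH10Approx.memLp_val {Ω : Set (Fin d → ℝ)} {f : (Fin d → ℝ) → ℝ}
    {g : Fin d → (Fin d → ℝ) → ℝ} {φ : ℕ → (Fin d → ℝ) → ℝ} (h : IsH10Approx Ω f g φ) (l : ℕ) :
    MemLp (φ l) 2 (volume.restrict Ω) :=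
  ((h.smooth l).continuous.memLp_of_hasCompactSupport (h.compactSupport l)).mono_measure
    Measure.restrict_le_self

theorem memLp_partialDeriv {φ : (Fin d → ℝ) → ℝ} (hφ : ContDiff ℝ ∞ φ)
    (hc : HasCompactSupport φ) (j : Fin d) (μ : Measure (Fin d → ℝ))
    [IsFiniteMeasureOnCompacts μ] : MemLp (partialDeriv j φ) 2 μ := by
  refine (continuous_partialDeriv hφ j).memLp_of_hasCompactSupport ?_
  exact (hc.fderiv (𝕜 := ℝ)).comp_left (g := fun L : (Fin d → ℝ) →L[ℝ] ℝ => L (Pi.single j 1))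
    (by simp)

theorem IsH10Approx.memLp_grad {Ω : Set (Fin d → ℝ)} {f : (Fin d → ℝ) → ℝ}
    {g : Fin d → (Fin d → ℝ) → ℝ} {φ : ℕ → (Fin d → ℝ) → ℝ} (h : IsH10Approx Ω f g φ) (j : Fin d)
    (l : ℕ) : MemLp (partialDeriv j (φ l)) 2 (volume.restrict Ω) :=
  (memLp_partialDeriv (h.smooth l) (h.compactSupport l) j volume).mono_measure
    Measure.restrict_le_self

end Sobolev

namespace MACMesh

variable {d : ℕ} {M : MACMesh d}

/-! ### Face means of functions of `H¹₀(Ω)` -/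

variable (M) in
/-- The lower corner of the cell `k`. -/
def lowerCorner (k : Fin d → ℤ) : Fin d → ℝ := fun j => M.x j (k j)

variable (M) in
/-- The upper corner of the cell `k`. -/
def upperCorner (k : Fin d → ℤ) : Fin d → ℝ := fun j => M.x j (k j + 1)

variable (M) in
/-- The part of the cell `k` at a distance less than `ε` from its upper face in direction `i`. -/
def slab (i : Fin d) (k : Fin d → ℤ) (ε : ℝ) : Set (Fin d → ℝ) :=
  openBox (Function.update (M.lowerCorner k) i (M.x i (k i + 1) - ε)) (M.upperCorner k)

theorem cellBox_eq (k : Fin d → ℤ) :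
    M.cellBox k = openBox (M.lowerCorner k) (M.upperCorner k) := rfl

theorem x_mono (j : Fin d) {a b : ℤ} (ha : 0 ≤ a) (hab : a ≤ b) (hb : b ≤ M.n j) :
    M.x j a ≤ M.x j b := by
  induction b, hab using Int.leInduction with
  | base => exact le_rfl
  | succ b hab ih => exact (ih (by omega)).trans (M.x_lt j b (by omega) (by omega)).le

theorem cellBox_subset_domain {k : Fin d → ℤ} (hk : k ∈ M.cells) : M.cellBox k ⊆ M.domain := by
  intro y hy j _
  have hkj := mem_cells.1 hk j
  have h1 := hy j trivial
  exact ⟨(x_mono j le_rfl hkj.1 hkj.2.le).trans_lt h1.1,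
    h1.2.trans_le (x_mono j (by omega) (by omega) le_rfl)⟩

theorem width_eq {j : Fin d} {k : Fin d → ℤ} (h : 0 ≤ k j ∧ k j < M.n j) :
    M.width j k = M.x j (k j + 1) - M.x j (k j) := if_pos h

theorem slab_subset_cellBox {i : Fin d} {k : Fin d → ℤ} (hk : k ∈ M.cells) {ε : ℝ}
    (hε : ε ≤ M.width i k) : M.slab i k ε ⊆ M.cellBox k := by
  intro y hy j _
  have h1 := hy j trivial
  beta_reduce at h1
  by_cases hj : j = i
  · subst hj
    rw [width_eq (mem_cells.1 hk j)] at hε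
    rw [Function.update_self] at h1
    exact ⟨by linarith [h1.1], h1.2⟩
  · rw [Function.update_of_ne hj] at h1
    exact h1

theorem volume_slab {i : Fin d} {k : Fin d → ℤ} (hk : k ∈ M.cells) {ε : ℝ} (hε : 0 ≤ ε) :
    (volume (M.slab i k ε)).toReal = ε * M.area i k := by
  rw [slab, volume_openBox_toReal, ← Finset.mul_prod_erase _ _ (Finset.mem_univ i), area]
  · congr 1
    · simp [upperCorner]
    · refine Finset.prod_congr rfl fun j hj => ?_
      rw [Function.update_of_ne (Finset.ne_of_mem_erase hj), width_eq (mem_cells.1 hk j)]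
      rfl
  · intro j
    by_cases hj : j = i
    · subst hj
      simp [upperCorner, hε]
    · rw [Function.update_of_ne hj]
      have := width_nonneg (M := M) j k
      rw [width_eq (mem_cells.1 hk j)] at this
      exact sub_nonneg.1 this

theorem volume_cellBox {k : Fin d → ℤ} (hk : k ∈ M.cells) :
    (volume (M.cellBox k)).toReal = M.vol k := by
  rw [cellBox_eq, volume_openBox_toReal]
  · exact Finset.prod_congr rfl fun j _ => (width_eq (mem_cells.1 hk j)).symm
  · intro j
    have := width_nonneg (M := M) j k
    rw [width_eq (mem_cells.1 hk j)] at this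
    exact sub_nonneg.1 this

theorem measurableSet_cellBox (k : Fin d → ℤ) : MeasurableSet (M.cellBox k) :=
  measurableSet_openBox _ _

theorem volume_cellBox_ne_top (k : Fin d → ℤ) : volume (M.cellBox k) ≠ (⊤ : ℝ≥0∞) :=
  volume_openBox_ne_top _ _

theorem smoothFaceMean_eq (φ : (Fin d → ℝ) → ℝ) (i : Fin d) {k : Fin d → ℤ}
    (hk : ∀ j, j ≠ i → 0 ≤ k j ∧ k j < M.n j) : M.smoothFaceMean φ i k
      = (M.area i k)⁻¹ * sectionIntegral φ i (M.lowerCorner k) (M.upperCorner k)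
          (M.x i (k i + 1)) := by
  have h1 : (volume (openBox (fun j : {j : Fin d // j ≠ i} => M.lowerCorner k j)
      (fun j => M.upperCorner k j))).toReal = M.area i k := by
    rw [volume_openBox_toReal, area, Finset.prod_subtype (p := fun j => j ≠ i) _ (by simp)]
    · exact Finset.prod_congr rfl fun j _ => (width_eq (hk j j.2)).symm
    · intro j
      have := width_nonneg (M := M) j k
      rw [width_eq (hk j j.2)] at this
      exact sub_nonneg.1 this
  rw [smoothFaceMean, setAverage_eq, ← h1]
  rfl

theorem sectionIntegral_congr (φ : (Fin d → ℝ) → ℝ) (i : Fin d) {lo hi lo' hi' : Fin d → ℝ}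
    (hlo : ∀ j, j ≠ i → lo j = lo' j) (hhi : ∀ j, j ≠ i → hi j = hi' j) (c : ℝ) :
    sectionIntegral φ i lo hi c = sectionIntegral φ i lo' hi' c := by
  have h1 : (fun j : {j : Fin d // j ≠ i} => lo j) = fun j : {j : Fin d // j ≠ i} => lo' j := funext fun j => hlo j j.2
  have h2 : (fun j : {j : Fin d // j ≠ i} => hi j) = fun j : {j : Fin d // j ≠ i} => hi' j := funext fun j => hhi j j.2
  rw [sectionIntegral, h1, h2, sectionIntegral]

variable (M) in
/-- The face mean of a function `f` of `H¹(Ω)`, `g` being its partial derivative in the direction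
`i`, expressed by integrals over the slab of width `ε` below the face. -/
noncomputable def slabMean (f g : (Fin d → ℝ) → ℝ) (i : Fin d) (k : Fin d → ℤ) (ε : ℝ) : ℝ :=
  (ε * M.area i k)⁻¹ * ((∫ y in M.slab i k ε, 1 * f y)
    + ∫ y in M.slab i k ε, (ε - M.x i (k i + 1) + y i) * g y)

theorem smoothFaceMean_eq_slabMean {φ : (Fin d → ℝ) → ℝ} (hφ : ContDiff ℝ ∞ φ) (i : Fin d)
    {k : Fin d → ℤ} (hk : k ∈ M.cells) {ε : ℝ} (hε : 0 < ε) :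
    M.smoothFaceMean φ i k = M.slabMean φ (partialDeriv i φ) i k ε := by
  have hc := hφ.continuous
  have hcp := continuous_partialDeriv hφ i
  have h1 := setIntegral_affine hφ i
    (lo := Function.update (M.lowerCorner k) i (M.x i (k i + 1) - ε)) (hi := M.upperCorner k)
    (by simp [upperCorner, hε.le]) (ε - M.x i (k i + 1)) 1
  rw [integral_add] at h1
  rotate_left
  · exact Continuous.integrableOn_openBox (by fun_prop) _ _
  · exact Continuous.integrableOn_openBox (by fun_prop) _ _
  simp only [one_mul, Function.update_self] at h1
  rw [slabMean, slab]
  simp only [one_mul]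
  rw [h1, smoothFaceMean_eq φ i (fun j _ => mem_cells.1 hk j)]
  rw [sectionIntegral_congr φ i (lo := Function.update (M.lowerCorner k) i (M.x i (k i + 1) - ε))
    (lo' := M.lowerCorner k) (hi := M.upperCorner k) (hi' := M.upperCorner k)
    (fun j hj => Function.update_of_ne hj _ _) (fun j _ => rfl)]
  have hA := (area_pos i hk).ne'
  simp only [upperCorner]
  field_simp
  ring

theorem abs_slab_weight_le {i : Fin d} {k : Fin d → ℤ} {ε : ℝ} {y : Fin d → ℝ}
    (hy : y ∈ M.slab i k ε) : |ε - M.x i (k i + 1) + y i| ≤ ε := by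
  have h1 := hy i trivial
  beta_reduce at h1
  rw [Function.update_self] at h1
  have h2 : y i < M.x i (k i + 1) := h1.2
  rw [abs_le]
  constructor <;> linarith [h1.1, h1.2]

theorem slab_subset_domain {i : Fin d} {k : Fin d → ℤ} (hk : k ∈ M.cells) {ε : ℝ}
    (hε : ε ≤ M.width i k) : M.slab i k ε ⊆ M.domain :=
  (slab_subset_cellBox hk hε).trans (cellBox_subset_domain hk)

theorem tendsto_smoothFaceMean {f : (Fin d → ℝ) → ℝ} {g : Fin d → (Fin d → ℝ) → ℝ}
    {φ : ℕ → (Fin d → ℝ) → ℝ} (hfg : HasH10Grad M.domain f g) (hφ : IsH10Approx M.domain f g φ)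
    (i : Fin d) {k : Fin d → ℤ} (hk : k ∈ M.cells) {ε : ℝ} (hε : 0 < ε) (hε' : ε ≤ M.width i k) :
    Tendsto (fun l => M.smoothFaceMean (φ l) i k) atTop (𝓝 (M.slabMean f (g i) i k ε)) := by
  simp only [fun l => smoothFaceMean_eq_slabMean (hφ.smooth l) i hk hε]
  have hsub := slab_subset_domain hk hε'
  refine Tendsto.const_mul _ (Tendsto.add ?_ ?_)
  · exact tendsto_setIntegral_mul (measurableSet_openBox _ _) hsub (volume_openBox_ne_top _ _)
      hfg.memLp_val hφ.memLp_val hφ.tendsto_val measurable_const zero_le_one (fun y _ => by simp)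
  · exact tendsto_setIntegral_mul (measurableSet_openBox _ _) hsub (volume_openBox_ne_top _ _)
      (hfg.memLp_grad i) (hφ.memLp_grad i) (hφ.tendsto_grad i) (by fun_prop) hε.le
      (fun y hy => abs_slab_weight_le hy)

theorem slabMean_eq {f : (Fin d → ℝ) → ℝ} {g : Fin d → (Fin d → ℝ) → ℝ}
    (hfg : HasH10Grad M.domain f g) (i : Fin d) {k : Fin d → ℤ} (hk : k ∈ M.cells) {ε : ℝ}
    (hε : 0 < ε) (hε' : ε ≤ M.width i k) :
    M.slabMean f (g i) i k ε = M.slabMean f (g i) i k (M.width i k) := by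
  obtain ⟨φ, hφ⟩ := hfg.approx
  exact tendsto_nhds_unique (tendsto_smoothFaceMean hfg hφ i hk hε hε')
    (tendsto_smoothFaceMean hfg hφ i hk (width_pos (mem_cells.1 hk i)) le_rfl)

theorem abs_slabMean_sub_le {f f' g g' : (Fin d → ℝ) → ℝ}
    (hf : MemLp f 2 (volume.restrict M.domain)) (hf' : MemLp f' 2 (volume.restrict M.domain))
    (hg : MemLp g 2 (volume.restrict M.domain)) (hg' : MemLp g' 2 (volume.restrict M.domain))
    (i : Fin d) {k : Fin d → ℤ} (hk : k ∈ M.cells) {ε : ℝ} (hε : 0 < ε) (hε' : ε ≤ M.width i k) :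
    |M.slabMean f g i k ε - M.slabMean f' g' i k ε|
      ≤ (Real.sqrt (ε * M.area i k))⁻¹ * (l2Norm M.domain (fun y => f y - f' y)
        + ε * l2Norm M.domain (fun y => g y - g' y)) := by
  have hA := area_pos i hk
  have hsub := slab_subset_domain hk hε'
  have hms := measurableSet_openBox (Function.update (M.lowerCorner k) i (M.x i (k i + 1) - ε))
    (M.upperCorner k)
  have hfin := volume_openBox_ne_top (Function.update (M.lowerCorner k) i (M.x i (k i + 1) - ε))
    (M.upperCorner k)
  have hψ1 : ∀ y ∈ M.slab i k ε, |(1 : ℝ)| ≤ 1 := fun y _ => by simp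
  have hψ2 : ∀ y ∈ M.slab i k ε, |ε - M.x i (k i + 1) + y i| ≤ ε := fun y hy =>
    abs_slab_weight_le hy
  have hψm2 : Measurable fun y : Fin d → ℝ => ε - M.x i (k i + 1) + y i := by fun_prop
  have h1 : M.slabMean f g i k ε - M.slabMean f' g' i k ε
      = (ε * M.area i k)⁻¹ * ((∫ y in M.slab i k ε, 1 * (f y - f' y))
        + ∫ y in M.slab i k ε, (ε - M.x i (k i + 1) + y i) * (g y - g' y)) := by
    simp only [mul_sub (1 : ℝ), mul_sub (ε - M.x i (k i + 1) + _), slabMean, slab]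
    rw [integral_sub (integrable_mul_of_memLp hms hsub hfin hf measurable_const hψ1)
      (integrable_mul_of_memLp hms hsub hfin hf' measurable_const hψ1),
      integral_sub (integrable_mul_of_memLp hms hsub hfin hg hψm2 hψ2)
      (integrable_mul_of_memLp hms hsub hfin hg' hψm2 hψ2)]
    ring
  have h2 := abs_setIntegral_mul_le hms hsub hfin (hf.sub hf') zero_le_one hψ1
  have h3 := abs_setIntegral_mul_le hms hsub hfin (hg.sub hg') hε.le hψ2
  have hv : (volume (M.slab i k ε)).toReal = ε * M.area i k := volume_slab hk hε.le
  rw [slab] at hv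
  rw [hv] at h2 h3
  have hpos : 0 < ε * M.area i k := by positivity
  have h4 : (Real.sqrt (ε * M.area i k))⁻¹ = (ε * M.area i k)⁻¹ * Real.sqrt (ε * M.area i k) := by
    have := Real.sqrt_pos.2 hpos
    nth_rw 2 [← Real.mul_self_sqrt hpos.le]
    field_simp
  rw [h1, abs_mul, abs_of_pos (inv_pos.2 hpos), h4, mul_assoc]
  refine mul_le_mul_of_nonneg_left ?_ (inv_pos.2 hpos).le
  refine (abs_add_le _ _).trans ((add_le_add h2 h3).trans (le_of_eq ?_))
  simp only [Pi.sub_def]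
  ring

/-- The face mean does not depend on the weak gradient. -/
theorem IsFaceMean.eq_slabMean {f : (Fin d → ℝ) → ℝ} {g : Fin d → (Fin d → ℝ) → ℝ} {i : Fin d}
    {k : Fin d → ℤ} {c : ℝ} (hc : M.IsFaceMean f i k c) (hfg : HasH10Grad M.domain f g)
    (hk : k ∈ M.cells) {ε : ℝ} (hε : 0 < ε) (hε' : ε ≤ M.width i k) :
    c = M.slabMean f (g i) i k ε := by
  obtain ⟨g', hfg', φ, hφ, hlim⟩ := hc
  have hw := width_pos (mem_cells.1 hk i)
  have hA := area_pos i hk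
  have h1 : ∀ ε, 0 < ε → ε ≤ M.width i k → c = M.slabMean f (g' i) i k ε := fun ε hε hε' =>
    tendsto_nhds_unique hlim (tendsto_smoothFaceMean hfg' hφ i hk hε hε')
  rw [slabMean_eq hfg i hk hε hε', ← sub_eq_zero, ← abs_nonpos_iff]
  set s := M.slabMean f (g i) i k (M.width i k) with hs
  set G := l2Norm M.domain (fun y => g' i y - g i y) with hG
  have h2 : ∀ ε, 0 < ε → ε ≤ M.width i k →
      |c - s| ≤ Real.sqrt ε * ((Real.sqrt (M.area i k))⁻¹ * G) := by
    intro ε hε hε'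
    have h3 := abs_slabMean_sub_le hfg.memLp_val hfg.memLp_val (hfg'.memLp_grad i)
      (hfg.memLp_grad i) i hk hε hε'
    rw [← h1 ε hε hε', slabMean_eq hfg i hk hε hε'] at h3
    refine h3.trans (le_of_eq ?_)
    have h4 : l2Norm M.domain (fun y => f y - f y) = 0 := by simp [l2Norm]
    rw [h4, zero_add, ← hG, Real.sqrt_mul hε.le]
    have h5 := Real.sqrt_pos.2 hε
    have h6 := Real.sqrt_pos.2 hA
    have h7 : ε = Real.sqrt ε * Real.sqrt ε := (Real.mul_self_sqrt hε.le).symm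
    nth_rw 2 [h7]
    field_simp
  have h5 : Tendsto (fun ε => Real.sqrt ε * ((Real.sqrt (M.area i k))⁻¹ * G)) (𝓝[>] 0)
      (𝓝 0) := by
    have : Tendsto (fun ε => Real.sqrt ε * ((Real.sqrt (M.area i k))⁻¹ * G)) (𝓝 0)
        (𝓝 (Real.sqrt 0 * ((Real.sqrt (M.area i k))⁻¹ * G))) :=
      (Real.continuous_sqrt.tendsto 0).mul_const _
    rw [Real.sqrt_zero, zero_mul] at this
    exact this.mono_left nhdsWithin_le_nhds
  refine ge_of_tendsto h5 ?_
  filter_upwards [Ioc_mem_nhdsGT hw] with ε hε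
  exact h2 ε hε.1 hε.2

theorem isFaceMean_slabMean {f : (Fin d → ℝ) → ℝ} {g : Fin d → (Fin d → ℝ) → ℝ}
    (hfg : HasH10Grad M.domain f g) (i : Fin d) {k : Fin d → ℤ} (hk : k ∈ M.cells) :
    M.IsFaceMean f i k (M.slabMean f (g i) i k (M.width i k)) := by
  obtain ⟨φ, hφ⟩ := hfg.approx
  exact ⟨g, hfg, φ, hφ, tendsto_smoothFaceMean hfg hφ i hk (width_pos (mem_cells.1 hk i)) le_rfl⟩

/-- The face means converge when the functions converge in `L²(Ω)` and are bounded
in `H¹₀(Ω)`. -/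
theorem tendsto_faceMean {f : ℕ → (Fin d → ℝ) → ℝ} {g : ℕ → Fin d → (Fin d → ℝ) → ℝ}
    {f' : (Fin d → ℝ) → ℝ} {g' : Fin d → (Fin d → ℝ) → ℝ}
    (hfg : ∀ m, HasH10Grad M.domain (f m) (g m)) (hfg' : HasH10Grad M.domain f' g')
    {C : ℝ} (i : Fin d) (hC : ∀ m, l2Norm M.domain (g m i) ≤ C)
    (hlim : Tendsto (fun m => eLpNorm (fun y => f m y - f' y) 2 (volume.restrict M.domain))
      atTop (𝓝 0)) {k : Fin d → ℤ} (hk : k ∈ M.cells) {c : ℕ → ℝ} {c' : ℝ}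
    (hc : ∀ m, M.IsFaceMean (f m) i k (c m)) (hc' : M.IsFaceMean f' i k c') :
    Tendsto c atTop (𝓝 c') := by
  have hw := width_pos (mem_cells.1 hk i)
  have hA := area_pos i hk
  set G := C + l2Norm M.domain (g' i) with hG
  have hbound : ∀ m ε, 0 < ε → ε ≤ M.width i k → |c m - c'|
      ≤ (Real.sqrt (ε * M.area i k))⁻¹ * l2Norm M.domain (fun y => f m y - f' y)
        + Real.sqrt ε * ((Real.sqrt (M.area i k))⁻¹ * G) := by
    intro m ε hε hε'
    have h3 := abs_slabMean_sub_le (hfg m).memLp_val hfg'.memLp_val ((hfg m).memLp_grad i)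
      (hfg'.memLp_grad i) i hk hε hε'
    rw [← (hc m).eq_slabMean (hfg m) hk hε hε', ← hc'.eq_slabMean hfg' hk hε hε'] at h3
    have h4 := l2Norm_sub_le ((hfg m).memLp_grad i) (hfg'.memLp_grad i)
    have h5 : l2Norm M.domain (fun y => g m i y - g' i y) ≤ G := by linarith [hC m]
    refine h3.trans ?_
    rw [mul_add]
    refine add_le_add le_rfl ?_
    have h7 : (Real.sqrt (ε * M.area i k))⁻¹ * (ε * G)
        = Real.sqrt ε * ((Real.sqrt (M.area i k))⁻¹ * G) := by
      rw [Real.sqrt_mul hε.le]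
      have h5 := Real.sqrt_pos.2 hε
      have h6 := Real.sqrt_pos.2 hA
      have h7 : ε = Real.sqrt ε * Real.sqrt ε := (Real.mul_self_sqrt hε.le).symm
      nth_rw 2 [h7]
      field_simp
    rw [← h7]
    gcongr
  rw [Metric.tendsto_atTop]
  intro η hη
  have h5 : Tendsto (fun ε => Real.sqrt ε * ((Real.sqrt (M.area i k))⁻¹ * G)) (𝓝[>] 0)
      (𝓝 0) := by
    have : Tendsto (fun ε => Real.sqrt ε * ((Real.sqrt (M.area i k))⁻¹ * G)) (𝓝 0)
        (𝓝 (Real.sqrt 0 * ((Real.sqrt (M.area i k))⁻¹ * G))) :=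
      (Real.continuous_sqrt.tendsto 0).mul_const _
    rw [Real.sqrt_zero, zero_mul] at this
    exact this.mono_left nhdsWithin_le_nhds
  obtain ⟨ε, hε1, hε2⟩ := ((h5.eventually (gt_mem_nhds (half_pos hη))).and
    (Ioc_mem_nhdsGT hw)).exists
  have h6 := (tendsto_l2Norm hlim).const_mul (Real.sqrt (ε * M.area i k))⁻¹
  rw [mul_zero] at h6
  obtain ⟨m₀, hm₀⟩ := eventually_atTop.1 (h6.eventually (gt_mem_nhds (half_pos hη)))
  refine ⟨m₀, fun m hm => ?_⟩
  rw [Real.dist_eq]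
  have h7 := hbound m ε hε2.1 hε2.2
  have h8 := hm₀ m hm
  linarith

theorem sub_e_area (i : Fin d) (k : Fin d → ℤ) : M.area i (k - e i) = M.area i k := by
  refine Finset.prod_congr rfl fun j hj => ?_
  rw [width, width, sub_e_of_ne _ (Finset.ne_of_mem_erase hj)]

theorem smoothFaceMean_of_notMem {φ : (Fin d → ℝ) → ℝ} (hφ : tsupport φ ⊆ M.domain) {i : Fin d}
    {k : Fin d → ℤ} (hk : ∀ j, j ≠ i → 0 ≤ k j ∧ k j < M.n j)
    (h : M.x i (k i + 1) ∉ Set.Ioo (M.x i 0) (M.x i (M.n i))) : M.smoothFaceMean φ i k = 0 := by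
  rw [smoothFaceMean_eq φ i hk, sectionIntegral]
  have : ∀ z, φ (insertCoord i (M.x i (k i + 1)) z) = 0 := by
    intro z
    apply image_eq_zero_of_notMem_tsupport
    intro hz
    have := hφ hz i trivial
    rw [insertCoord_same] at this
    exact h this
  simp [this]

/-- The divergence theorem on a cell, for one component. -/
theorem area_mul_sub_eq_integral {f : (Fin d → ℝ) → ℝ} {g : Fin d → (Fin d → ℝ) → ℝ}
    (hfg : HasH10Grad M.domain f g) {i : Fin d} {c : (Fin d → ℤ) → ℝ}
    (hc : ∀ k ∈ M.faces i, M.IsFaceMean f i k (c k)) (hc0 : ∀ k, k ∉ M.faces i → c k = 0)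
    {k : Fin d → ℤ} (hk : k ∈ M.cells) :
    M.area i k * c k - M.area i (k - e i) * c (k - e i) = ∫ y in M.cellBox k, 1 * g i y := by
  obtain ⟨φ, hφ⟩ := hfg.approx
  have hkk := mem_cells.1 hk
  have hlim1 : ∀ k ∈ M.faces i, Tendsto (fun l => M.smoothFaceMean (φ l) i k) atTop (𝓝 (c k)) := by
    intro k hk
    have hw := width_pos (mem_cells.1 (cells_of_mem_faces hk) i)
    rw [(hc k hk).eq_slabMean hfg (cells_of_mem_faces hk) hw le_rfl]
    exact tendsto_smoothFaceMean hfg hφ i (cells_of_mem_faces hk) hw le_rfl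
  have hup : Tendsto (fun l => M.smoothFaceMean (φ l) i k) atTop (𝓝 (c k)) := by
    by_cases h : k ∈ M.faces i
    · exact hlim1 k h
    · rw [hc0 k h]
      have h1 : k i + 1 = M.n i := by
        rw [faces, Finset.mem_filter, not_and] at h
        have := h hk
        have := (hkk i).2
        omega
      simp only [fun l => smoothFaceMean_of_notMem (hφ.support_subset l) (i := i) (k := k)
        (fun j _ => hkk j) (by simp [h1])]
      exact tendsto_const_nhds
  have hoff : ∀ j, j ≠ i → 0 ≤ (k - e i) j ∧ (k - e i) j < M.n j := fun j hj => by
    rw [sub_e_of_ne _ hj]; exact hkk j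
  have hdown : Tendsto (fun l => M.smoothFaceMean (φ l) i (k - e i)) atTop
      (𝓝 (c (k - e i))) := by
    by_cases h : k - e i ∈ M.faces i
    · exact hlim1 _ h
    · rw [hc0 _ h]
      have h1 : k i = 0 := by
        by_contra hne
        apply h
        rw [mem_faces, sub_add_cancel]
        refine ⟨mem_cells.2 fun j => ?_, hk⟩
        by_cases hj : j = i
        · subst hj
          rw [sub_e_same]
          have := hkk j
          omega
        · exact hoff j hj
      have hz : ∀ l, M.smoothFaceMean (φ l) i (k - e i) = 0 := fun l =>
        smoothFaceMean_of_notMem (hφ.support_subset l) hoff (by rw [sub_e_same, h1]; simp)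
      simp only [hz]
      exact tendsto_const_nhds
  have hcell := tendsto_setIntegral_mul (measurableSet_cellBox k) (cellBox_subset_domain hk)
    (volume_cellBox_ne_top k) (hfg.memLp_grad i) (hφ.memLp_grad i) (hφ.tendsto_grad i)
    (measurable_const (a := (1 : ℝ))) zero_le_one (fun y _ => by simp)
  have hA := (area_pos i hk).ne'
  have heq : ∀ l, ∫ y in M.cellBox k, 1 * partialDeriv i (φ l) y
      = M.area i k * M.smoothFaceMean (φ l) i k
        - M.area i (k - e i) * M.smoothFaceMean (φ l) i (k - e i) := by
    intro l
    have h1 := setIntegral_affine (hφ.smooth l) i (lo := M.lowerCorner k) (hi := M.upperCorner k)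
      (by have := (width_pos (hkk i)).le; rw [width_eq (hkk i)] at this; exact sub_nonneg.1 this)
      1 0
    simp only [zero_mul, zero_add, add_zero] at h1
    rw [cellBox_eq, h1, smoothFaceMean_eq _ _ (fun j _ => hkk j), smoothFaceMean_eq _ _ hoff,
      sub_e_area, sub_e_same, sub_add_cancel,
      sectionIntegral_congr (φ l) i (lo := M.lowerCorner (k - e i)) (lo' := M.lowerCorner k)
        (hi := M.upperCorner (k - e i)) (hi' := M.upperCorner k)
        (fun j hj => by simp only [lowerCorner, sub_e_of_ne k hj])
        (fun j hj => by simp only [upperCorner, sub_e_of_ne k hj])]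
    simp only [upperCorner, lowerCorner]
    field_simp
  simp only [heq] at hcell
  exact tendsto_nhds_unique ((hup.const_mul _).sub (hdown.const_mul _)) hcell

/-- The discrete divergence of the face means is the cell mean of the divergence. -/
theorem divVel_eq_integral {f : Fin d → (Fin d → ℝ) → ℝ} {g : Fin d → Fin d → (Fin d → ℝ) → ℝ}
    (hfg : ∀ i, HasH10Grad M.domain (f i) (g i)) {U : M.FaceField}
    (hU : M.IsFaceInterpolate f U) (k : M.cells) :
    divVel U k = (1 / M.vol k) * ∫ y in M.cellBox k, 1 * ∑ i, g i i y := by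
  rw [divVel_eq]
  congr 1
  simp only [Finset.mul_sum]
  rw [integral_finsetSum]
  · refine Finset.sum_congr rfl fun i _ => ?_
    refine area_mul_sub_eq_integral (hfg i) (c := fv U i) (fun k hk => ?_)
      (fun k hk => fv_of_notMem U hk) k.2
    rw [fv_of_mem U hk]
    exact hU i ⟨k, hk⟩
  · intro i _
    exact integrable_mul_of_memLp (measurableSet_cellBox _) (cellBox_subset_domain k.2)
      (volume_cellBox_ne_top _) ((hfg i).memLp_grad i) measurable_const (W := 1)
      (fun y _ => by simp)

theorem abs_divVel_le {f : Fin d → (Fin d → ℝ) → ℝ} {g : Fin d → Fin d → (Fin d → ℝ) → ℝ}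
    (hfg : ∀ i, HasH10Grad M.domain (f i) (g i)) {U : M.FaceField}
    (hU : M.IsFaceInterpolate f U) (k : M.cells) :
    |divVel U k| ≤ (1 / M.vol k) * (Real.sqrt (M.vol k)
      * l2Norm M.domain (fun y => ∑ i, g i i y)) := by
  have hv := vol_pos k.2
  rw [divVel_eq_integral hfg hU k, abs_mul, abs_of_pos (by positivity : 0 < 1 / M.vol k)]
  have h1 := abs_setIntegral_mul_le (measurableSet_cellBox (M := M) k) (cellBox_subset_domain k.2)
    (volume_cellBox_ne_top _) (f := fun y => ∑ i, g i i y)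
    (memLp_finsetSum _ fun i _ => (hfg i).memLp_grad i) (ψ := fun _ => 1) zero_le_one
    (fun y _ => by simp)
  rw [volume_cellBox k.2, one_mul] at h1
  gcongr

end MACMesh

/-! ### Weak compactness in `H¹₀(Ω)` -/

/-- The closed convex hulls of the tails of a bounded sequence of a Hilbert space have a
common point. -/
theorem exists_mem_closure_convexHull_tails {E : Type*} [NormedAddCommGroup E]
    [InnerProductSpace ℝ E] [CompleteSpace E] {x : ℕ → E} {R : ℝ} (hx : ∀ m, ‖x m‖ ≤ R) :
    ∃ y, ∀ m, y ∈ closure (convexHull ℝ (x '' Set.Ici m)) := by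
  set K : ℕ → Set E := fun m => closure (convexHull ℝ (x '' Set.Ici m)) with hK
  have hKconv : ∀ m, Convex ℝ (K m) := fun m => (convex_convexHull ℝ _).closure
  have hKne : ∀ m, (K m).Nonempty := fun m =>
    ⟨x m, subset_closure (subset_convexHull ℝ _ ⟨m, Set.mem_Ici.2 le_rfl, rfl⟩)⟩
  have hKmono : ∀ m n, m ≤ n → K n ⊆ K m := fun m n h =>
    closure_mono (convexHull_mono (Set.image_mono (Set.Ici_subset_Ici.2 h)))
  have hKb : ∀ m, K m ⊆ Metric.closedBall 0 R := fun m =>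
    closure_minimal (convexHull_min (by
      rintro _ ⟨l, _, rfl⟩
      simpa using hx l) (convex_closedBall _ _)) Metric.isClosed_closedBall
  have hex : ∀ m, ∃ p ∈ K m, ∀ w ∈ K m, ‖p‖ ^ 2 ≤ inner ℝ p w := by
    intro m
    obtain ⟨p, hp, hmin⟩ := exists_norm_eq_iInf_of_complete_convex (hKne m)
      isClosed_closure.isComplete (hKconv m) 0
    refine ⟨p, hp, fun w hw => ?_⟩
    have := (norm_eq_iInf_iff_real_inner_le_zero (hKconv m) hp).1 hmin w hw
    rw [zero_sub, inner_neg_left, inner_sub_right, real_inner_self_eq_norm_sq] at this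
    linarith
  choose p hp hmin using hex
  have hdist : ∀ m n, m ≤ n → ‖p n - p m‖ ^ 2 ≤ ‖p n‖ ^ 2 - ‖p m‖ ^ 2 := by
    intro m n h
    rw [norm_sub_sq_real, real_inner_comm]
    linarith [hmin m (p n) (hKmono m n h (hp n))]
  have hmono : Monotone fun m => ‖p m‖ ^ 2 := fun m n h => by
    have := hdist m n h
    have h2 := sq_nonneg ‖p n - p m‖
    show ‖p m‖ ^ 2 ≤ ‖p n‖ ^ 2
    linarith
  have hbdd : BddAbove (Set.range fun m => ‖p m‖ ^ 2) := by
    refine ⟨R ^ 2, ?_⟩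
    rintro _ ⟨m, rfl⟩
    have : ‖p m‖ ≤ R := by simpa using hKb m (hp m)
    exact pow_le_pow_left₀ (norm_nonneg _) this 2
  have hlim := tendsto_atTop_ciSup hmono hbdd
  have hcau : CauchySeq p := by
    rw [Metric.cauchySeq_iff']
    intro ε hε
    obtain ⟨m, hm⟩ := Metric.cauchySeq_iff'.1 hlim.cauchySeq (ε ^ 2) (by positivity)
    refine ⟨m, fun n hn => ?_⟩
    rw [dist_eq_norm]
    have h1 := (le_abs_self _).trans_lt (hm n hn)
    exact lt_of_pow_lt_pow_left₀ 2 hε.le ((hdist m n hn).trans_lt h1)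
  obtain ⟨y, hy⟩ := cauchySeq_tendsto_of_complete hcau
  refine ⟨y, fun m => isClosed_closure.mem_of_tendsto hy ?_⟩
  filter_upwards [eventually_ge_atTop m] with n hn
  exact hKmono m n hn (hp n)

section

variable {d : ℕ}

/-- The space of pairs of a function and a vector field of `L²(Ω)`. -/
abbrev GradSpace (μ : Measure (Fin d → ℝ)) : Type := PiLp 2 fun _ : Option (Fin d) => Lp ℝ 2 μ

/-- The pairs `(φ, ∇ φ)`, `φ ∈ C_c^∞(Ω)`. -/
def smoothPairs (Ω : Set (Fin d → ℝ)) : Set (GradSpace (volume.restrict Ω)) :=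
  {x | ∃ φ : (Fin d → ℝ) → ℝ, ContDiff ℝ ∞ φ ∧ HasCompactSupport φ ∧ tsupport φ ⊆ Ω ∧
    x none =ᵐ[volume.restrict Ω] φ ∧ ∀ j, x (some j) =ᵐ[volume.restrict Ω] partialDeriv j φ}

theorem convex_smoothPairs (Ω : Set (Fin d → ℝ)) : Convex ℝ (smoothPairs Ω) := by
  rintro x ⟨φ, hφ, hφc, hφs, hx, hxg⟩ y ⟨ψ, hψ, hψc, hψs, hy, hyg⟩ a b - - -
  have h1 : tsupport (fun z => a * φ z + b * ψ z) ⊆ tsupport φ ∪ tsupport ψ := by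
    refine (closure_minimal ?_ ((isClosed_tsupport φ).union (isClosed_tsupport ψ)))
    intro z hz
    by_contra hcon
    rw [Set.mem_union, not_or] at hcon
    apply hz
    simp [image_eq_zero_of_notMem_tsupport hcon.1, image_eq_zero_of_notMem_tsupport hcon.2]
  refine ⟨fun z => a * φ z + b * ψ z, by fun_prop, ?_, h1.trans (Set.union_subset hφs hψs), ?_, ?_⟩
  · exact HasCompactSupport.of_support_subset_isCompact (hφc.isCompact.union hψc.isCompact)
      ((subset_tsupport _).trans h1)
  · have e1 : (a • x + b • y) none = a • x none + b • y none := rfl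
    rw [e1]
    filter_upwards [Lp.coeFn_add (a • x none) (b • y none), Lp.coeFn_smul a (x none),
      Lp.coeFn_smul b (y none), hx, hy] with z h1 h2 h3 h4 h5
    rw [h1]
    simp [h2, h3, h4, h5]
  · intro j
    have e1 : (a • x + b • y) (some j) = a • x (some j) + b • y (some j) := rfl
    rw [e1]
    filter_upwards [Lp.coeFn_add (a • x (some j)) (b • y (some j)), Lp.coeFn_smul a (x (some j)),
      Lp.coeFn_smul b (y (some j)), hxg j, hyg j] with z h1 h2 h3 h4 h5
    have hφd : DifferentiableAt ℝ φ z := (hφ.differentiable (by simp)) z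
    have hψd : DifferentiableAt ℝ ψ z := (hψ.differentiable (by simp)) z
    have h6 : partialDeriv j (fun z => a * φ z + b * ψ z) z
        = a * partialDeriv j φ z + b * partialDeriv j ψ z := by
      rw [partialDeriv, fderiv_fun_add (hφd.const_mul a) (hψd.const_mul b),
        fderiv_const_mul hφd, fderiv_const_mul hψd]
      simp [partialDeriv]
    rw [h1, h6]
    simp [h2, h3, h4, h5]

/-- The element of `L²(Ω) × L²(Ω)^d` given by square integrable functions. -/
noncomputable def toGradSpace {μ : Measure (Fin d → ℝ)} {f : (Fin d → ℝ) → ℝ}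
    {g : Fin d → (Fin d → ℝ) → ℝ} (hf : MemLp f 2 μ) (hg : ∀ j, MemLp (g j) 2 μ) : GradSpace μ :=
  WithLp.toLp 2 fun o => o.elim (hf.toLp f) fun j => (hg j).toLp (g j)

theorem tendsto_toLp {α : Type*} [MeasurableSpace α] {μ : Measure α} {F : ℕ → α → ℝ} {f : α → ℝ}
    (hF : ∀ l, MemLp (F l) 2 μ) (hf : MemLp f 2 μ)
    (h : Tendsto (fun l => eLpNorm (fun y => F l y - f y) 2 μ) atTop (𝓝 0)) :
    Tendsto (fun l => (hF l).toLp (F l)) atTop (𝓝 (hf.toLp f)) :=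
  (Lp.tendsto_Lp_iff_tendsto_eLpNorm'' F hF f hf).2 h

theorem HasH10Grad.mem_closure {Ω : Set (Fin d → ℝ)} {f : (Fin d → ℝ) → ℝ}
    {g : Fin d → (Fin d → ℝ) → ℝ} (h : HasH10Grad Ω f g) :
    toGradSpace h.memLp_val h.memLp_grad ∈ closure (smoothPairs Ω) := by
  obtain ⟨φ, hφ⟩ := h.approx
  rw [mem_closure_iff_seq_limit]
  refine ⟨fun l => toGradSpace (hφ.memLp_val l) (fun j => hφ.memLp_grad j l), fun l => ?_, ?_⟩
  · exact ⟨φ l, hφ.smooth l, hφ.compactSupport l, hφ.support_subset l,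
      (hφ.memLp_val l).coeFn_toLp, fun j => (hφ.memLp_grad j l).coeFn_toLp⟩
  · refine ((PiLp.continuous_toLp 2 _).tendsto _).comp (tendsto_pi_nhds.2 fun o => ?_)
    cases o with
    | none => exact tendsto_toLp hφ.memLp_val h.memLp_val hφ.tendsto_val
    | some j => exact tendsto_toLp (hφ.memLp_grad j) (h.memLp_grad j) (hφ.tendsto_grad j)

/-- A limit in `L²(Ω)` of a sequence which is bounded in `H¹₀(Ω)` belongs to `H¹₀(Ω)`. -/
theorem exists_hasH10Grad_of_tendsto {Ω : Set (Fin d → ℝ)} {f : ℕ → (Fin d → ℝ) → ℝ}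
    {g : ℕ → Fin d → (Fin d → ℝ) → ℝ} {f' : (Fin d → ℝ) → ℝ} (h : ∀ m, HasH10Grad Ω (f m) (g m))
    (hf' : MemLp f' 2 (volume.restrict Ω)) {C : ℝ} (hC : ∀ m j, l2Norm Ω (g m j) ≤ C)
    (hlim : Tendsto (fun m => eLpNorm (fun y => f m y - f' y) 2 (volume.restrict Ω)) atTop (𝓝 0)) :
    ∃ g', HasH10Grad Ω f' g' := by
  set x : ℕ → GradSpace (volume.restrict Ω) :=
    fun m => toGradSpace (h m).memLp_val (h m).memLp_grad with hx
  have hnone : Tendsto (fun m => x m none) atTop (𝓝 (hf'.toLp f')) :=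
    tendsto_toLp (fun m => (h m).memLp_val) hf' hlim
  obtain ⟨R, hR⟩ : ∃ R, ∀ m, ‖x m‖ ≤ R := by
    obtain ⟨B, hB⟩ := (Metric.isBounded_range_of_tendsto _ hnone).exists_norm_le
    refine ⟨Real.sqrt (B ^ 2 + ∑ _j : Fin d, C ^ 2), fun m => ?_⟩
    rw [PiLp.norm_eq_of_L2, Fintype.sum_option]
    refine Real.sqrt_le_sqrt (add_le_add ?_ (Finset.sum_le_sum fun j _ => ?_))
    · exact pow_le_pow_left₀ (norm_nonneg _) (hB _ ⟨m, rfl⟩) 2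
    · refine pow_le_pow_left₀ (norm_nonneg _) ?_ 2
      refine le_trans (le_of_eq ?_) (hC m j)
      exact Lp.norm_toLp _ ((h m).memLp_grad j)
  obtain ⟨y, hy⟩ := exists_mem_closure_convexHull_tails hR
  have hyS : y ∈ closure (smoothPairs Ω) := by
    refine closure_minimal (convexHull_min ?_ (convex_smoothPairs Ω).closure) isClosed_closure
      (hy 0)
    rintro _ ⟨m, _, rfl⟩
    exact (h m).mem_closure
  have hy0 : y none = hf'.toLp f' := by
    rw [← dist_le_zero]
    refine le_of_forall_pos_le_add fun η hη => ?_
    rw [zero_add]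
    obtain ⟨m, hm⟩ := Metric.tendsto_atTop.1 hnone η hη
    have hcl : IsClosed {z : GradSpace (volume.restrict Ω) |
        z none ∈ Metric.closedBall (hf'.toLp f') η} :=
      Metric.isClosed_closedBall.preimage
        (PiLp.proj (𝕜 := ℝ) 2 (fun _ : Option (Fin d) => Lp ℝ 2 (volume.restrict Ω)) none).continuous
    have hcv : Convex ℝ {z : GradSpace (volume.restrict Ω) |
        z none ∈ Metric.closedBall (hf'.toLp f') η} :=
      (convex_closedBall (hf'.toLp f') η).linear_preimage
        (PiLp.proj (𝕜 := ℝ) 2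
          (fun _ : Option (Fin d) => Lp ℝ 2 (volume.restrict Ω)) none).toLinearMap
    have := closure_minimal (convexHull_min (s := x '' Set.Ici m) (by
      rintro _ ⟨l, hl, rfl⟩
      exact (hm l hl).le) hcv) hcl (hy m)
    exact this
  obtain ⟨s, hs, hsy⟩ := mem_closure_iff_seq_limit.1 hyS
  choose φ hφ hφc hφs hφv hφg using hs
  have hcoord : ∀ o, Tendsto (fun l => s l o) atTop (𝓝 (y o)) := fun o =>
    ((PiLp.proj (𝕜 := ℝ) 2
      (fun _ : Option (Fin d) => Lp ℝ 2 (volume.restrict Ω)) o).continuous.tendsto y).comp hsy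
  refine ⟨fun j => y (some j), hf', fun j => Lp.memLp _, φ, hφ, hφc, hφs, ?_, fun j => ?_⟩
  · have h1 := (Lp.tendsto_Lp_iff_tendsto_eLpNorm' _ _).1 (hcoord none)
    refine h1.congr fun l => eLpNorm_congr_ae ?_
    rw [hy0]
    filter_upwards [hφv l, hf'.coeFn_toLp] with z h1 h2
    simp [h1, h2]
  · have h1 := (Lp.tendsto_Lp_iff_tendsto_eLpNorm' _ _).1 (hcoord (some j))
    refine h1.congr fun l => eLpNorm_congr_ae ?_
    filter_upwards [hφg l j] with z h1
    simp [h1]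

end

namespace MACMesh

variable {d : ℕ} {M : MACMesh d}

/-! ### Continuity of the discrete operators -/

theorem continuous_fv (i : Fin d) (k : Fin d → ℤ) : Continuous fun u : M.FaceField => fv u i k := by
  by_cases h : k ∈ M.faces i
  · simp only [fv_of_mem _ h]; fun_prop
  · simp only [fv_of_notMem _ h]; fun_prop

theorem continuous_cv (k : Fin d → ℤ) : Continuous fun p : M.CellField => cv p k := by
  by_cases h : k ∈ M.cells
  · simp only [cv_of_mem _ h]; fun_prop
  · simp only [cv, h, dite_false]; fun_prop

theorem continuous_divVel : Continuous (divVel : M.FaceField → M.CellField) := by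
  refine continuous_pi fun k => ?_
  simp only [divVel_eq]
  have h := fun i k => continuous_fv (M := M) i k
  fun_prop

theorem continuous_grad (i : Fin d) (k : Fin d → ℤ) :
    Continuous fun p : M.CellField => grad p i k := by
  have h := fun k => continuous_cv (M := M) k
  simp only [grad]
  fun_prop

theorem continuous_divTau (μ lam : ℝ) (i : Fin d) (k : Fin d → ℤ) :
    Continuous fun v : M.FaceField => divTau μ lam v i k := by
  have h := fun i k => continuous_fv (M := M) i k
  have h2 : Continuous fun v : M.FaceField => grad (divVel v) i k :=
    (continuous_grad i k).comp continuous_divVel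
  simp only [divTau, laplacian, diffFlux]
  fun_prop

theorem continuous_dualDensity (i : Fin d) (k : Fin d → ℤ) :
    Continuous fun ρ : M.CellField => dualDensity ρ i k := by
  have h := fun k => continuous_cv (M := M) k
  simp only [dualDensity]
  fun_prop

theorem continuous_integral : Continuous (integral : M.CellField → ℝ) := by
  unfold integral
  fun_prop

theorem dualDensity_one {i : Fin d} {k : Fin d → ℤ} (hk : k ∈ M.faces i) :
    dualDensity (M := M) (fun _ => 1) i k = 1 := by
  have h := (dualVol_pos hk).ne'
  rw [dualDensity, cv_of_mem _ (cells_of_mem_faces hk), cv_of_mem _ (add_e_mem_cells hk), mul_one,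
    mul_one, ← dualVol, div_self h]

section Limits

variable {ρ : ℕ → M.CellField} {u w : ℕ → M.FaceField} {u' w' : M.FaceField}

theorem tendsto_dualDensity (hρ : Tendsto ρ atTop (𝓝 fun _ => 1)) {i : Fin d} {k : Fin d → ℤ}
    (hk : k ∈ M.faces i) : Tendsto (fun m => dualDensity (ρ m) i k) atTop (𝓝 1) := by
  have := ((continuous_dualDensity i k).tendsto _).comp hρ
  rwa [dualDensity_one hk] at this

theorem tendsto_massFlux (hρ : Tendsto ρ atTop (𝓝 fun _ => 1)) (hu : Tendsto u atTop (𝓝 u'))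
    (i : Fin d) (k : Fin d → ℤ) :
    Tendsto (fun m => massFlux (ρ m) (u m) i k) atTop (𝓝 (massFlux (fun _ => 1) u' i k)) := by
  by_cases hk : k ∈ M.faces i
  · rw [massFlux_one]
    simp only [massFlux]
    have hK := ((continuous_cv k).tendsto _).comp hρ
    have hL := ((continuous_cv (k + e i)).tendsto _).comp hρ
    rw [cv_of_mem _ (cells_of_mem_faces hk)] at hK
    rw [cv_of_mem _ (add_e_mem_cells hk)] at hL
    have hite : Tendsto (fun m => if 0 ≤ fv (u m) i k then cv (ρ m) k else cv (ρ m) (k + e i))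
        atTop (𝓝 1) := by
      rw [Metric.tendsto_nhds] at hK hL ⊢
      intro ε hε
      filter_upwards [hK ε hε, hL ε hε] with m h1 h2
      split_ifs
      exacts [h1, h2]
    simpa using (hite.const_mul (M.area i k)).mul (((continuous_fv i k).tendsto _).comp hu)
  · simp only [massFlux_of_notMem _ _ hk]
    exact tendsto_const_nhds

theorem tendsto_divMass (hρ : Tendsto ρ atTop (𝓝 fun _ => 1)) (hu : Tendsto u atTop (𝓝 u'))
    (k : Fin d → ℤ) :
    Tendsto (fun m => divMass (ρ m) (u m) k) atTop (𝓝 (divMass (fun _ => 1) u' k)) :=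
  (tendsto_finsetSum _ fun i _ =>
    (tendsto_massFlux hρ hu i k).sub (tendsto_massFlux hρ hu i (k - e i))).const_mul _

theorem tendsto_conv (hρ : Tendsto ρ atTop (𝓝 fun _ => 1)) (hw : Tendsto w atTop (𝓝 w'))
    (hu : Tendsto u atTop (𝓝 u')) (i : Fin d) (k : Fin d → ℤ) :
    Tendsto (fun m => conv (ρ m) (w m) (u m) i k) atTop (𝓝 (conv (fun _ => 1) w' u' i k)) := by
  have hfl : ∀ j k, Tendsto (fun m => dualFlux (ρ m) (u m) i j k) atTop
      (𝓝 (dualFlux (fun _ => 1) u' i j k)) := fun j k =>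
    ((tendsto_massFlux hρ hu j k).add (tendsto_massFlux hρ hu j (k + e i))).div_const 2
  have hv : ∀ j k, Tendsto (fun m => dualFaceVal (w m) i j k) atTop
      (𝓝 (dualFaceVal w' i j k)) := fun j k =>
    ((((continuous_fv i k).tendsto _).comp hw).add
      (((continuous_fv i (k + e j)).tendsto _).comp hw)).div_const 2
  exact (tendsto_finsetSum _ fun j _ => ((hfl j k).mul (hv j k)).sub
    ((hfl j (k - e j)).mul (hv j (k - e j)))).const_mul _

end Limits

theorem grad_deltaP (γ Ma : ℝ) (ρ : M.CellField) {i : Fin d} {k : Fin d → ℤ}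
    (hk : k ∈ M.faces i) :
    grad (deltaP γ Ma ρ) i k = (1 / Ma ^ 2) * grad (pressure γ ρ) i k := by
  simp only [grad, cv_of_mem _ (cells_of_mem_faces hk), cv_of_mem _ (add_e_mem_cells hk), deltaP]
  ring

theorem integral_deltaP (γ Ma : ℝ) (ρ : M.CellField) : integral (deltaP γ Ma ρ) = 0 := by
  have hV := (sum_vol_pos (M := M)).ne'
  rw [integral]
  simp only [deltaP, mul_div_assoc', ← Finset.sum_div, mul_sub, Finset.sum_sub_distrib,
    ← Finset.sum_mul]
  rw [← mul_assoc, mul_inv_cancel₀ hV, one_mul, integral, sub_self, zero_div]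

/-! ### Sequences of solutions of the compressible scheme -/

/-- A sequence of solutions of the compressible scheme with vanishing Mach numbers and
well-prepared initial discrete fields. -/
structure IsLowMachSequence (M : MACMesh d) (γ μ lam δt : ℝ) (N : ℕ) (Ma : ℕ → ℝ)
    (ρ : ℕ → ℤ → M.CellField) (u w : ℕ → ℕ → M.FaceField) (V₀ : M.FaceField) : Prop where
  mach_pos : ∀ m, 0 < Ma m
  mach_tendsto : Tendsto Ma atTop (𝓝 0)
  density_init : ∃ C : ℝ, ∀ m k, |ρ m 0 k - 1| ≤ C * Ma m ^ 2
  velocity_init : Tendsto (fun m => u m 0) atTop (𝓝 V₀)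
  div_init : ∀ k : M.cells, divVel V₀ k = 0
  sol : ∀ m, ∃ ρ₀ u₀, IsCompressibleSol γ μ lam δt (Ma m) N ρ₀ u₀ (ρ m) (u m) (w m)

namespace IsLowMachSequence

variable {γ μ lam δt : ℝ} {N : ℕ} {Ma : ℕ → ℝ} {ρ : ℕ → ℤ → M.CellField}
  {u w : ℕ → ℕ → M.FaceField} {V₀ : M.FaceField}

theorem comp (H : IsLowMachSequence M γ μ lam δt N Ma ρ u w V₀) {θ : ℕ → ℕ}
    (hθ : Tendsto θ atTop atTop) :
    IsLowMachSequence M γ μ lam δt N (fun m => Ma (θ m)) (fun m => ρ (θ m)) (fun m => u (θ m))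
      (fun m => w (θ m)) V₀ where
  mach_pos m := H.mach_pos _
  mach_tendsto := H.mach_tendsto.comp hθ
  density_init := by
    obtain ⟨C, hC⟩ := H.density_init
    exact ⟨C, fun m => hC _⟩
  velocity_init := H.velocity_init.comp hθ
  div_init := H.div_init
  sol m := H.sol _

theorem tendsto_mach_sq (H : IsLowMachSequence M γ μ lam δt N Ma ρ u w V₀) :
    Tendsto (fun m => Ma m ^ 2) atTop (𝓝 0) := by
  simpa using H.mach_tendsto.pow 2

theorem tendsto_density_zero (H : IsLowMachSequence M γ μ lam δt N Ma ρ u w V₀) :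
    Tendsto (fun m => ρ m 0) atTop (𝓝 fun _ => 1) := by
  obtain ⟨C, hC⟩ := H.density_init
  rw [tendsto_pi_nhds]
  intro k
  rw [tendsto_iff_norm_sub_tendsto_zero]
  refine squeeze_zero (fun _ => norm_nonneg _) (fun m => hC m k) ?_
  simpa using H.tendsto_mach_sq.const_mul C

theorem tendsto_density_neg_one (H : IsLowMachSequence M γ μ lam δt N Ma ρ u w V₀) (hδt : 0 < δt) :
    Tendsto (fun m => ρ m (-1)) atTop (𝓝 fun _ => 1) := by
  rw [tendsto_pi_nhds]
  intro k
  have h1 : ∀ m, ρ m (-1) k = ρ m 0 k + δt * divMass (ρ m 0) (u m 0) k := by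
    intro m
    obtain ⟨ρ₀, u₀, hs⟩ := H.sol m
    have := hs.init_backward k
    field_simp at this
    linarith
  simp only [h1]
  have h2 := tendsto_divMass H.tendsto_density_zero H.velocity_init k
  have h3 : divMass (fun _ => 1) V₀ k = 0 := H.div_init k
  rw [h3] at h2
  simpa using (tendsto_pi_nhds.1 H.tendsto_density_zero k).add (h2.const_mul δt)

/-- The initial scaled pressure variations are bounded. -/
theorem isBigO_pressure_init (H : IsLowMachSequence M γ μ lam δt N Ma ρ u w V₀) (k : M.cells) :
    (fun m => (1 / Ma m ^ 2) * (ρ m 0 k ^ γ - 1)) =O[atTop] fun _ => (1 : ℝ) := by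
  obtain ⟨C, hC⟩ := H.density_init
  have h1 : (fun x : ℝ => x ^ γ - 1 ^ γ) =O[𝓝 1] fun x => x - 1 :=
    (Real.hasDerivAt_rpow_const (Or.inl one_ne_zero)).isBigO_sub
  have h2 := h1.comp_tendsto (tendsto_pi_nhds.1 H.tendsto_density_zero k)
  have h3 : (fun m => ρ m 0 k - 1) =O[atTop] fun m => Ma m ^ 2 := by
    refine Asymptotics.IsBigO.of_bound C (Eventually.of_forall fun m => ?_)
    rw [Real.norm_eq_abs, Real.norm_of_nonneg (sq_nonneg _)]
    exact hC m k
  have h4 := (Asymptotics.isBigO_refl (fun m => 1 / Ma m ^ 2) atTop).mul (h2.trans h3)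
  refine (h4.congr (fun m => ?_) (fun m => ?_))
  · simp
  · have := (H.mach_pos m).ne'
    field_simp

theorem isBigO_elastic_init (H : IsLowMachSequence M γ μ lam δt N Ma ρ u w V₀) {Ψ h : ℝ → ℝ}
    (hΨ : IsElasticPotential γ Ψ h) (k : M.cells) :
    (fun m => (1 / Ma m ^ 2) * Ψ (ρ m 0 k)) =O[atTop] fun _ => (1 : ℝ) := by
  obtain ⟨C, hC⟩ := H.density_init
  have hk := tendsto_pi_nhds.1 H.tendsto_density_zero k
  have h1 : (fun m => h (ρ m 0 k)) =O[atTop] fun _ => (1 : ℝ) :=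
    (hΨ.continuousAt_deriv.tendsto.comp hk).isBigO_one ℝ
  refine Asymptotics.IsBigO.trans ?_ (h1.const_mul_left C)
  refine Asymptotics.IsBigO.of_bound 1 ?_
  filter_upwards [hk.eventually (lt_mem_nhds one_pos)] with m hm
  have hMa := H.mach_pos m
  have h0 := hΨ.nonneg hm
  have h2 := hΨ.le_deriv_mul hm
  have h3 := hC m k
  rw [one_mul, Real.norm_of_nonneg (by positivity), Real.norm_eq_abs, abs_mul]
  calc (1 / Ma m ^ 2) * Ψ (ρ m 0 k) ≤ (1 / Ma m ^ 2) * (|h (ρ m 0 k)| * (C * Ma m ^ 2)) := by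
        gcongr
        exact h2.trans (by gcongr)
    _ = C * |h (ρ m 0 k)| := by field_simp
    _ ≤ |C| * |h (ρ m 0 k)| := by gcongr; exact le_abs_self C

/-- The initial energy is bounded. -/
theorem isBigO_energy_init (H : IsLowMachSequence M γ μ lam δt N Ma ρ u w V₀) (hδt : 0 < δt)
    {Ψ h : ℝ → ℝ} (hΨ : IsElasticPotential γ Ψ h) :
    (fun m => energy γ δt (Ma m) Ψ (ρ m (-1)) (ρ m 0) (u m 0)) =O[atTop] fun _ => (1 : ℝ) := by
  unfold energy
  refine Asymptotics.IsBigO.add ?_ ?_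
  · refine Asymptotics.IsBigO.fun_sum fun i _ => Asymptotics.IsBigO.fun_sum fun k hk => ?_
    refine Asymptotics.IsBigO.const_mul_left (Asymptotics.IsBigO.add ?_ ?_) _
    · have h1 := tendsto_dualDensity (H.tendsto_density_neg_one hδt) hk
      have h2 := ((continuous_fv i k).tendsto _).comp H.velocity_init
      exact ((h1.mul (h2.pow 2)).div_const 2).isBigO_one ℝ
    · have h1 := tendsto_dualDensity (H.tendsto_density_neg_one hδt) hk
      have h3 : Tendsto (fun m => δt ^ 2 / (2 * dualDensity (ρ m (-1)) i k)) atTop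
          (𝓝 (δt ^ 2 / (2 * 1))) := tendsto_const_nhds.div (h1.const_mul 2) (by norm_num)
      have h4 : (fun m => (1 / Ma m ^ 2) * grad (pressure γ (ρ m 0)) i k)
          =O[atTop] fun _ => (1 : ℝ) := by
        have h5 := ((H.isBigO_pressure_init ⟨_, add_e_mem_cells hk⟩).sub
          (H.isBigO_pressure_init ⟨k, cells_of_mem_faces hk⟩)).const_mul_left
            (M.area i k / M.dualVol i k)
        refine h5.congr_left fun m => ?_
        simp only [grad, cv_of_mem _ (cells_of_mem_faces hk), cv_of_mem _ (add_e_mem_cells hk),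
          pressure]
        ring
      refine ((h4.pow 2).mul (h3.isBigO_one ℝ)).congr (fun m => ?_) (fun m => by simp)
      ring
  · have : ∀ m, (1 / Ma m ^ 2) * ∑ k : M.cells, M.vol k * Ψ (ρ m 0 k)
        = ∑ k : M.cells, M.vol k * ((1 / Ma m ^ 2) * Ψ (ρ m 0 k)) := fun m => by
      rw [Finset.mul_sum]
      exact Finset.sum_congr rfl fun k _ => by ring
    simp only [this]
    exact Asymptotics.IsBigO.fun_sum fun k _ => (H.isBigO_elastic_init hΨ k).const_mul_left _

/-- Positivity of the density and boundedness of the energy, at all times. -/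
theorem exists_energy_bound (H : IsLowMachSequence M γ μ lam δt N Ma ρ u w V₀) (hδt : 0 < δt)
    (hμ : 0 ≤ μ) (hlam : 0 ≤ μ + lam) {Ψ h : ℝ → ℝ} (hΨ : IsElasticPotential γ Ψ h) :
    ∃ E : ℝ, ∀ᶠ m in atTop, ∀ n : ℕ, n ≤ N → (∀ k, 0 < ρ m (n - 1) k) ∧ (∀ k, 0 < ρ m n k) ∧
      energy γ δt (Ma m) Ψ (ρ m (n - 1)) (ρ m n) (u m n) ≤ E := by
  obtain ⟨E, hE⟩ := (H.isBigO_energy_init hδt hΨ).bound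
  refine ⟨E, ?_⟩
  have hp0 : ∀ᶠ m in atTop, ∀ k, 0 < ρ m 0 k := eventually_all.2 fun k =>
    (tendsto_pi_nhds.1 H.tendsto_density_zero k).eventually (lt_mem_nhds one_pos)
  have hp1 : ∀ᶠ m in atTop, ∀ k, 0 < ρ m (-1) k := eventually_all.2 fun k =>
    (tendsto_pi_nhds.1 (H.tendsto_density_neg_one hδt) k).eventually (lt_mem_nhds one_pos)
  filter_upwards [hE, hp0, hp1] with m hEm h0 h1
  obtain ⟨ρ₀, u₀, hs⟩ := H.sol m
  have hmass : ∀ n : ℕ, n ≤ N → ∀ k : M.cells,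
      (1 / δt) * (ρ m n k - ρ m (n - 1) k) + divMass (ρ m n) (u m n) k = 0 := by
    intro n hn k
    cases n with
    | zero => simpa using hs.init_backward k
    | succ n => simpa using hs.mass n hn k
  intro n
  induction n with
  | zero =>
    intro _
    refine ⟨by simpa using h1, by simpa using h0, ?_⟩
    have := (le_abs_self _).trans hEm
    simpa using this
  | succ n ih =>
    intro hn
    obtain ⟨i1, i2, i3⟩ := ih (by omega)
    have e1 : (((n + 1 : ℕ) : ℤ) - 1) = n := by push_cast; ring
    rw [e1]
    have hm1 := hs.mass n hn
    refine ⟨i2, by simpa using density_pos_of_mass_balance hδt i2 hm1, le_trans ?_ i3⟩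
    simpa using energy_le hδt hμ hlam hΨ i1 i2 (hmass n (by omega)) (hs.prediction n hn)
      (hs.correction n hn) hm1

theorem energy_terms_nonneg {Ma : ℝ} {Ψ h : ℝ → ℝ} (hΨ : IsElasticPotential γ Ψ h)
    {ρm ρ : M.CellField} (u : M.FaceField) (hρm : ∀ k, 0 < ρm k) (hρ : ∀ k, 0 < ρ k) :
    (∀ i, ∀ k ∈ M.faces i, M.dualVol i k * (dualDensity ρm i k * fv u i k ^ 2 / 2
      + δt ^ 2 * ((1 / Ma ^ 2) * grad (pressure γ ρ) i k) ^ 2 / (2 * dualDensity ρm i k))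
      ≤ energy γ δt Ma Ψ ρm ρ u) ∧
    ∀ k : M.cells, (1 / Ma ^ 2) * (M.vol k * Ψ (ρ k)) ≤ energy γ δt Ma Ψ ρm ρ u := by
  have h1 : ∀ i, ∀ k ∈ M.faces i, 0 ≤ M.dualVol i k * (dualDensity ρm i k * fv u i k ^ 2 / 2
      + δt ^ 2 * ((1 / Ma ^ 2) * grad (pressure γ ρ) i k) ^ 2 / (2 * dualDensity ρm i k)) := by
    intro i k hk
    have := dualVol_pos hk
    have := dualDensity_pos hρm hk
    positivity
  have h2 : ∀ k : M.cells, 0 ≤ M.vol k * Ψ (ρ k) := fun k =>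
    mul_nonneg (vol_pos k.2).le (hΨ.nonneg (hρ k))
  have h3 : 0 ≤ 1 / Ma ^ 2 := by positivity
  have h4 : ∀ i, 0 ≤ ∑ k ∈ M.faces i, M.dualVol i k * (dualDensity ρm i k * fv u i k ^ 2 / 2
      + δt ^ 2 * ((1 / Ma ^ 2) * grad (pressure γ ρ) i k) ^ 2 / (2 * dualDensity ρm i k)) :=
    fun i => Finset.sum_nonneg (h1 i)
  constructor
  · intro i k hk
    refine (Finset.single_le_sum (h1 i) hk).trans ?_
    refine (Finset.single_le_sum (fun i _ => h4 i) (Finset.mem_univ i)).trans ?_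
    exact le_add_of_nonneg_right (mul_nonneg h3 (Finset.sum_nonneg fun k _ => h2 k))
  · intro k
    refine (mul_le_mul_of_nonneg_left
      (Finset.single_le_sum (fun k _ => h2 k) (Finset.mem_univ k)) h3).trans ?_
    exact le_add_of_nonneg_left (Finset.sum_nonneg fun i _ => h4 i)

/-- The discrete densities converge to one. -/
theorem tendsto_density (H : IsLowMachSequence M γ μ lam δt N Ma ρ u w V₀) (hδt : 0 < δt)
    (hγ : 1 ≤ γ) (hμ : 0 ≤ μ) (hlam : 0 ≤ μ + lam) {n : ℕ} (hn : n ≤ N) :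
    Tendsto (fun m => ρ m n) atTop (𝓝 fun _ => 1) := by
  obtain ⟨Ψ, h, hΨ⟩ := exists_isElasticPotential hγ
  obtain ⟨E, hE⟩ := H.exists_energy_bound hδt hμ hlam hΨ
  rw [tendsto_pi_nhds]
  intro k
  rw [Metric.tendsto_nhds]
  intro ε hε
  obtain ⟨η, hη, hcoer⟩ := hΨ.coercive hε
  have hv := vol_pos k.2
  have h1 : Tendsto (fun m => Ma m ^ 2 * (E / M.vol k)) atTop (𝓝 0) := by
    simpa using H.tendsto_mach_sq.mul_const (E / M.vol k)
  filter_upwards [hE, h1.eventually (gt_mem_nhds hη)] with m hm hlt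
  obtain ⟨i1, i2, i3⟩ := hm n hn
  have h2 := ((energy_terms_nonneg (δt := δt) (Ma := Ma m) hΨ (u m n) i1 i2).2 k).trans i3
  rw [Real.dist_eq]
  refine hcoer _ (i2 k) (lt_of_le_of_lt ?_ hlt)
  have hMa := H.mach_pos m
  field_simp at h2 ⊢
  linarith

theorem tendsto_density_pred (H : IsLowMachSequence M γ μ lam δt N Ma ρ u w V₀) (hδt : 0 < δt)
    (hγ : 1 ≤ γ) (hμ : 0 ≤ μ) (hlam : 0 ≤ μ + lam) {n : ℕ} (hn : n ≤ N) :
    Tendsto (fun m => ρ m (n - 1)) atTop (𝓝 fun _ => 1) := by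
  cases n with
  | zero => simpa using H.tendsto_density_neg_one hδt
  | succ n => simpa using H.tendsto_density hδt hγ hμ hlam (n := n) (by omega)

theorem _root_.isBigO_one_of_sq_le {f : ℕ → ℝ} {C : ℝ} (h : ∀ᶠ m in atTop, f m ^ 2 ≤ C) :
    f =O[atTop] fun _ => (1 : ℝ) := by
  refine Asymptotics.IsBigO.of_bound (Real.sqrt C) ?_
  filter_upwards [h] with m hm
  rw [norm_one, mul_one, Real.norm_eq_abs]
  exact Real.abs_le_sqrt hm

/-- The velocities and the scaled pressure gradients are bounded. -/
theorem isBigO_velocity_grad (H : IsLowMachSequence M γ μ lam δt N Ma ρ u w V₀) (hδt : 0 < δt)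
    (hγ : 1 ≤ γ) (hμ : 0 ≤ μ) (hlam : 0 ≤ μ + lam) {n : ℕ} (hn : n ≤ N) {i : Fin d}
    {k : Fin d → ℤ} (hk : k ∈ M.faces i) :
    ((fun m => fv (u m n) i k) =O[atTop] fun _ => (1 : ℝ)) ∧
      (fun m => (1 / Ma m ^ 2) * grad (pressure γ (ρ m n)) i k) =O[atTop] fun _ => (1 : ℝ) := by
  obtain ⟨Ψ, h, hΨ⟩ := exists_isElasticPotential hγ
  obtain ⟨E, hE⟩ := H.exists_energy_bound hδt hμ hlam hΨ
  have hr := tendsto_dualDensity (H.tendsto_density_pred hδt hγ hμ hlam hn) hk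
  have hD := dualVol_pos hk
  have hlow : ∀ᶠ m in atTop, 1 / 2 < dualDensity (ρ m (n - 1)) i k :=
    hr.eventually (lt_mem_nhds (by norm_num))
  have hup : ∀ᶠ m in atTop, dualDensity (ρ m (n - 1)) i k < 2 :=
    hr.eventually (gt_mem_nhds (by norm_num))
  have key : ∀ᶠ m in atTop, fv (u m n) i k ^ 2 ≤ 4 * E / M.dualVol i k ∧
      ((1 / Ma m ^ 2) * grad (pressure γ (ρ m n)) i k) ^ 2 ≤ 4 * E / (M.dualVol i k * δt ^ 2) := by
    filter_upwards [hE, hlow, hup] with m hm hl hu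
    obtain ⟨i1, i2, i3⟩ := hm n hn
    have h2 := ((energy_terms_nonneg (δt := δt) (Ma := Ma m) hΨ (u m n) i1 i2).1 i k hk).trans i3
    generalize dualDensity (ρ m (n - 1)) i k = r at *
    generalize fv (u m n) i k = a at *
    generalize (1 / Ma m ^ 2) * grad (pressure γ (ρ m n)) i k = g at *
    have hr0 : 0 < r := by linarith
    have h3 : a ^ 2 / 4 ≤ r * a ^ 2 / 2 := by nlinarith [sq_nonneg a]
    have h4 : δt ^ 2 * g ^ 2 / 4 ≤ δt ^ 2 * g ^ 2 / (2 * r) := by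
      apply div_le_div_of_nonneg_left (by positivity) (by positivity)
      linarith
    have h5 : 0 ≤ δt ^ 2 * g ^ 2 / 4 := by positivity
    have h6 : 0 ≤ a ^ 2 / 4 := by positivity
    constructor
    · rw [le_div_iff₀ hD]
      have : M.dualVol i k * (a ^ 2 / 4) ≤ E := le_trans (by gcongr; linarith) h2
      linarith
    · rw [le_div_iff₀ (by positivity)]
      have : M.dualVol i k * (δt ^ 2 * g ^ 2 / 4) ≤ E := le_trans (by gcongr; linarith) h2
      linarith
  exact ⟨isBigO_one_of_sq_le (key.mono fun m h => h.1),
    isBigO_one_of_sq_le (key.mono fun m h => h.2)⟩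

theorem isBigO_velocity (H : IsLowMachSequence M γ μ lam δt N Ma ρ u w V₀) (hδt : 0 < δt)
    (hγ : 1 ≤ γ) (hμ : 0 ≤ μ) (hlam : 0 ≤ μ + lam) {n : ℕ} (hn : n ≤ N) :
    (fun m => u m n) =O[atTop] fun _ => (1 : ℝ) := by
  refine Asymptotics.isBigO_pi.2 fun i => Asymptotics.isBigO_pi.2 fun k => ?_
  have := (H.isBigO_velocity_grad hδt hγ hμ hlam hn k.2).1
  simpa only [fv_of_mem _ k.2] using this

/-- The scaled pressure deviations are bounded. -/
theorem isBigO_deltaP (H : IsLowMachSequence M γ μ lam δt N Ma ρ u w V₀) (hδt : 0 < δt)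
    (hγ : 1 ≤ γ) (hμ : 0 ≤ μ) (hlam : 0 ≤ μ + lam) {n : ℕ} (hn : n ≤ N) :
    (fun m => deltaP γ (Ma m) (ρ m n)) =O[atTop] fun _ => (1 : ℝ) := by
  refine Asymptotics.isBigO_pi.2 fun k => ?_
  set c : ℕ → ℝ := fun m => ∑ i, ∑ k ∈ M.faces i,
    M.dualVol i k / M.area i k * |(1 / Ma m ^ 2) * grad (pressure γ (ρ m n)) i k| with hc
  have hcO : c =O[atTop] fun _ => (1 : ℝ) :=
    Asymptotics.IsBigO.fun_sum fun i _ => Asymptotics.IsBigO.fun_sum fun k hk =>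
      ((H.isBigO_velocity_grad hδt hγ hμ hlam hn hk).2.norm_left).const_mul_left _
  refine Asymptotics.IsBigO.trans (Asymptotics.IsBigO.of_bound 1 (Eventually.of_forall fun m => ?_))
    (hcO.const_mul_left (2 * M.layers))
  have hnn : ∀ i, ∀ k ∈ M.faces i, 0 ≤ M.dualVol i k / M.area i k
      * |(1 / Ma m ^ 2) * grad (pressure γ (ρ m n)) i k| := fun i k hk => by
    have := dualVol_pos hk
    have := area_pos i (cells_of_mem_faces hk)
    positivity
  have hc0 : 0 ≤ c m := Finset.sum_nonneg fun i _ => Finset.sum_nonneg (hnn i)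
  rw [one_mul]
  refine le_trans ?_ (le_abs_self _)
  refine abs_le_of_faces hc0 (fun i k hk => ?_) (integral_deltaP _ _ _) k
  rw [abs_cv_sub_eq _ hk, grad_deltaP _ _ _ hk]
  exact (Finset.single_le_sum (hnn i) hk).trans (Finset.single_le_sum
    (f := fun i => ∑ k ∈ M.faces i, M.dualVol i k / M.area i k
      * |(1 / Ma m ^ 2) * grad (pressure γ (ρ m n)) i k|)
    (fun i _ => Finset.sum_nonneg (hnn i)) (Finset.mem_univ i))

theorem tendsto_sqrt_ratio (H : IsLowMachSequence M γ μ lam δt N Ma ρ u w V₀) (hδt : 0 < δt)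
    (hγ : 1 ≤ γ) (hμ : 0 ≤ μ) (hlam : 0 ≤ μ + lam) {n : ℕ} (hn : n ≤ N) {i : Fin d}
    {k : Fin d → ℤ} (hk : k ∈ M.faces i) :
    Tendsto (fun m => Real.sqrt (dualDensity (ρ m n) i k / dualDensity (ρ m (n - 1)) i k)) atTop
      (𝓝 1) := by
  have h1 := (tendsto_dualDensity (H.tendsto_density hδt hγ hμ hlam hn) hk).div
    (tendsto_dualDensity (H.tendsto_density_pred hδt hγ hμ hlam hn) hk) one_ne_zero
  have h2 := h1.sqrt
  simpa using h2

theorem isBigO_predicted (H : IsLowMachSequence M γ μ lam δt N Ma ρ u w V₀) (hδt : 0 < δt)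
    (hγ : 1 ≤ γ) (hμ : 0 ≤ μ) (hlam : 0 ≤ μ + lam) {n : ℕ} (hn : n < N) :
    (fun m => w m (n + 1)) =O[atTop] fun _ => (1 : ℝ) := by
  refine Asymptotics.isBigO_pi.2 fun i => Asymptotics.isBigO_pi.2 fun k => ?_
  obtain ⟨h1, h2⟩ := H.isBigO_velocity_grad hδt hγ hμ hlam (n := n + 1) hn k.2
  have h3 := (H.isBigO_velocity_grad hδt hγ hμ hlam hn.le k.2).2
  have h4 := (H.tendsto_sqrt_ratio hδt hγ hμ hlam hn.le k.2).isBigO_one ℝ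
  have h5 := tendsto_dualDensity (H.tendsto_density hδt hγ hμ hlam hn.le) k.2
  have h6 : (fun m => δt / dualDensity (ρ m n) i k) =O[atTop] fun _ => (1 : ℝ) :=
    (tendsto_const_nhds.div h5 one_ne_zero).isBigO_one ℝ
  have h7 := h1.add ((h6.mul (h2.sub ((h4.mul h3).congr_right fun _ => by simp))).congr_right
    fun _ => by simp)
  refine h7.congr' ?_ EventuallyEq.rfl
  filter_upwards [h5.eventually (lt_mem_nhds one_pos)] with m hm
  obtain ⟨ρ₀, u₀, hs⟩ := H.sol m
  have e1 := hs.correction n hn i k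
  rw [fv_of_mem _ k.2]
  have hMa := (H.mach_pos m).ne'
  push_cast
  generalize Real.sqrt (dualDensity (ρ m n) i k / dualDensity (ρ m (n - 1)) i k) = s at *
  field_simp at e1 ⊢
  linarith

end IsLowMachSequence

end MACMesh

namespace MACMesh

variable {d : ℕ} {M : MACMesh d}

namespace IsLowMachSequence

variable {γ μ lam δt : ℝ} {N : ℕ} {Ma : ℕ → ℝ} {ρ : ℕ → ℤ → M.CellField}
  {u w : ℕ → ℕ → M.FaceField} {V₀ : M.FaceField}

/-- A subsequential limit of `(u, δp)` along which the predicted velocities converge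
solves the incompressible scheme. -/
theorem isIncompressibleSol (H : IsLowMachSequence M γ μ lam δt N Ma ρ u w V₀) (hδt : 0 < δt)
    (hγ : 1 ≤ γ) (hμ : 0 ≤ μ) (hlam : 0 ≤ μ + lam) {v z : ℕ → M.FaceField} {π : ℕ → M.CellField}
    {P₀ : M.CellField} (hP : Tendsto (fun m => deltaP γ (Ma m) (ρ m 0)) atTop (𝓝 P₀))
    (hv : ∀ n ≤ N, Tendsto (fun m => u m n) atTop (𝓝 (v n)))
    (hz : ∀ n < N, Tendsto (fun m => w m (n + 1)) atTop (𝓝 (z (n + 1))))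
    (hπ : ∀ n ≤ N, Tendsto (fun m => deltaP γ (Ma m) (ρ m n)) atTop (𝓝 (π n))) :
    IsIncompressibleSol μ lam δt N V₀ P₀ v z π := by
  have hgrad : ∀ n ≤ N, ∀ i, ∀ k ∈ M.faces i,
      Tendsto (fun m => (1 / Ma m ^ 2) * grad (pressure γ (ρ m n)) i k) atTop
        (𝓝 (grad (π n) i k)) := by
    intro n hn i k hk
    simp only [← grad_deltaP _ _ _ hk]
    exact ((continuous_grad i k).tendsto _).comp (hπ n hn)
  have hsgrad : ∀ n ≤ N, ∀ i, ∀ k ∈ M.faces i,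
      Tendsto (fun m => (1 / Ma m ^ 2) * (Real.sqrt (dualDensity (ρ m n) i k
        / dualDensity (ρ m (n - 1)) i k) * grad (pressure γ (ρ m n)) i k)) atTop
        (𝓝 (grad (π n) i k)) := by
    intro n hn i k hk
    have := (H.tendsto_sqrt_ratio hδt hγ hμ hlam hn hk).mul (hgrad n hn i k hk)
    rw [one_mul] at this
    exact this.congr fun m => by ring
  have hcoord : ∀ {x : ℕ → M.FaceField} {y : M.FaceField}, Tendsto x atTop (𝓝 y) →
      ∀ i k, Tendsto (fun m => x m i k) atTop (𝓝 (y i k)) := fun h i k =>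
    tendsto_pi_nhds.1 (tendsto_pi_nhds.1 h i) k
  refine ⟨tendsto_nhds_unique (hv 0 (Nat.zero_le _)) H.velocity_init,
    tendsto_nhds_unique (by simpa using hπ 0 (Nat.zero_le _)) hP, fun n hn => ?_,
    fun n hn i k => ?_, fun n hn i k => ?_, fun n hn k => ?_⟩
  · have h1 := (continuous_integral.tendsto _).comp (hπ n hn)
    simp only [Function.comp_def, integral_deltaP] at h1
    exact tendsto_nhds_unique h1 tendsto_const_nhds
  · have hd1 := tendsto_dualDensity (H.tendsto_density hδt hγ hμ hlam hn.le) k.2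
    have hd2 := tendsto_dualDensity (H.tendsto_density_pred hδt hγ hμ hlam hn.le) k.2
    have h1 := ((((hd1.mul (hcoord (hz n hn) i k)).sub
      (hd2.mul (hcoord (hv n hn.le) i k))).const_mul (1 / δt)).add
      (tendsto_conv (H.tendsto_density hδt hγ hμ hlam hn.le) (hz n hn) (hv n hn.le) i k)).sub
      (((continuous_divTau μ lam i k).tendsto _).comp (hz n hn))
    have h2 := h1.add (hsgrad n hn.le i k k.2)
    rw [one_mul, one_mul] at h2
    refine tendsto_nhds_unique h2 (tendsto_const_nhds.congr fun m => ?_)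
    obtain ⟨ρ₀, u₀, hs⟩ := H.sol m
    exact (hs.prediction n hn i k).symm
  · have hd1 := tendsto_dualDensity (H.tendsto_density hδt hγ hμ hlam hn.le) k.2
    have h1 := ((((hd1.const_mul (1 / δt)).mul ((hcoord (hv (n + 1) hn) i k).sub
      (hcoord (hz n hn) i k)))).add (hgrad (n + 1) hn i k k.2)).sub (hsgrad n hn.le i k k.2)
    rw [mul_one] at h1
    refine tendsto_nhds_unique h1 (tendsto_const_nhds.congr fun m => ?_)
    obtain ⟨ρ₀, u₀, hs⟩ := H.sol m
    simpa using (hs.correction n hn i k).symm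
  · have hr0 := tendsto_pi_nhds.1 (H.tendsto_density hδt hγ hμ hlam hn.le) k
    have hr1 := H.tendsto_density hδt hγ hμ hlam (n := n + 1) hn
    have h1 := (((tendsto_pi_nhds.1 hr1 k).sub hr0).const_mul (1 / δt)).add
      (tendsto_divMass hr1 (hv (n + 1) hn) k)
    rw [sub_self, mul_zero, zero_add] at h1
    refine tendsto_nhds_unique h1 (tendsto_const_nhds.congr fun m => ?_)
    obtain ⟨ρ₀, u₀, hs⟩ := H.sol m
    simpa using (hs.mass n hn k).symm

theorem _root_.exists_subseq_tendsto_of_isBigO_one {X : Type*} [NormedAddCommGroup X] [ProperSpace X]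
    {x : ℕ → X} (h : x =O[atTop] fun _ => (1 : ℝ)) :
    ∃ a, ∃ ψ : ℕ → ℕ, StrictMono ψ ∧ Tendsto (fun m => x (ψ m)) atTop (𝓝 a) := by
  obtain ⟨c, hc⟩ := h.bound
  have h1 : ∃ᶠ m in atTop, x m ∈ Metric.closedBall (0 : X) c :=
    (hc.mono fun m hm => by simpa using hm).frequently
  obtain ⟨a, -, ψ, hψ, hlim⟩ := tendsto_subseq_of_frequently_bounded Metric.isBounded_closedBall h1
  exact ⟨a, ψ, hψ, hlim⟩

/-- Compactness: a subsequence converges to a solution of the incompressible scheme. -/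
theorem exists_subseq (H : IsLowMachSequence M γ μ lam δt N Ma ρ u w V₀) (hδt : 0 < δt)
    (hγ : 1 ≤ γ) (hμ : 0 ≤ μ) (hlam : 0 ≤ μ + lam) {P₀ : M.CellField}
    (hP : Tendsto (fun m => deltaP γ (Ma m) (ρ m 0)) atTop (𝓝 P₀)) :
    ∃ (v z : ℕ → M.FaceField) (π : ℕ → M.CellField), IsIncompressibleSol μ lam δt N V₀ P₀ v z π ∧
      ∃ ψ : ℕ → ℕ, StrictMono ψ ∧ ∀ n ≤ N, Tendsto (fun m => u (ψ m) n) atTop (𝓝 (v n)) ∧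
        Tendsto (fun m => deltaP γ (Ma (ψ m)) (ρ (ψ m) n)) atTop (𝓝 (π n)) := by
  have hX : (fun m => ((fun n : Fin (N + 1) => (u m n, deltaP γ (Ma m) (ρ m n))),
      (fun n : Fin N => w m (n + 1)))) =O[atTop] fun _ => (1 : ℝ) := by
    refine Asymptotics.IsBigO.prod_left (Asymptotics.isBigO_pi.2 fun n => ?_)
      (Asymptotics.isBigO_pi.2 fun n => H.isBigO_predicted hδt hγ hμ hlam n.2)
    exact (H.isBigO_velocity hδt hγ hμ hlam (Nat.lt_succ_iff.1 n.2)).prod_left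
      (H.isBigO_deltaP hδt hγ hμ hlam (Nat.lt_succ_iff.1 n.2))
  obtain ⟨⟨a, b⟩, ψ, hψ, hlim⟩ := exists_subseq_tendsto_of_isBigO_one hX
  rw [Prod.tendsto_iff] at hlim
  have h1 := fun n => tendsto_pi_nhds.1 hlim.1 n
  have h2 := fun n => tendsto_pi_nhds.1 hlim.2 n
  simp only [Prod.tendsto_iff] at h1
  have hv : ∀ n ≤ N, Tendsto (fun m => u (ψ m) n) atTop
      (𝓝 (if h : n < N + 1 then (a ⟨n, h⟩).1 else 0)) := by
    intro n hn
    rw [dif_pos (Nat.lt_succ_of_le hn)]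
    exact (h1 ⟨n, Nat.lt_succ_of_le hn⟩).1
  have hπ : ∀ n ≤ N, Tendsto (fun m => deltaP γ (Ma (ψ m)) (ρ (ψ m) n)) atTop
      (𝓝 (if h : n < N + 1 then (a ⟨n, h⟩).2 else 0)) := by
    intro n hn
    rw [dif_pos (Nat.lt_succ_of_le hn)]
    exact (h1 ⟨n, Nat.lt_succ_of_le hn⟩).2
  have hz : ∀ n < N, Tendsto (fun m => w (ψ m) (n + 1)) atTop
      (𝓝 (if h : n + 1 - 1 < N then b ⟨n + 1 - 1, h⟩ else 0)) := by
    intro n hn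
    rw [dif_pos (by simpa using hn)]
    exact h2 ⟨n, hn⟩
  exact ⟨fun n => if h : n < N + 1 then (a ⟨n, h⟩).1 else 0,
    fun n => if h : n - 1 < N then b ⟨n - 1, h⟩ else 0,
    fun n => if h : n < N + 1 then (a ⟨n, h⟩).2 else 0,
    (H.comp hψ.tendsto_atTop).isIncompressibleSol hδt hγ hμ hlam (hP.comp hψ.tendsto_atTop) hv hz hπ,
    ψ, hψ, fun n hn => ⟨hv n hn, hπ n hn⟩⟩

/-- Convergence to the unique solution of the incompressible scheme. -/
theorem exists_tendsto (H : IsLowMachSequence M γ μ lam δt N Ma ρ u w V₀) (hδt : 0 < δt)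
    (hγ : 1 ≤ γ) (hμ : 0 ≤ μ) (hlam : 0 ≤ μ + lam) {P₀ : M.CellField}
    (hP : Tendsto (fun m => deltaP γ (Ma m) (ρ m 0)) atTop (𝓝 P₀)) :
    ∃ (v z : ℕ → M.FaceField) (π : ℕ → M.CellField), IsIncompressibleSol μ lam δt N V₀ P₀ v z π ∧
      ∀ n ≤ N, Tendsto (fun m => u m n) atTop (𝓝 (v n)) ∧
        Tendsto (fun m => deltaP γ (Ma m) (ρ m n)) atTop (𝓝 (π n)) := by
  obtain ⟨v, z, π, hsol, -⟩ := H.exists_subseq hδt hγ hμ hlam hP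
  refine ⟨v, z, π, hsol, fun n hn => ?_⟩
  rw [← Prod.tendsto_iff (fun m => (u m n, deltaP γ (Ma m) (ρ m n))) (v n, π n)]
  refine tendsto_of_subseq_tendsto fun θ hθ => ?_
  obtain ⟨v', z', π', hsol', ψ, -, hlim⟩ := (H.comp hθ).exists_subseq hδt hγ hμ hlam (hP.comp hθ)
  obtain ⟨e1, e2⟩ := (hsol.unique hδt hμ hlam H.div_init hsol').1 n hn
  refine ⟨ψ, ?_⟩
  rw [Prod.tendsto_iff, ← e1, ← e2]
  exact hlim n hn

end IsLowMachSequence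

/-! ### Convergence of the density functions -/

theorem cellBox_disjoint {k l : Fin d → ℤ} (hk : k ∈ M.cells) (hl : l ∈ M.cells)
    {y : Fin d → ℝ} (hyk : y ∈ M.cellBox k) (hyl : y ∈ M.cellBox l) : k = l := by
  funext j
  have h1 := hyk j trivial
  have h2 := hyl j trivial
  beta_reduce at h1 h2
  have a1 := mem_cells.1 hk j
  have a2 := mem_cells.1 hl j
  by_contra hne
  rcases lt_or_gt_of_ne hne with h | h
  · have := x_mono (M := M) j (a := k j + 1) (b := l j) (by omega) (by omega) (by omega)
    linarith [h1.2, h2.1]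
  · have := x_mono (M := M) j (a := l j + 1) (b := k j) (by omega) (by omega) (by omega)
    linarith [h2.2, h1.1]

theorem cellFun_of_mem (p : M.CellField) {k : M.cells} {y : Fin d → ℝ} (hy : y ∈ M.cellBox k) :
    cellFun p y = p k := by
  rw [cellFun, Finset.sum_eq_single k]
  · rw [Set.indicator_of_mem hy]
  · intro l _ hl
    refine Set.indicator_of_notMem (fun hyl => hl ?_) _
    exact Subtype.ext (cellBox_disjoint l.2 k.2 hyl hy)
  · simp

theorem exists_mem_Ioo_of_ne (j : Fin d) {t : ℝ} (ht : t ∈ Set.Ioo (M.x j 0) (M.x j (M.n j)))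
    (hne : ∀ a : ℤ, t ≠ M.x j a) :
    ∃ a : ℤ, (0 ≤ a ∧ a < M.n j) ∧ t ∈ Set.Ioo (M.x j a) (M.x j (a + 1)) := by
  have key : ∀ n : ℕ, t < M.x j n →
      ∃ a : ℤ, (0 ≤ a ∧ a < n) ∧ t ∈ Set.Ioo (M.x j a) (M.x j (a + 1)) := by
    intro n
    induction n with
    | zero => intro h; exact absurd (ht.1.trans h) (by simp)
    | succ n ih =>
      intro h
      rcases lt_or_gt_of_ne (hne n) with h1 | h1
      · obtain ⟨a, ⟨h2, h3⟩, h4⟩ := ih h1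
        exact ⟨a, ⟨h2, by push_cast; omega⟩, h4⟩
      · exact ⟨n, ⟨by positivity, by push_cast; omega⟩, h1, by simpa using h⟩
  exact key (M.n j) ht.2

theorem ae_exists_mem_cellBox :
    ∀ᵐ y ∂(volume.restrict M.domain), ∃ k : M.cells, y ∈ M.cellBox k := by
  have h1 : ∀ᵐ y : Fin d → ℝ, ∀ j, ∀ a : ℤ, y j ≠ M.x j a := by
    rw [ae_all_iff]
    intro j
    rw [ae_all_iff]
    intro a
    exact Measure.ae_eval_ne (fun _ : Fin d => (volume : Measure ℝ)) j (M.x j a)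
  have hm : MeasurableSet M.domain :=
    MeasurableSet.univ_pi fun _ => measurableSet_Ioo
  rw [ae_restrict_iff' hm]
  filter_upwards [h1] with y hy hyd
  choose a ha hya using fun j => exists_mem_Ioo_of_ne (M := M) j (hyd j trivial) (hy j)
  exact ⟨⟨a, mem_cells.2 ha⟩, fun j _ => hya j⟩

theorem eLpNorm_cellFun_sub_one_le (p : M.CellField) (q : ℝ≥0∞) :
    eLpNorm (fun y => cellFun p y - 1) q (volume.restrict M.domain)
      ≤ (volume M.domain) ^ q.toReal⁻¹ * ENNReal.ofReal (∑ k, |p k - 1|) := by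
  have := eLpNorm_le_of_ae_bound (p := q) (μ := volume.restrict M.domain)
    (f := fun y => cellFun p y - 1) (C := ∑ k, |p k - 1|) (by
      filter_upwards [ae_exists_mem_cellBox (M := M)] with y hy
      obtain ⟨k, hk⟩ := hy
      rw [cellFun_of_mem p hk, Real.norm_eq_abs]
      exact Finset.single_le_sum (f := fun k => |p k - 1|) (fun k _ => abs_nonneg _)
        (Finset.mem_univ k))
  simpa using this

theorem tendsto_densityFun {ρ : ℕ → ℤ → M.CellField} {T δt : ℝ} (hδt : 0 < δt) {N : ℕ}
    (hN : N = ⌊T / δt⌋₊) (h : ∀ n ≤ N, Tendsto (fun m => ρ m (n : ℕ)) atTop (𝓝 fun _ => 1))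
    (q : ℝ≥0∞) :
    Tendsto (fun m => ⨆ t ∈ Set.Icc 0 T, eLpNorm (fun y => densityFun δt (ρ m) t y - 1) q
      (volume.restrict M.domain)) atTop (𝓝 0) := by
  have hfin : (volume M.domain) ^ q.toReal⁻¹ ≠ (⊤ : ℝ≥0∞) :=
    ENNReal.rpow_ne_top_of_nonneg (by positivity)
      (volume_openBox_ne_top (fun j => M.x j 0) (fun j => M.x j (M.n j)))
  have h1 : Tendsto (fun m => ∑ n ∈ Finset.range (N + 1), ∑ k, |ρ m (n : ℕ) k - 1|) atTop
      (𝓝 0) := by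
    have : Tendsto (fun m => ∑ n ∈ Finset.range (N + 1), ∑ k, |ρ m (n : ℕ) k - 1|) atTop
        (𝓝 (∑ n ∈ Finset.range (N + 1), ∑ k : M.cells, |(1 : ℝ) - 1|)) :=
      tendsto_finsetSum _ fun n hn => tendsto_finsetSum _ fun k _ =>
        ((tendsto_pi_nhds.1 (h n (Nat.lt_succ_iff.1 (Finset.mem_range.1 hn))) k).sub_const 1).abs
    simpa using this
  have h2 : Tendsto (fun m => (volume M.domain) ^ q.toReal⁻¹
      * ENNReal.ofReal (∑ n ∈ Finset.range (N + 1), ∑ k, |ρ m (n : ℕ) k - 1|)) atTop (𝓝 0) := by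
    have := ENNReal.Tendsto.const_mul (ENNReal.tendsto_ofReal h1) (Or.inr hfin)
    simpa using this
  refine tendsto_of_tendsto_of_tendsto_of_le_of_le tendsto_const_nhds h2 (fun _ => zero_le)
    (fun m => iSup₂_le fun t ht => ?_)
  have hfl : ⌊t / δt⌋ = ((⌊t / δt⌋₊ : ℕ) : ℤ) :=
    (Int.natCast_floor_eq_floor (div_nonneg ht.1 hδt.le)).symm
  have hle : ⌊t / δt⌋₊ ≤ N := by
    rw [hN]
    exact Nat.floor_le_floor (div_le_div_of_nonneg_right ht.2 hδt.le)
  simp only [densityFun, hfl]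
  refine (eLpNorm_cellFun_sub_one_le _ _).trans ?_
  gcongr
  exact Finset.single_le_sum (f := fun n : ℕ => ∑ k, |ρ m (n : ℕ) k - 1|)
    (fun n _ => Finset.sum_nonneg fun k _ => abs_nonneg _)
    (Finset.mem_range.2 (Nat.lt_succ_of_le hle))

/-! ### Well-prepared data -/

theorem _root_.Seminorm.tendsto_zero {X : Type*} [NormedAddCommGroup X] [NormedSpace ℝ X]
    [FiniteDimensional ℝ X] (p : Seminorm ℝ X) {x : ℕ → X} (h : Tendsto x atTop (𝓝 0)) :
    Tendsto (fun m => p (x m)) atTop (𝓝 0) := by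
  have hc : Continuous p := by
    rw [← continuousOn_univ]
    simpa using p.convexOn.continuousOn_interior
  have := (hc.tendsto 0).comp h
  rwa [map_zero] at this

/-- The initial discrete densities are close to one. -/
theorem abs_setAverage_sub_one_le {ρ₀ : (Fin d → ℝ) → ℝ}
    (hρ : MemLp ρ₀ (⊤ : ℝ≥0∞) (volume.restrict M.domain)) {k : Fin d → ℤ} (hk : k ∈ M.cells) :
    |(⨍ y in M.cellBox k, ρ₀ y) - 1|
      ≤ (eLpNorm (fun y => ρ₀ y - 1) (⊤ : ℝ≥0∞) (volume.restrict M.domain)).toReal := by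
  set B := (eLpNorm (fun y => ρ₀ y - 1) (⊤ : ℝ≥0∞) (volume.restrict M.domain)).toReal with hB
  have hv := vol_pos hk
  have hreal : volume.real (M.cellBox k) = M.vol k := volume_cellBox hk
  have hfin : IsFiniteMeasure (volume.restrict M.domain) :=
    ⟨by
      rw [Measure.restrict_apply_univ]
      exact (volume_openBox_ne_top (fun j => M.x j 0) (fun j => M.x j (M.n j))).lt_top⟩
  have hsub := cellBox_subset_domain hk
  have hmem : MemLp (fun y => ρ₀ y - 1) (⊤ : ℝ≥0∞) (volume.restrict M.domain) :=
    hρ.sub (memLp_const 1)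
  have hae : ∀ᵐ y ∂(volume.restrict M.domain), ‖ρ₀ y - 1‖ ≤ B := by
    have := ae_le_eLpNormEssSup (f := fun y => ρ₀ y - 1) (μ := volume.restrict M.domain)
    filter_upwards [this] with y hy
    rw [hB, eLpNorm_exponent_top, ← ENNReal.ofReal_le_iff_le_toReal, ofReal_norm]
    · exact hy
    · rw [← eLpNorm_exponent_top]; exact hmem.2.ne
  have hae' : ∀ᵐ y ∂(volume.restrict (M.cellBox k)), ‖ρ₀ y - 1‖ ≤ B :=
    ae_restrict_of_ae_restrict_of_subset hsub hae
  have hint : IntegrableOn ρ₀ (M.cellBox k) :=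
    (hρ.integrable le_top).mono_measure (Measure.restrict_mono hsub le_rfl)
  have h1 : (⨍ y in M.cellBox k, ρ₀ y) - 1
      = (M.vol k)⁻¹ * ∫ y in M.cellBox k, (ρ₀ y - 1) := by
    rw [integral_sub hint (integrableOn_const (volume_cellBox_ne_top k)), setAverage_eq, hreal,
      setIntegral_const, hreal]
    simp only [smul_eq_mul]
    field_simp
  have h2 : ‖∫ y in M.cellBox k, (ρ₀ y - 1)‖ ≤ B * volume.real (M.cellBox k) := by
    refine norm_setIntegral_le_of_norm_le_const_ae (volume_cellBox_ne_top k).lt_top ?_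
    exact hae'
  rw [hreal, Real.norm_eq_abs] at h2
  rw [h1, abs_mul, abs_of_pos (inv_pos.2 hv), inv_mul_le_iff₀ hv]
  linarith

theorem _root_.WellPrepared.bounds {Ω : Set (Fin d → ℝ)} {Ma C : ℝ} {ρ₀ : (Fin d → ℝ) → ℝ}
    {u₀ : Fin d → (Fin d → ℝ) → ℝ} {Gu₀ : Fin d → Fin d → (Fin d → ℝ) → ℝ} (hMa : 0 < Ma)
    (h : WellPrepared Ω Ma C ρ₀ u₀ Gu₀) :
    (∀ i j, l2Norm Ω (Gu₀ i j) ≤ C) ∧ l2Norm Ω (fun y => ∑ i, Gu₀ i i y) ≤ C * Ma ∧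
      (eLpNorm (fun y => ρ₀ y - 1) (⊤ : ℝ≥0∞) (volume.restrict Ω)).toReal ≤ C * Ma ^ 2 := by
  have hb := h.bound
  have h1 : 0 ≤ h1Norm Ω u₀ Gu₀ := Real.sqrt_nonneg _
  have h2 : 0 ≤ (1 / Ma) * l2Norm Ω (fun y => ∑ i, Gu₀ i i y) :=
    mul_nonneg (by positivity) (l2Norm_nonneg _ _)
  have h3 : 0 ≤ (1 / Ma ^ 2)
      * (eLpNorm (fun y => ρ₀ y - 1) (⊤ : ℝ≥0∞) (volume.restrict Ω)).toReal := by positivity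
  refine ⟨fun i j => ?_, ?_, ?_⟩
  · refine le_trans (Real.le_sqrt_of_sq_le ?_) (by linarith : h1Norm Ω u₀ Gu₀ ≤ C)
    have e1 : ∀ i, 0 ≤ l2Norm Ω (u₀ i) ^ 2 + ∑ j, l2Norm Ω (Gu₀ i j) ^ 2 := fun i => by positivity
    refine le_trans ?_ (Finset.single_le_sum (fun i _ => e1 i) (Finset.mem_univ i))
    have e2 := Finset.single_le_sum (f := fun j => l2Norm Ω (Gu₀ i j) ^ 2)
      (fun j _ => sq_nonneg _) (Finset.mem_univ j)
    have e3 := sq_nonneg (l2Norm Ω (u₀ i))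
    linarith
  · have : (1 / Ma) * l2Norm Ω (fun y => ∑ i, Gu₀ i i y) ≤ C := by linarith
    rwa [one_div, inv_mul_le_iff₀ hMa, mul_comm] at this
  · have : (1 / Ma ^ 2)
      * (eLpNorm (fun y => ρ₀ y - 1) (⊤ : ℝ≥0∞) (volume.restrict Ω)).toReal ≤ C := by linarith
    rwa [one_div, inv_mul_le_iff₀ (by positivity), mul_comm] at this

end MACMesh

theorem mainTheorem1 (d : ℕ) (hd : d = 2 ∨ d = 3) (M : MACMesh d)
    (T δt γ μ lam : ℝ) (hT : 0 < T) (hδt : 0 < δt) (hγ : 1 ≤ γ) (hμ : 0 < μ)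
    (hμlam : 0 < μ + lam) (N : ℕ) (hN : N = ⌊T / δt⌋₊)
    (Ma : ℕ → ℝ) (hMa_pos : ∀ m, 0 < Ma m) (hMa : Tendsto Ma atTop (𝓝 0))
    -- well-prepared initial data, whose velocities converge in `L²(Ω)^d`
    (ρ₀ : ℕ → (Fin d → ℝ) → ℝ) (u₀ : ℕ → Fin d → (Fin d → ℝ) → ℝ)
    (Gu₀ : ℕ → Fin d → Fin d → (Fin d → ℝ) → ℝ)
    (hdata : ∃ C : ℝ, ∀ m, WellPrepared M.domain (Ma m) C (ρ₀ m) (u₀ m) (Gu₀ m))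
    (ubar₀ : Fin d → (Fin d → ℝ) → ℝ)
    (hubar₀ : ∀ i, MemLp (ubar₀ i) 2 (volume.restrict M.domain))
    (hconv₀ : ∀ i, Tendsto
      (fun m => eLpNorm (fun y => u₀ m i y - ubar₀ i y) 2 (volume.restrict M.domain))
      atTop (𝓝 0))
    -- corresponding solutions of the compressible scheme
    (ρ : ℕ → ℤ → M.CellField) (u : ℕ → ℕ → M.FaceField)
    (hsol : ∀ m, ∃ w : ℕ → M.FaceField,
      MACMesh.IsCompressibleSol γ μ lam δt (Ma m) N (ρ₀ m) (u₀ m) (ρ m) (u m) w) :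
    -- convergence of the density in `L^∞(0,T; L^q(Ω))`
    (∀ q : ℝ, 1 ≤ q → q ≤ min γ 2 →
      Tendsto (fun m => ⨆ t ∈ Set.Icc 0 T,
        eLpNorm (fun y => MACMesh.densityFun δt (ρ m) t y - 1) (ENNReal.ofReal q)
          (volume.restrict M.domain)) atTop (𝓝 0)) ∧
    -- every subsequence has a further subsequence along which the initial `δp⁰` converges
    (∀ φ : ℕ → ℕ, StrictMono φ → ∃ ψ : ℕ → ℕ, StrictMono ψ ∧ ∃ P₀ : M.CellField,
      Tendsto (fun m => MACMesh.deltaP γ (Ma (φ (ψ m))) (ρ (φ (ψ m)) 0)) atTop (𝓝 P₀)) ∧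
    -- the limit initial velocity is in `H¹₀(Ω)^d`, the field of its face averages is discretely
    -- divergence-free, and
    (∀ i, ∃ g, HasH10Grad M.domain (ubar₀ i) g) ∧
    ∃ V₀ : M.FaceField, MACMesh.IsFaceInterpolate ubar₀ V₀ ∧
      (∀ k : M.cells, MACMesh.divVel V₀ k = 0) ∧
      -- whenever the initial `δp⁰` converges, along the whole sequence (`φ = id`) or along
      -- a subsequence, so do `(u, δp)`, to the unique solution of the incompressible scheme
      ∀ φ : ℕ → ℕ, StrictMono φ → ∀ P₀ : M.CellField,
        Tendsto (fun m => MACMesh.deltaP γ (Ma (φ m)) (ρ (φ m) 0)) atTop (𝓝 P₀) →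
        ∃ (v w : ℕ → M.FaceField) (π : ℕ → M.CellField),
          MACMesh.IsIncompressibleSol μ lam δt N V₀ P₀ v w π ∧
          (∀ v' w' π', MACMesh.IsIncompressibleSol μ lam δt N V₀ P₀ v' w' π' →
            (∀ n ≤ N, v' n = v n ∧ π' n = π n) ∧ ∀ n < N, w' (n + 1) = w (n + 1)) ∧
          -- convergence for every norm (even every seminorm) on the space of discrete functions
          ∀ p : Seminorm ℝ (Fin (N + 1) → M.FaceField × M.CellField),
            Tendsto (fun m => p fun n =>
              (u (φ m) n - v n,
                MACMesh.deltaP γ (Ma (φ m)) (ρ (φ m) n) - π n)) atTop (𝓝 0) := by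
  obtain ⟨C, hC⟩ := hdata
  choose w hw using hsol
  have hb := fun m => (hC m).bounds (hMa_pos m)
  have hgrad : ∀ i, ∃ g, HasH10Grad M.domain (ubar₀ i) g := fun i =>
    exists_hasH10Grad_of_tendsto (fun m => (hC m).velocity_h10 i) (hubar₀ i)
      (fun m j => (hb m).1 i j) (hconv₀ i)
  choose g hg using hgrad
  set V₀ : M.FaceField := fun i k => M.slabMean (ubar₀ i) (g i i) i k (M.width i k) with hV₀
  have hmean : M.IsFaceInterpolate ubar₀ V₀ := fun i k =>
    MACMesh.isFaceMean_slabMean (hg i) i (MACMesh.cells_of_mem_faces k.2)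
  have hvel : Tendsto (fun m => u m 0) atTop (𝓝 V₀) := by
    refine tendsto_pi_nhds.2 fun i => tendsto_pi_nhds.2 fun k => ?_
    exact MACMesh.tendsto_faceMean (fun m => (hC m).velocity_h10 i) (hg i) i
      (fun m => (hb m).1 i i) (hconv₀ i) (MACMesh.cells_of_mem_faces k.2)
      (fun m => (hw m).init_velocity i k) (hmean i k)
  have hdiv : ∀ k : M.cells, MACMesh.divVel V₀ k = 0 := by
    intro k
    have h1 := tendsto_pi_nhds.1 ((MACMesh.continuous_divVel.tendsto _).comp hvel) k
    refine tendsto_nhds_unique h1 ?_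
    have hlim : Tendsto (fun m => (1 / M.vol k) * (Real.sqrt (M.vol k) * (C * Ma m))) atTop
        (𝓝 0) := by
      simpa using ((hMa.const_mul C).const_mul (Real.sqrt (M.vol k))).const_mul (1 / M.vol k)
    refine squeeze_zero_norm (fun m => ?_) hlim
    have hv := MACMesh.vol_pos k.2
    refine (MACMesh.abs_divVel_le (fun i => (hC m).velocity_h10 i) (hw m).init_velocity k).trans ?_
    gcongr
    exact (hb m).2.1
  have H : MACMesh.IsLowMachSequence M γ μ lam δt N Ma ρ u w V₀ :=
    { mach_pos := hMa_pos
      mach_tendsto := hMa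
      density_init := ⟨C, fun m k => by
        rw [(hw m).init_density k]
        exact (MACMesh.abs_setAverage_sub_one_le (hC m).density_memLp k.2).trans (hb m).2.2⟩
      velocity_init := hvel
      div_init := hdiv
      sol := fun m => ⟨_, _, hw m⟩ }
  have hμ' := hμ.le
  have hlam' := hμlam.le
  refine ⟨fun q _ _ => MACMesh.tendsto_densityFun hδt hN
      (fun n hn => H.tendsto_density hδt hγ hμ' hlam' hn) _, fun φ hφ => ?_,
    fun i => ⟨g i, hg i⟩, V₀, hmean, hdiv, fun φ hφ P₀ hP => ?_⟩
  · have h1 := (H.comp hφ.tendsto_atTop).isBigO_deltaP hδt hγ hμ' hlam' (Nat.zero_le N)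
    obtain ⟨P₀, ψ, hψ, hlim⟩ := exists_subseq_tendsto_of_isBigO_one h1
    exact ⟨ψ, hψ, P₀, hlim⟩
  · obtain ⟨v, z, π, hsol, hlim⟩ :=
      (H.comp hφ.tendsto_atTop).exists_tendsto hδt hγ hμ' hlam' hP
    refine ⟨v, z, π, hsol, fun v' w' π' h' => hsol.unique hδt hμ' hlam' hdiv h', fun p => ?_⟩
    refine p.tendsto_zero (tendsto_pi_nhds.2 fun n => ?_)
    obtain ⟨h1, h2⟩ := hlim n (Nat.lt_succ_iff.1 n.2)
    have h3 := (h1.sub_const (v n)).prodMk_nhds (h2.sub_const (π n))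
    rw [sub_self, sub_self] at h3
    exact h3
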